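/- Let $d\ge 1$, $T>0$, $\mathbb{T}^d=\mathbb{R}^d/\mathbb{Z}^d$ with its Lebesgue (Haar) measure, and let $b\in L^1([0,T]\times\mathbb{T}^d;\mathbb{R}^d)$, $b_t=b(t,\cdot)$, be such that for every $t\in[0,T]$ one has $b_t\in W^{1,1}(\mathbb{T}^d;\mathbb{R}^d)$, with distributional gradient $\nabla b_t$. Assume that $$\sup_{t\in[0,T]}\int_{\mathbb{T}^d}\exp\{\beta|\nabla b_t(x)|\}\,dx<\infty\quad\text{for every }\beta>0,\qquad \|\operatorname{div} b\|_{L^\infty([0,T]\times\mathbb{T}^d)}<\infty .$$ Then each $b_t$, $t\in[0,T]$, has a continuous representative (still denoted $b_t$); this representative admits a unique flow, i.e. a unique map $X:[0,T]\times\mathbb{T}^d\to\mathbb{T}^d$ such that for every $x\in\mathbb{T}^d$ the function $s\mapsto b_s(X_s(x))$ is integrable on $[0,T]$ and $$X_t(x)=x+\int_0^t b_s(X_s(x))\,ds \pmod{\mathbb{Z}^d}\qquad\text{for all } t\in[0,T];$$ and for every $t\in[0,T]$ the map $X_t:\mathbb{T}^d\to\mathbb{T}^d$ is bijective, and $X_t$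 and its inverse $(X_t)^{-1}$ belong to $W^{1,p}$ for every $1\le p<\infty$. Here a map $F:\mathbb{T}^d\to\mathbb{T}^d$ is said to belong to $W^{1,p}$ if $F(x)=x+u(x) \pmod{\mathbb{Z}^d}$ for all $x\in\mathbb{T}^d$, for some continuous $u:\mathbb{T}^d\to\mathbb{R}^d$ in the Sobolev space $W^{1,p}(\mathbb{T}^d;\mathbb{R}^d)$. -/

import Mathlib

open MeasureTheory Set
open scoped ENNReal ContDiff

/-- Euclidean space `ℝᵈ`. The torus `ℝᵈ / ℤᵈ` is Mathlib's `UnitAddTorus (Fin d)`, with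
`volume` the Haar probability measure. -/
abbrev Euc (d : ℕ) : Type := EuclideanSpace ℝ (Fin d)

/-- The canonical projection `ℝᵈ → ℝᵈ / ℤᵈ`. -/
def torusProj {d : ℕ} (v : Euc d) : UnitAddTorus (Fin d) := fun i => ((v i : ℝ) : UnitAddCircle)

/-- A function on the torus is `C^∞` if its periodic lift to `ℝᵈ` is. -/
def TorusSmooth {d : ℕ} (φ : UnitAddTorus (Fin d) → ℝ) : Prop :=
  ContDiff ℝ ∞ (fun v : Euc d => φ (torusProj v))

/-- The classical partial derivative `∂ⱼ φ` on the torus (used for smooth `φ` only). -/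
noncomputable def torusPartial {d : ℕ} (j : Fin d) (φ : UnitAddTorus (Fin d) → ℝ)
    (y : UnitAddTorus (Fin d)) : ℝ :=
  deriv (fun s : ℝ => φ (y + Pi.single j (s : UnitAddCircle))) 0

/-- `g ∈ L¹` is the distributional partial derivative `∂ⱼ f` of `f ∈ L¹` on the torus. -/
def HasWeakPartial {d : ℕ} (j : Fin d) (f g : UnitAddTorus (Fin d) → ℝ) : Prop :=
  Integrable f volume ∧ Integrable g volume ∧
    ∀ φ : UnitAddTorus (Fin d) → ℝ, TorusSmooth φ →
      ∫ y, f y * torusPartial j φ y = - ∫ y, g y * φ y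

/-- `G` is the distributional gradient of the vector field `f`: `G y i j = ∂ⱼ fᵢ (y)`. -/
def IsWeakGradient {d : ℕ} (f : UnitAddTorus (Fin d) → Euc d)
    (G : UnitAddTorus (Fin d) → Matrix (Fin d) (Fin d) ℝ) : Prop :=
  ∀ i j : Fin d, HasWeakPartial j (fun y => f y i) (fun y => G y i j)

/-- The Euclidean (Frobenius) norm `|A|` of a matrix. -/
noncomputable def matrixAbs {d : ℕ} (A : Matrix (Fin d) (Fin d) ℝ) : ℝ :=
  Real.sqrt (∑ i, ∑ j, A i j ^ 2)

/-- The Sobolev space `W^{1,p}(𝕋ᵈ; ℝᵈ)`: `f` and its distributional gradient are in `Lᵖ`. -/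
def MemW1p {d : ℕ} (p : ℝ≥0∞) (f : UnitAddTorus (Fin d) → Euc d) : Prop :=
  MemLp f p volume ∧
    ∃ G : UnitAddTorus (Fin d) → Matrix (Fin d) (Fin d) ℝ, IsWeakGradient f G ∧
      ∀ i j : Fin d, MemLp (fun y => G y i j) p volume

/-- `W^{1,p}` regularity of a torus map `F` homotopic to the identity (as flow maps are):
`F` has a continuous lift `v ↦ v + u(v)` to `ℝᵈ` whose periodic part `u`, which is unique up to
a constant in `ℤᵈ`, belongs to `W^{1,p}(𝕋ᵈ; ℝᵈ)`. Equivalently, the lift is in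
`W^{1,p}_loc(ℝᵈ; ℝᵈ)`. -/
def TorusMapMemW1p {d : ℕ} (p : ℝ≥0∞) (F : UnitAddTorus (Fin d) → UnitAddTorus (Fin d)) : Prop :=
  ∃ u : UnitAddTorus (Fin d) → Euc d,
    Continuous u ∧ (∀ y, F y = y + torusProj (u y)) ∧ MemW1p p u

/-- `X` is a flow of `b` on `[0,T]`: for every `x`, the curve `t ↦ X t x` is an absolutely
continuous solution of `∂ₜ X = b(t, X)`, `X(0,x) = x`, written in integral form (`b` is merely
measurable in time). -/
def IsFlow {d : ℕ} (T : ℝ) (b : ℝ → UnitAddTorus (Fin d) → Euc d)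
    (X : ℝ → UnitAddTorus (Fin d) → UnitAddTorus (Fin d)) : Prop :=
  ∀ x, IntegrableOn (fun s => b s (X s x)) (Icc 0 T) volume ∧
    ∀ t ∈ Icc 0 T, X t x = x + torusProj (∫ s in (0 : ℝ)..t, b s (X s x))

open Filter Topology

/-! ### The torus and its projection -/

/-! Exponential integrability of the gradient for every β is almost a Lipschitz bound. Comparing two
points with the average over one ball between them gives |f(x+w) − f(x)| ≤ A|w| + B e^{−λA} for all
A ≥ A₀, a linearized form of a log-Lipschitz modulus (`exists_modulus`). Since β is free, λ can be
prescribed, with B and A₀ depending on it. By Jensen, mollification keeps the exponential moments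
and the divergence bound, so the modulus is uniform in time and in the mollification parameter.
Hence the mollifications converge uniformly to a continuous representative (`contRep`).

Gronwall with slope A amplifies errors by e^{AT}. Taking λ = T + 1, the remainder B e^{−λA} beats
this factor as A grows, so approximate solutions from one point with small errors stay close
(`ExpField.stability`). This gives uniqueness, and uniform convergence of any scheme whose error
tends to zero (`ExpField.exists_limit`).

The scheme is the Euler method for the mollified field; its maps are compositions of small
perturbations of the identity. Bounded divergence keeps the Jacobian of a step of length h above 1 −
O(h), so the compositions compress measure by a bounded factor. The derivative of a composition is
at most the exponential of the summed step derivatives along the orbit; Jensen and bounded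
compression reduce its p-th moment to an exponential moment of ∇b with β proportional to pT
(`lintegral_compDispDeriv_pow_le`). These bounds, uniform along the scheme, pass to the limit by
weak compactness (`memW1p_of_tendsto`).

The inverse of the time-t map is the time-t map of the reversed field, which satisfies the same
hypotheses, so it has the same regularity (`ExpField.exists_inverse`). -/

instance torus_isProbabilityMeasure {d : ℕ} :
    IsProbabilityMeasure (volume : Measure (UnitAddTorus (Fin d))) :=
  ⟨by rw [volume_pi, Measure.pi_univ]; simp⟩

instance torus_isNegInvariant {d : ℕ} :
    (volume : Measure (UnitAddTorus (Fin d))).IsNegInvariant :=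
  Measure.IsAddHaarMeasure.isNegInvariant_of_regular _

section Torus
variable {d : ℕ}

@[simp] theorem torusProj_zero : torusProj (0 : Euc d) = 0 := by
  ext i; simp [torusProj]

theorem torusProj_add (v w : Euc d) : torusProj (v + w) = torusProj v + torusProj w := by
  ext i; simp [torusProj]

theorem torusProj_neg (v : Euc d) : torusProj (-v) = -torusProj v := by
  ext i; simp [torusProj]

theorem torusProj_sub (v w : Euc d) : torusProj (v - w) = torusProj v - torusProj w := by
  ext i; simp [torusProj]

theorem isOpenQuotientMap_torusProj : IsOpenQuotientMap (torusProj : Euc d → UnitAddTorus (Fin d)) := by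
  have h : IsOpenQuotientMap (Pi.map (fun (_ : Fin d) (x : ℝ) => (x : UnitAddCircle))) :=
    IsOpenQuotientMap.piMap fun _ => QuotientAddGroup.isOpenQuotientMap_mk
  exact h.comp (PiLp.homeomorph 2 (fun _ : Fin d => ℝ)).isOpenQuotientMap

theorem continuous_torusProj : Continuous (torusProj : Euc d → UnitAddTorus (Fin d)) :=
  isOpenQuotientMap_torusProj.continuous

theorem torusProj_surjective : Function.Surjective (torusProj : Euc d → UnitAddTorus (Fin d)) :=
  isOpenQuotientMap_torusProj.surjective

theorem torusProj_eq_iff {v w : Euc d} :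
    torusProj v = torusProj w ↔ ∃ k : Fin d → ℤ, ∀ i, v i = w i + k i := by
  constructor
  · intro h
    have : ∀ i, ∃ k : ℤ, v i = w i + k := by
      intro i
      have := congrFun h i
      simp only [torusProj] at this
      rw [← sub_eq_zero, ← AddCircle.coe_sub, AddCircle.coe_eq_zero_iff] at this
      obtain ⟨n, hn⟩ := this
      exact ⟨n, by simp at hn; linarith⟩
    choose k hk using this
    exact ⟨k, hk⟩
  · rintro ⟨k, hk⟩
    ext i
    simp only [torusProj]
    rw [← sub_eq_zero, ← AddCircle.coe_sub, AddCircle.coe_eq_zero_iff]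
    exact ⟨k i, by rw [hk]; simp⟩

theorem exists_torusProj_eq (y : UnitAddTorus (Fin d)) :
    ∃ w : Euc d, torusProj w = y ∧ ∀ i, |w i| = ‖y i‖ := by
  have : ∀ i, ∃ r : ℝ, (r : UnitAddCircle) = y i ∧ |r| = ‖y i‖ := by
    intro i
    obtain ⟨r, hr⟩ := QuotientAddGroup.mk_surjective (y i)
    refine ⟨r - round r, ?_, ?_⟩
    · rw [← hr]
      rw [← sub_eq_zero]
      change ((r - round r : ℝ) : UnitAddCircle) - (r : UnitAddCircle) = 0
      rw [← AddCircle.coe_sub, AddCircle.coe_eq_zero_iff]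
      exact ⟨-round r, by simp⟩
    · rw [← hr]
      exact (UnitAddCircle.norm_eq).symm
  choose r hr hr' using this
  exact ⟨WithLp.toLp 2 r, by ext i; simp [torusProj, hr], fun i => by simp [hr']⟩

theorem euc_norm_le_sum (w : Euc d) : ‖w‖ ≤ ∑ i, |w i| := by
  rw [EuclideanSpace.norm_eq]
  refine Real.sqrt_le_iff.2 ⟨Finset.sum_nonneg fun _ _ => abs_nonneg _, ?_⟩
  simpa using Finset.sum_sq_le_sq_sum_of_nonneg (s := Finset.univ) (f := fun i => |w i|)
    (fun _ _ => abs_nonneg _)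

theorem euc_abs_apply_le (w : Euc d) (i : Fin d) : |w i| ≤ ‖w‖ := PiLp.norm_apply_le w i

theorem exists_torusProj_norm_le (y : UnitAddTorus (Fin d)) :
    ∃ w : Euc d, torusProj w = y ∧ ‖w‖ ≤ d * ‖y‖ := by
  obtain ⟨w, hw, hw'⟩ := exists_torusProj_eq y
  refine ⟨w, hw, (euc_norm_le_sum w).trans ?_⟩
  calc ∑ i, |w i| ≤ ∑ _i : Fin d, ‖y‖ :=
        Finset.sum_le_sum fun i _ => (hw' i).le.trans (norm_le_pi_norm y i)
    _ = d * ‖y‖ := by simp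

/-- The half-open unit cube with corner `a`. -/
def unitCube (a : Fin d → ℝ) : Set (Euc d) := {v | ∀ i, v i ∈ Ioc (a i) (a i + 1)}

theorem measurableSet_unitCube (a : Fin d → ℝ) : MeasurableSet (unitCube a) := by
  have : unitCube a = WithLp.ofLp ⁻¹' {v : Fin d → ℝ | ∀ i, v i ∈ Ioc (a i) (a i + 1)} := rfl
  rw [this]
  exact (PiLp.volume_preserving_ofLp (Fin d)).measurable
    (MeasurableSet.univ_pi' fun i => measurableSet_Ioc)

theorem lintegral_torus_eq (f : UnitAddTorus (Fin d) → ℝ≥0∞) (a : Fin d → ℝ) :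
    ∫⁻ x, f x = ∫⁻ v in unitCube a, f (torusProj v) := by
  -- The circle has length one, so its volume is the normalized Haar measure.
  have hvol : (Measure.pi fun _ : Fin d => (AddCircle.haarAddCircle : Measure UnitAddCircle)) =
      volume := by
    rw [volume_pi]
    congr 1
    ext1 i
    rw [AddCircle.volume_eq_smul_haarAddCircle]
    simp
  have h0 := UnitAddTorus.lintegral_preimage f a
  change ∫⁻ x, f x ∂(Measure.pi fun _ : Fin d => AddCircle.haarAddCircle) = _ at h0
  rw [hvol] at h0
  rw [h0]
  have h := (PiLp.volume_preserving_ofLp (Fin d)).setLIntegral_comp_preimage_emb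
    (MeasurableEquiv.toLp 2 (Fin d → ℝ)).symm.measurableEmbedding
    (fun x : Fin d → ℝ => f fun i => (x i : UnitAddCircle)) {v : Fin d → ℝ | ∀ i, v i ∈ Ioc (a i) (a i + 1)}
  exact h.symm

theorem volume_unitCube (a : Fin d → ℝ) : volume (unitCube a) = 1 := by
  have h := lintegral_torus_eq (fun _ => 1) a
  simpa using h.symm

theorem injOn_torusProj_unitCube (a : Fin d → ℝ) : InjOn torusProj (unitCube a) := by
  intro v hv w hw h
  obtain ⟨k, hk⟩ := torusProj_eq_iff.1 h
  ext i
  have h1 := hv i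
  have h2 := hw i
  have h3 := hk i
  simp only [mem_Ioc] at h1 h2
  have : k i = 0 := by
    have a1 : (k i : ℝ) < 1 := by linarith
    have a2 : (-1 : ℝ) < k i := by linarith
    norm_cast at a1
    have a2' : ((-1 : ℤ) : ℝ) < k i := by simpa using a2
    norm_cast at a2'
    omega
  rw [h3, this]; simp

theorem injOn_torusProj_of_dist_lt {S : Set (Euc d)} (hS : ∀ v ∈ S, ∀ w ∈ S, ‖v - w‖ < 1) :
    InjOn torusProj S := by
  intro v hv w hw h
  obtain ⟨k, hk⟩ := torusProj_eq_iff.1 h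
  ext i
  have h3 := hk i
  have h4 := (euc_abs_apply_le (v - w) i).trans_lt (hS v hv w hw)
  have : k i = 0 := by
    have : |(k i : ℝ)| < 1 := by simpa [h3] using h4
    exact_mod_cast Int.abs_lt_one_iff.1 (by exact_mod_cast this)
  rw [h3, this]; simp

/-- Cut S along the integer unit cubes: each piece lies in a fundamental domain, and by injectivity
on S the projected pieces are disjoint. -/
theorem setLIntegral_torusProj_le {S : Set (Euc d)} (hS : MeasurableSet S) (hinj : InjOn torusProj S)
    {g : UnitAddTorus (Fin d) → ℝ≥0∞} :
    ∫⁻ v in S, g (torusProj v) ≤ ∫⁻ y, g y := by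
  set Q : (Fin d → ℤ) → Set (Euc d) := fun k => unitCube fun i => (k i : ℝ) with hQ
  -- The cubes are open on the left and closed on the right, so the index of the cube containing v
  -- is the ceiling minus one.
  have hmem : ∀ v : Euc d, ∀ k, v ∈ Q k ↔ k = fun i => ⌈v i⌉ - 1 := by
    intro v k
    simp only [hQ, unitCube, mem_ofPred_eq, mem_Ioc, funext_iff]
    refine forall_congr' fun i => ?_
    rw [eq_sub_iff_add_eq, eq_comm, Int.ceil_eq_iff]
    push_cast
    constructor <;> rintro ⟨h1, h2⟩ <;> constructor <;> linarith
  have hQm : ∀ k, MeasurableSet (Q k) := fun k => measurableSet_unitCube _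
  have hdisj : Pairwise (Function.onFun Disjoint fun k => S ∩ Q k) := by
    intro k l hkl
    refine Set.disjoint_left.2 fun v hv hv' => hkl ?_
    rw [(hmem v k).1 hv.2, (hmem v l).1 hv'.2]
  have hU : S = ⋃ k, S ∩ Q k := by
    ext v
    simp only [mem_iUnion, mem_inter_iff]
    exact ⟨fun h => ⟨_, h, (hmem v _).2 rfl⟩, fun ⟨_, h, _⟩ => h⟩
  have hA : ∀ k, MeasurableSet (torusProj '' (S ∩ Q k)) := fun k =>
    (hS.inter (hQm k)).image_of_measurable_injOn continuous_torusProj.measurable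
      (hinj.mono inter_subset_left)
  have hAd : Pairwise (Function.onFun Disjoint fun k => torusProj '' (S ∩ Q k)) := by
    intro k l hkl
    refine Set.disjoint_left.2 ?_
    rintro _ ⟨v, hv, rfl⟩ ⟨w, hw, h⟩
    have := hinj hw.1 hv.1 h
    subst this
    exact Set.disjoint_left.1 (hdisj hkl) hv hw
  rw [hU, lintegral_iUnion (fun k => hS.inter (hQm k)) hdisj]
  have key : ∀ k, ∫⁻ v in S ∩ Q k, g (torusProj v) = ∫⁻ y in torusProj '' (S ∩ Q k), g y := by
    intro k
    rw [← lintegral_indicator (hA k), lintegral_torus_eq _ fun i => (k i : ℝ)]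
    change _ = ∫⁻ v in Q k, _
    rw [← Measure.restrict_restrict hS, ← lintegral_indicator hS]
    refine setLIntegral_congr_fun (hQm k) fun v hv => ?_
    by_cases hvS : v ∈ S
    · have : torusProj v ∈ torusProj '' (S ∩ Q k) := ⟨v, ⟨hvS, hv⟩, rfl⟩
      simp [hvS, this]
    · have : torusProj v ∉ torusProj '' (S ∩ Q k) := by
        rintro ⟨w, hw, hwv⟩
        have := injOn_torusProj_unitCube _ hw.2 hv hwv
        exact hvS (this ▸ hw.1)
      simp [hvS, this]
  simp_rw [key]
  rw [← lintegral_iUnion hA hAd]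
  exact setLIntegral_le_lintegral _ _

/-- `f` is a `C¹` function on the torus with derivative `f'`. -/
def TorusC1 {F : Type*} [NormedAddCommGroup F] [NormedSpace ℝ F]
    (f : UnitAddTorus (Fin d) → F) (f' : UnitAddTorus (Fin d) → Euc d →L[ℝ] F) : Prop :=
  Continuous f' ∧ ∀ y, HasFDerivAt (fun v : Euc d => f (y + torusProj v)) (f' y) 0

section C1
variable {F : Type*} [NormedAddCommGroup F] [NormedSpace ℝ F]
  {f : UnitAddTorus (Fin d) → F} {f' : UnitAddTorus (Fin d) → Euc d →L[ℝ] F}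

theorem TorusC1.hasFDerivAt (h : TorusC1 f f') (y : UnitAddTorus (Fin d)) (v : Euc d) :
    HasFDerivAt (fun v : Euc d => f (y + torusProj v)) (f' (y + torusProj v)) v := by
  have h1 := h.2 (y + torusProj v)
  have h2 : HasFDerivAt (fun w : Euc d => w - v) (ContinuousLinearMap.id ℝ (Euc d)) v :=
    (hasFDerivAt_id v).sub_const v
  have h3 : HasFDerivAt (fun w : Euc d => f (y + torusProj v + torusProj w))
      (f' (y + torusProj v)) (v - v) := by rw [sub_self]; exact h1
  have h4 := HasFDerivAt.comp (f := fun w : Euc d => w - v) v h3 h2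
  convert! h4 using 1
  ext w
  simp [torusProj_sub]

theorem TorusC1.continuous (h : TorusC1 f f') : Continuous f := by
  rw [isOpenQuotientMap_torusProj.isQuotientMap.continuous_iff]
  have : f ∘ torusProj = fun v : Euc d => f (0 + torusProj v) := by ext; simp
  rw [this]
  exact continuous_iff_continuousAt.2 fun v => (h.hasFDerivAt 0 v).continuousAt

end C1

/-- Perturbations of the identity with Jacobian bounded below have bounded compression. -/
theorem lintegral_comp_add_torusProj_le {W : UnitAddTorus (Fin d) → Euc d}
    {W' : UnitAddTorus (Fin d) → Euc d →L[ℝ] Euc d} (hW : TorusC1 W W')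
    {r : ℝ} (hr1 : r < 1) (hr : ∀ y, ‖W' y‖ ≤ r) {c : ℝ} (hc : 0 < c)
    (hdet : ∀ y, c ≤ (ContinuousLinearMap.id ℝ (Euc d) + W' y).det)
    {g : UnitAddTorus (Fin d) → ℝ≥0∞} (hg : Measurable g) :
    ∫⁻ y, g (y + torusProj (W y)) ≤ ENNReal.ofReal c⁻¹ * ∫⁻ y, g y := by
  set Φ : Euc d → Euc d := fun v => v + W (torusProj v) with hΦ
  have hWd : ∀ v, HasFDerivAt (fun v => W (torusProj v)) (W' (torusProj v)) v := by
    intro v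
    simpa using hW.hasFDerivAt 0 v
  have hΦd : ∀ v, HasFDerivAt Φ (ContinuousLinearMap.id ℝ (Euc d) + W' (torusProj v)) v := fun v =>
    (hasFDerivAt_id v).add (hWd v)
  have hlip : ∀ v w, ‖W (torusProj v) - W (torusProj w)‖ ≤ r * ‖v - w‖ := fun v w =>
    Convex.norm_image_sub_le_of_norm_hasFDerivWithin_le (s := univ)
      (fun x _ => (hWd x).hasFDerivWithinAt) (fun x _ => hr _) convex_univ (mem_univ _) (mem_univ _)
  -- The displacement is a strict contraction, so it cannot cancel v − w.
  have hinj : Function.Injective Φ := by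
    intro v w h
    have h1 : v - w = -(W (torusProj v) - W (torusProj w)) := by
      simp only [hΦ] at h
      rw [neg_sub, sub_eq_sub_iff_add_eq_add, h, add_comm]
    have h2 : ‖v - w‖ ≤ r * ‖v - w‖ := by
      conv_lhs => rw [h1, norm_neg]
      exact hlip v w
    have h3 : ‖v - w‖ = 0 := by nlinarith [norm_nonneg (v - w)]
    exact sub_eq_zero.1 (norm_eq_zero.1 h3)
  set Q : Set (Euc d) := unitCube 0 with hQ
  have hQm : MeasurableSet Q := measurableSet_unitCube _
  have hPΦ : ∀ v, torusProj (Φ v) = torusProj v + torusProj (W (torusProj v)) := fun v =>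
    torusProj_add _ _
  -- If Φ v and Φ w differ by an integer vector k, periodicity of W gives Φ v = Φ (w + k), hence v =
  -- w + k; two points of one cube congruent mod ℤᵈ coincide.
  have hinj2 : InjOn torusProj (Φ '' Q) := by
    rintro _ ⟨v, hv, rfl⟩ _ ⟨w, hw, rfl⟩ h
    obtain ⟨k, hk⟩ := torusProj_eq_iff.1 h
    set kv : Euc d := WithLp.toLp 2 fun i => (k i : ℝ) with hkv
    have h1 : Φ v = Φ w + kv := by
      ext i; simp [hkv, hk i]
    have h2 : torusProj (w + kv) = torusProj w :=
      torusProj_eq_iff.2 ⟨k, fun i => by simp [hkv]⟩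
    have h3 : Φ v = Φ (w + kv) := by
      rw [h1]; simp only [hΦ, h2]; abel
    have h4 := hinj h3
    have h5 : v = w := injOn_torusProj_unitCube _ hv hw (by rw [h4, h2])
    rw [h5]
  have hΦm : MeasurableSet (Φ '' Q) :=
    hQm.image_of_continuousOn_injOn
      (fun v _ => (hΦd v).continuousAt.continuousWithinAt) hinj.injOn
  have hcv := lintegral_image_eq_lintegral_abs_det_fderiv_mul volume hQm
    (fun v _ => (hΦd v).hasFDerivWithinAt) hinj.injOn (fun v => g (torusProj v))
  -- Only injectivity is needed for this inequality: the image may be a proper subset of the torus.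
  have h1 : ENNReal.ofReal c * ∫⁻ y, g (y + torusProj (W y)) ≤ ∫⁻ y, g y := by
    rw [lintegral_torus_eq _ 0, ← lintegral_const_mul]
    · refine le_trans ?_ (setLIntegral_torusProj_le hΦm hinj2)
      rw [hcv]
      refine setLIntegral_mono' hQm fun v _ => ?_
      rw [hPΦ]
      gcongr
      exact (hdet _).trans (le_abs_self _)
    · have := hW.continuous
      have := continuous_torusProj (d := d)
      exact hg.comp (by fun_prop : Continuous fun v : Euc d =>
        torusProj v + torusProj (W (torusProj v))).measurable
  rw [ENNReal.ofReal_inv_of_pos hc]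
  rw [← ENNReal.div_eq_inv_mul, ENNReal.le_div_iff_mul_le (by simp [hc]) (by simp), mul_comm]
  exact h1

end Torus

/-! ### A mollifier on the torus -/

section Kernel
variable {d : ℕ}

/-- A trigonometric polynomial on the torus with a strict maximum at the origin. -/
noncomputable def bump (y : UnitAddTorus (Fin d)) : ℝ :=
  ∏ i, (1 + ((AddCircle.toCircle (y i) : Circle) : ℂ).re) / 2

theorem continuous_bump : Continuous (bump (d := d)) := by
  unfold bump
  have := AddCircle.continuous_toCircle (T := (1 : ℝ))
  fun_prop

theorem bump_factor_mem (z : UnitAddCircle) :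
    0 ≤ (1 + ((AddCircle.toCircle z : Circle) : ℂ).re) / 2 ∧
      (1 + ((AddCircle.toCircle z : Circle) : ℂ).re) / 2 ≤ 1 := by
  have h := Complex.abs_re_le_norm ((AddCircle.toCircle z : Circle) : ℂ)
  rw [Circle.norm_coe, abs_le] at h
  constructor <;> linarith [h.1, h.2]

theorem bump_nonneg (y : UnitAddTorus (Fin d)) : 0 ≤ bump y :=
  Finset.prod_nonneg fun i _ => (bump_factor_mem (y i)).1

@[simp] theorem bump_zero : bump (0 : UnitAddTorus (Fin d)) = 1 := by
  simp [bump]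

theorem bump_lt_one {y : UnitAddTorus (Fin d)} (hy : y ≠ 0) : bump y < 1 := by
  obtain ⟨i, hi⟩ := Function.ne_iff.1 hy
  have hlt : (1 + ((AddCircle.toCircle (y i) : Circle) : ℂ).re) / 2 < 1 := by
    refine lt_of_le_of_ne (bump_factor_mem (y i)).2 fun h => hi ?_
    have hre : ((AddCircle.toCircle (y i) : Circle) : ℂ).re = 1 := by linarith
    have hn : Complex.normSq ((AddCircle.toCircle (y i) : Circle) : ℂ) = 1 := Circle.normSq_coe _
    rw [Complex.normSq_apply, hre] at hn
    have him : ((AddCircle.toCircle (y i) : Circle) : ℂ).im = 0 := by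
      have : ((AddCircle.toCircle (y i) : Circle) : ℂ).im *
        ((AddCircle.toCircle (y i) : Circle) : ℂ).im = 0 := by linarith
      exact mul_self_eq_zero.1 this
    have h1 : AddCircle.toCircle (y i) = AddCircle.toCircle (0 : UnitAddCircle) := by
      rw [AddCircle.toCircle_zero]
      ext
      exact Complex.ext (by simpa using hre) (by simpa using him)
    exact AddCircle.injective_toCircle one_ne_zero h1
  unfold bump
  rw [← Finset.mul_prod_erase _ _ (Finset.mem_univ i)]
  calc _ ≤ (1 + ((AddCircle.toCircle (y i) : Circle) : ℂ).re) / 2 * 1 := by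
        refine mul_le_mul_of_nonneg_left ?_ (bump_factor_mem _).1
        exact Finset.prod_le_one (fun j _ => (bump_factor_mem _).1) fun j _ => (bump_factor_mem _).2
    _ < 1 := by simpa using hlt

theorem bump_torusProj (v : Euc d) :
    bump (torusProj v) = ∏ i, (1 + Real.cos (2 * Real.pi * v i)) / 2 := by
  unfold bump torusProj
  refine Finset.prod_congr rfl fun i _ => ?_
  rw [AddCircle.toCircle_apply_mk, Circle.coe_exp]
  rw [Complex.exp_ofReal_mul_I_re]
  simp

theorem integral_bump_pow_pos (N : ℕ) : 0 < ∫ y : UnitAddTorus (Fin d), bump y ^ N := by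
  have hc : Continuous fun y : UnitAddTorus (Fin d) => bump y ^ N := continuous_bump.pow N
  refine hc.integral_pos_of_hasCompactSupport_nonneg_nonzero (HasCompactSupport.of_compactSpace _)
    (fun y => pow_nonneg (bump_nonneg y) N) (x := 0) (by simp)

/-- The mollifying kernels on the torus: normalized powers of `bump`. -/
noncomputable def moll (N : ℕ) (y : UnitAddTorus (Fin d)) : ℝ :=
  (∫ z : UnitAddTorus (Fin d), bump z ^ N)⁻¹ * bump y ^ N

theorem continuous_moll (N : ℕ) : Continuous (moll (d := d) N) :=
  continuous_const.mul (continuous_bump.pow N)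

theorem moll_nonneg (N : ℕ) (y : UnitAddTorus (Fin d)) : 0 ≤ moll N y :=
  mul_nonneg (inv_nonneg.2 (integral_bump_pow_pos N).le) (pow_nonneg (bump_nonneg y) N)

theorem integral_moll (N : ℕ) : ∫ y : UnitAddTorus (Fin d), moll N y = 1 := by
  simp only [moll]
  rw [integral_const_mul, inv_mul_cancel₀ (integral_bump_pow_pos N).ne']

theorem integrable_moll (N : ℕ) : Integrable (moll (d := d) N) :=
  (continuous_moll N).integrable_of_hasCompactSupport (HasCompactSupport.of_compactSpace _)

theorem integral_moll_sub (N : ℕ) (x : UnitAddTorus (Fin d)) : ∫ y, moll N (x - y) = 1 := by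
  rw [integral_sub_left_eq_self (moll N) volume x, integral_moll]

/-- Normalized powers of a function with a unique maximum concentrate their mass at the maximum
point. -/
theorem tendsto_integral_moll_mul {g : UnitAddTorus (Fin d) → ℝ} (hg : Continuous g) :
    Tendsto (fun N => ∫ y, moll N y * g y) atTop (𝓝 (g 0)) := by
  have h := tendsto_setIntegral_pow_smul_of_unique_maximum_of_isCompact_of_continuousOn
    (μ := (volume : Measure (UnitAddTorus (Fin d)))) (s := univ) (x₀ := 0) (g := g) isCompact_univ
    continuous_bump.continuousOn (fun y _ hy => by simpa using bump_lt_one hy)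
    (fun y _ => bump_nonneg y) (by simp) (by simp) hg.continuousOn
  refine h.congr fun N => ?_
  simp only [Measure.restrict_univ, smul_eq_mul, moll]
  rw [← integral_const_mul]
  simp [mul_assoc]

theorem torusSmooth_moll (N : ℕ) : TorusSmooth (moll (d := d) N) := by
  unfold TorusSmooth moll
  simp only [bump_torusProj]
  fun_prop

/-- The derivative of a function on the torus. -/
noncomputable def torusFDeriv {F : Type*} [NormedAddCommGroup F] [NormedSpace ℝ F]
    (f : UnitAddTorus (Fin d) → F) (y : UnitAddTorus (Fin d)) : Euc d →L[ℝ] F :=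
  fderiv ℝ (fun v : Euc d => f (y + torusProj v)) 0

theorem TorusSmooth.torusC1 {φ : UnitAddTorus (Fin d) → ℝ} (h : TorusSmooth φ) :
    TorusC1 φ (torusFDeriv φ) := by
  have h1 : ∀ w : Euc d, HasFDerivAt (fun v : Euc d => φ (torusProj w + torusProj v))
      (fderiv ℝ (fun v : Euc d => φ (torusProj v)) w) 0 := by
    intro w
    have h2 : HasFDerivAt (fun v : Euc d => φ (torusProj v))
        (fderiv ℝ (fun v : Euc d => φ (torusProj v)) w) (w + 0) := by
      rw [add_zero]
      exact ((h.differentiable (by simp)) w).hasFDerivAt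
    have h3 : HasFDerivAt (fun v : Euc d => w + v) (ContinuousLinearMap.id ℝ (Euc d)) 0 :=
      (hasFDerivAt_id _).const_add w
    have h4 := HasFDerivAt.comp (f := fun v : Euc d => w + v) 0 h2 h3
    simpa only [Function.comp_def, torusProj_add, ContinuousLinearMap.comp_id] using h4
  refine ⟨?_, fun y => ?_⟩
  · rw [isOpenQuotientMap_torusProj.isQuotientMap.continuous_iff]
    have : torusFDeriv φ ∘ torusProj = fderiv ℝ (fun v : Euc d => φ (torusProj v)) := by
      ext1 w
      exact (h1 w).fderiv
    rw [this]
    exact h.continuous_fderiv (by simp)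
  · obtain ⟨w, rfl⟩ := torusProj_surjective y
    exact (h1 w).differentiableAt.hasFDerivAt

theorem TorusSmooth.comp_sub_left {φ : UnitAddTorus (Fin d) → ℝ} (h : TorusSmooth φ)
    (x : UnitAddTorus (Fin d)) : TorusSmooth fun y => φ (x - y) := by
  obtain ⟨w, rfl⟩ := torusProj_surjective x
  have : ContDiff ℝ ∞ ((fun v : Euc d => φ (torusProj v)) ∘ fun v => w - v) :=
    ContDiff.comp h (contDiff_const.sub contDiff_id)
  simpa only [TorusSmooth, Function.comp_def, torusProj_sub] using this

theorem torusProj_single (j : Fin d) (s : ℝ) :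
    torusProj (EuclideanSpace.single j s) = Pi.single j (s : UnitAddCircle) := by
  ext i
  by_cases h : i = j
  · subst h; simp [torusProj]
  · simp [torusProj, h]

theorem TorusC1.hasDerivAt_single {f : UnitAddTorus (Fin d) → ℝ}
    {f' : UnitAddTorus (Fin d) → Euc d →L[ℝ] ℝ} (h : TorusC1 f f') (j : Fin d)
    (y : UnitAddTorus (Fin d)) (t : ℝ) :
    HasDerivAt (fun s : ℝ => f (y + Pi.single j (s : UnitAddCircle)))
      (f' (y + Pi.single j (t : UnitAddCircle)) (EuclideanSpace.single j 1)) t := by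
  have h1 := h.hasFDerivAt y (EuclideanSpace.single j t)
  have h2 : HasDerivAt (fun s : ℝ => s • (EuclideanSpace.single j 1 : Euc d))
      ((1 : ℝ) • (EuclideanSpace.single j 1 : Euc d)) t := (hasDerivAt_id t).smul_const _
  have h3 : (fun s : ℝ => s • (EuclideanSpace.single j 1 : Euc d)) =
      fun s => EuclideanSpace.single j s := by
    ext s i; simp
  rw [h3, one_smul] at h2
  have h4 := h1.comp_hasDerivAt t h2
  rw [torusProj_single] at h4
  convert! h4 using 1
  ext s
  simp [torusProj_single]

theorem TorusC1.torusPartial_eq {f : UnitAddTorus (Fin d) → ℝ}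
    {f' : UnitAddTorus (Fin d) → Euc d →L[ℝ] ℝ} (h : TorusC1 f f') (j : Fin d)
    (y : UnitAddTorus (Fin d)) : torusPartial j f y = f' y (EuclideanSpace.single j 1) := by
  have := h.hasDerivAt_single j y 0
  simp only [AddCircle.coe_zero, Pi.single_zero, add_zero] at this
  exact this.deriv

/-! ### Convolution on the torus and its derivative. -/

section Conv
variable {F : Type*} [NormedAddCommGroup F] [NormedSpace ℝ F]

/-- Convolution on the torus. -/
noncomputable def torusConv (K : UnitAddTorus (Fin d) → ℝ) (f : UnitAddTorus (Fin d) → F)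
    (x : UnitAddTorus (Fin d)) : F := ∫ y, K (x - y) • f y

/-- The derivative of a convolution on the torus. -/
noncomputable def torusConvDeriv (K : UnitAddTorus (Fin d) → ℝ) (f : UnitAddTorus (Fin d) → F)
    (x : UnitAddTorus (Fin d)) : Euc d →L[ℝ] F := ∫ y, (torusFDeriv K (x - y)).smulRight (f y)

theorem exists_norm_bound {G : Type*} [NormedAddCommGroup G] {f : UnitAddTorus (Fin d) → G}
    (hf : Continuous f) : ∃ C, 0 ≤ C ∧ ∀ y, ‖f y‖ ≤ C := by
  obtain ⟨C, hC⟩ := isCompact_univ.exists_bound_of_continuousOn hf.continuousOn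
  exact ⟨C, (norm_nonneg _).trans (hC 0 (mem_univ _)), fun y => hC y (mem_univ _)⟩

theorem Continuous.integrable_torus {G : Type*} [NormedAddCommGroup G]
    {f : UnitAddTorus (Fin d) → G} (hf : Continuous f) : Integrable f :=
  hf.integrable_of_hasCompactSupport (HasCompactSupport.of_compactSpace _)

theorem integrable_smul_of_continuous {k : UnitAddTorus (Fin d) → ℝ} (hk : Continuous k)
    {f : UnitAddTorus (Fin d) → F} (hf : Integrable f) : Integrable fun y => k y • f y := by
  obtain ⟨C, -, hC⟩ := exists_norm_bound hk
  exact hf.bdd_smul C hk.aestronglyMeasurable (Eventually.of_forall hC)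

theorem integrable_torusConv {K : UnitAddTorus (Fin d) → ℝ} (hK : Continuous K)
    {f : UnitAddTorus (Fin d) → F} (hf : Integrable f) (x : UnitAddTorus (Fin d)) :
    Integrable fun y => K (x - y) • f y :=
  integrable_smul_of_continuous (by fun_prop) hf

theorem norm_torusConv_le {K : UnitAddTorus (Fin d) → ℝ} {C : ℝ} (hC : ∀ y, ‖K y‖ ≤ C)
    {f : UnitAddTorus (Fin d) → F} (hf : Integrable f) (x : UnitAddTorus (Fin d)) :
    ‖torusConv K f x‖ ≤ C * ∫ y, ‖f y‖ := by
  rw [← integral_const_mul]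
  refine norm_integral_le_of_norm_le (hf.norm.const_mul C) (Eventually.of_forall fun y => ?_)
  rw [norm_smul]
  exact mul_le_mul_of_nonneg_right (hC _) (norm_nonneg _)

theorem aestronglyMeasurable_smulRight {k : UnitAddTorus (Fin d) → Euc d →L[ℝ] ℝ}
    (hk : Continuous k) {f : UnitAddTorus (Fin d) → F} (hf : AEStronglyMeasurable f) :
    AEStronglyMeasurable (fun y => (k y).smulRight (f y)) volume :=
  (ContinuousLinearMap.smulRightL ℝ (Euc d) F).aestronglyMeasurable_comp₂
    hk.aestronglyMeasurable hf

theorem integrable_smulRight {k : UnitAddTorus (Fin d) → Euc d →L[ℝ] ℝ}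
    (hk : Continuous k) {f : UnitAddTorus (Fin d) → F} (hf : Integrable f) :
    Integrable (fun y => (k y).smulRight (f y)) volume := by
  obtain ⟨C, -, hC⟩ := exists_norm_bound hk
  refine (hf.norm.const_mul C).mono' (aestronglyMeasurable_smulRight hk hf.1)
    (Eventually.of_forall fun y => ?_)
  rw [ContinuousLinearMap.norm_smulRight_apply]
  exact mul_le_mul_of_nonneg_right (hC _) (norm_nonneg _)

theorem torusC1_torusConv [CompleteSpace F] {K : UnitAddTorus (Fin d) → ℝ}
    (hK : TorusC1 K (torusFDeriv K))
    {f : UnitAddTorus (Fin d) → F} (hf : Integrable f) :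
    TorusC1 (torusConv K f) (torusConvDeriv K f) := by
  have hKc := hK.continuous
  have hK'c := hK.1
  obtain ⟨C, -, hC⟩ := exists_norm_bound hK.1
  have hb : ∀ z y, ‖(torusFDeriv K z).smulRight (f y)‖ ≤ C * ‖f y‖ := fun z y => by
    rw [ContinuousLinearMap.norm_smulRight_apply]
    exact mul_le_mul_of_nonneg_right (hC _) (norm_nonneg _)
  refine ⟨?_, fun x => ?_⟩
  · refine continuous_of_dominated (F := fun x y => (torusFDeriv K (x - y)).smulRight (f y))
      (fun x => aestronglyMeasurable_smulRight (by fun_prop) hf.1)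
      (fun x => Eventually.of_forall fun y => hb _ y) (hf.norm.const_mul C)
      (Eventually.of_forall fun y => ?_)
    have h1 : Continuous fun x => torusFDeriv K (x - y) := by fun_prop
    exact ((ContinuousLinearMap.smulRightL ℝ (Euc d) F).flip (f y)).continuous.comp h1
  · have key := hasFDerivAt_integral_of_dominated_of_fderiv_le (𝕜 := ℝ) (μ := volume)
      (F := fun (v : Euc d) y => K (x + torusProj v - y) • f y)
      (F' := fun (v : Euc d) y => (torusFDeriv K (x + torusProj v - y)).smulRight (f y))
      (x₀ := 0) (bound := fun y => C * ‖f y‖) (s := univ) univ_mem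
      (Eventually.of_forall fun v => (integrable_torusConv hKc hf _).1)
      (integrable_torusConv hKc hf _)
      (aestronglyMeasurable_smulRight (by fun_prop) hf.1)
      (Eventually.of_forall fun y v _ => hb _ y) (hf.norm.const_mul C)
      (Eventually.of_forall fun y v _ => ?_)
    · simpa [torusConv, torusConvDeriv] using key
    · have h1 := (hK.hasFDerivAt (x - y) v).smul_const (f y)
      convert! h1 using 1
      · ext w; rw [sub_add_eq_add_sub]
      · rw [sub_add_eq_add_sub]

theorem torusConvDeriv_apply [CompleteSpace F] {K : UnitAddTorus (Fin d) → ℝ}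
    (hK : TorusC1 K (torusFDeriv K))
    {f : UnitAddTorus (Fin d) → F} (hf : Integrable f) (x : UnitAddTorus (Fin d)) (e : Euc d) :
    torusConvDeriv K f x e = ∫ y, torusFDeriv K (x - y) e • f y := by
  have := hK.1
  unfold torusConvDeriv
  rw [ContinuousLinearMap.integral_apply (integrable_smulRight (by fun_prop) hf)]
  rfl

end Conv

theorem torusPartial_comp_sub_left {K : UnitAddTorus (Fin d) → ℝ} (hK : TorusSmooth K)
    (x y : UnitAddTorus (Fin d)) (j : Fin d) :
    torusPartial j (fun y => K (x - y)) y = -torusFDeriv K (x - y) (EuclideanSpace.single j 1) := by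
  have h := hK.torusC1.hasDerivAt_single j (x - y) (-0)
  have h2 := h.scomp 0 (hasDerivAt_neg (0 : ℝ))
  simp only [neg_zero, AddCircle.coe_zero, Pi.single_zero, add_zero, neg_smul, one_smul] at h2
  unfold torusPartial
  rw [← h2.deriv]
  congr 1
  ext s
  simp only [Function.comp]
  congr 1
  rw [AddCircle.coe_neg, Pi.single_neg]
  abel

theorem euc_integral_apply {α : Type*} [MeasurableSpace α] {μ : Measure α} {f : α → Euc d}
    (hf : Integrable f μ) (i : Fin d) : (∫ y, f y ∂μ) i = ∫ y, f y i ∂μ := by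
  have := (EuclideanSpace.proj i : Euc d →L[ℝ] ℝ).integral_comp_comm hf
  simpa using this.symm

theorem euc_integrable_of_apply {α : Type*} [MeasurableSpace α] {μ : Measure α} {f : α → Euc d}
    (hf : ∀ i, Integrable (fun y => f y i) μ) : Integrable f μ := by
  exact Integrable.of_eval_piLp hf

theorem IsWeakGradient.integrable {f : UnitAddTorus (Fin d) → Euc d}
    {G : UnitAddTorus (Fin d) → Matrix (Fin d) (Fin d) ℝ} (h : IsWeakGradient f G)
    (hd : 1 ≤ d) : Integrable f := by
  exact euc_integrable_of_apply fun i => (h i ⟨0, hd⟩).1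

/-- Testing the weak gradient against y ↦ K(x − y) moves the derivative from the kernel to the
field; the sign from the reflection cancels the one from integration by parts. -/
theorem torusConvDeriv_entry {K : UnitAddTorus (Fin d) → ℝ} (hK : TorusSmooth K)
    {f : UnitAddTorus (Fin d) → Euc d} (hf : Integrable f)
    {G : UnitAddTorus (Fin d) → Matrix (Fin d) (Fin d) ℝ} (h : IsWeakGradient f G)
    (x : UnitAddTorus (Fin d)) (i j : Fin d) :
    (torusConvDeriv K f x (EuclideanSpace.single j 1)) i = ∫ y, K (x - y) * G y i j := by
  have hK1 := hK.torusC1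
  have hK'c := hK1.1
  rw [torusConvDeriv_apply hK1 hf, euc_integral_apply]
  · have h1 := (h i j).2.2 _ (hK.comp_sub_left x)
    simp only [torusPartial_comp_sub_left hK, mul_neg, integral_neg, neg_inj] at h1
    simp only [PiLp.smul_apply, smul_eq_mul]
    rw [← integral_congr_ae (Eventually.of_forall fun y => mul_comm _ _), h1]
    exact integral_congr_ae (Eventually.of_forall fun y => mul_comm _ _)
  · exact integrable_smul_of_continuous (by fun_prop) hf

end Kernel

/-! ### Bounds on mollified fields -/

section Jensen

theorem exp_integral_mul_le {α : Type*} [MeasurableSpace α] {μ : Measure α} {k g : α → ℝ}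
    (hk : ∀ y, 0 ≤ k y) (hki : Integrable k μ) (hk1 : ∫ y, k y ∂μ = 1)
    (hkg : Integrable (fun y => k y * g y) μ)
    (hke : Integrable (fun y => k y * Real.exp (g y)) μ) :
    Real.exp (∫ y, k y * g y ∂μ) ≤ ∫ y, k y * Real.exp (g y) ∂μ := by
  set m := ∫ y, k y * g y ∂μ with hm
  -- This is the integral of the tangent line of exp at the mean m, which lies below the graph.
  have h1 : ∫ y, Real.exp m * ((1 - m) * k y + k y * g y) ∂μ = Real.exp m := by
    rw [integral_const_mul, integral_add (hki.const_mul _) hkg, integral_const_mul, hk1, ← hm]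
    ring
  rw [← h1]
  refine integral_mono (((hki.const_mul _).add hkg).const_mul _) hke fun y => ?_
  have h2 := Real.add_one_le_exp (g y - m)
  have h3 : Real.exp (g y) = Real.exp m * Real.exp (g y - m) := by
    rw [← Real.exp_add]; congr 1; ring
  change Real.exp m * ((1 - m) * k y + k y * g y) ≤ k y * Real.exp (g y)
  rw [h3]
  have h4 : k y * (Real.exp m * (g y - m + 1)) ≤ k y * (Real.exp m * Real.exp (g y - m)) := by
    gcongr
    exact hk y
  linarith

/-- Jensen for the uniform weights 1/n. It separates a product of growth factors along an orbit into
terms that can be integrated one at a time. -/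
theorem exp_sum_le_average {n : ℕ} (hn : 0 < n) (a : ℕ → ℝ) :
    Real.exp (∑ k ∈ Finset.range n, a k) ≤
      ∑ k ∈ Finset.range n, (n : ℝ)⁻¹ * Real.exp (n * a k) := by
  have hn' : (n : ℝ) ≠ 0 := by positivity
  have h := convexOn_exp.map_sum_le (t := Finset.range n) (w := fun _ => (n : ℝ)⁻¹)
    (p := fun k => n * a k) (fun _ _ => by positivity) (by simp [hn']) (fun _ _ => mem_univ _)
  simpa [hn'] using h

end Jensen

/-! ### Gradient entries, exponential moments, traces and determinants. -/

section Entries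
variable {d : ℕ}

theorem integrable_torusConv_mul {K : UnitAddTorus (Fin d) → ℝ} (hK : Continuous K)
    {f : UnitAddTorus (Fin d) → ℝ} (hf : Integrable f) (x : UnitAddTorus (Fin d)) :
    Integrable fun y => K (x - y) * f y :=
  integrable_torusConv hK hf x

theorem abs_entry_le_matrixAbs (A : Matrix (Fin d) (Fin d) ℝ) (i j : Fin d) :
    |A i j| ≤ matrixAbs A := by
  unfold matrixAbs
  refine Real.abs_le_sqrt ?_
  calc A i j ^ 2 ≤ ∑ j, A i j ^ 2 :=
        Finset.single_le_sum (f := fun j => A i j ^ 2) (fun _ _ => sq_nonneg _) (Finset.mem_univ j)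
    _ ≤ _ := Finset.single_le_sum (f := fun i => ∑ j, A i j ^ 2)
        (fun _ _ => Finset.sum_nonneg fun _ _ => sq_nonneg _) (Finset.mem_univ i)

theorem matrixAbs_nonneg (A : Matrix (Fin d) (Fin d) ℝ) : 0 ≤ matrixAbs A := Real.sqrt_nonneg _

theorem matrixAbs_neg (A : Matrix (Fin d) (Fin d) ℝ) : matrixAbs (-A) = matrixAbs A := by
  simp [matrixAbs]

/-- The crude factor d² is harmless: all exponential moments are finite, so it can be absorbed into
β. -/
theorem clm_norm_le_of_entries {A : Euc d →L[ℝ] Euc d} {m : ℝ}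
    (hm : ∀ i j, |(A (EuclideanSpace.single j 1)) i| ≤ m) : ‖A‖ ≤ (d : ℝ) ^ 2 * m := by
  rcases Nat.eq_zero_or_pos d with rfl | hd
  · have : A = 0 := by ext v i; exact i.elim0
    simp [this]
  have hm0 : 0 ≤ m := (abs_nonneg _).trans (hm ⟨0, hd⟩ ⟨0, hd⟩)
  refine A.opNorm_le_bound (by positivity) fun v => ?_
  have hv : v = ∑ j, v j • (EuclideanSpace.single j 1 : Euc d) := by
    ext i
    simp [Pi.single_apply]
  have hcol : ∀ j, ‖A (EuclideanSpace.single j 1)‖ ≤ d * m := fun j =>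
    (euc_norm_le_sum _).trans ((Finset.sum_le_sum fun i _ => hm i j).trans (by simp))
  calc ‖A v‖ = ‖∑ j, v j • A (EuclideanSpace.single j 1)‖ := by
        conv_lhs => rw [hv]
        simp
    _ ≤ ∑ j, ‖v j • A (EuclideanSpace.single j 1)‖ := norm_sum_le _ _
    _ ≤ ∑ _j : Fin d, ‖v‖ * (d * m) := by
        refine Finset.sum_le_sum fun j _ => ?_
        rw [norm_smul]
        exact mul_le_mul (euc_abs_apply_le v j) (hcol j) (norm_nonneg _) (norm_nonneg _)
    _ = d ^ 2 * m * ‖v‖ := by simp; ring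

theorem IsWeakGradient.integrable_entry {f : UnitAddTorus (Fin d) → Euc d}
    {G : UnitAddTorus (Fin d) → Matrix (Fin d) (Fin d) ℝ} (h : IsWeakGradient f G) (i j : Fin d) :
    Integrable (fun y => G y i j) := (h i j).2.1

theorem IsWeakGradient.integrable_matrixAbs {f : UnitAddTorus (Fin d) → Euc d}
    {G : UnitAddTorus (Fin d) → Matrix (Fin d) (Fin d) ℝ} (h : IsWeakGradient f G) :
    Integrable (fun y => matrixAbs (G y)) := by
  have hs : Integrable fun y => ∑ i, ∑ j, |G y i j| :=
    integrable_finsetSum _ fun i _ => integrable_finsetSum _ fun j _ => (h.integrable_entry i j).abs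
  refine hs.mono' ?_ (Eventually.of_forall fun y => ?_)
  · have hm : AEMeasurable (fun y => ∑ i, ∑ j, G y i j ^ 2) volume :=
      Finset.aemeasurable_fun_sum _ fun i _ => Finset.aemeasurable_fun_sum _ fun j _ =>
        ((h.integrable_entry i j).aemeasurable.pow_const 2)
    exact (Real.continuous_sqrt.measurable.comp_aemeasurable hm).aestronglyMeasurable
  · rw [Real.norm_of_nonneg (matrixAbs_nonneg _)]
    refine Real.sqrt_le_iff.2 ⟨Finset.sum_nonneg fun _ _ => Finset.sum_nonneg fun _ _ =>
      abs_nonneg _, ?_⟩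
    have h1 : ∀ i, ∑ j, G y i j ^ 2 ≤ (∑ j, |G y i j|) ^ 2 := fun i => by
      simpa using Finset.sum_sq_le_sq_sum_of_nonneg (s := Finset.univ) (f := fun j => |G y i j|)
        (fun _ _ => abs_nonneg _)
    exact (Finset.sum_le_sum fun i _ => h1 i).trans
      (Finset.sum_sq_le_sq_sum_of_nonneg fun i _ => Finset.sum_nonneg fun _ _ => abs_nonneg _)

theorem norm_torusConvDeriv_le {K : UnitAddTorus (Fin d) → ℝ} (hK : TorusSmooth K)
    (hK0 : ∀ y, 0 ≤ K y)
    {f : UnitAddTorus (Fin d) → Euc d} (hf : Integrable f)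
    {G : UnitAddTorus (Fin d) → Matrix (Fin d) (Fin d) ℝ} (h : IsWeakGradient f G)
    (x : UnitAddTorus (Fin d)) :
    ‖torusConvDeriv K f x‖ ≤ (d : ℝ) ^ 2 * ∫ y, K (x - y) * matrixAbs (G y) := by
  have hKc := hK.torusC1.continuous
  refine clm_norm_le_of_entries fun i j => ?_
  rw [torusConvDeriv_entry hK hf h]
  rw [← Real.norm_eq_abs]
  refine norm_integral_le_of_norm_le (integrable_torusConv_mul hKc h.integrable_matrixAbs x)
    (Eventually.of_forall fun y => ?_)
  rw [Real.norm_eq_abs, abs_mul, abs_of_nonneg (hK0 _)]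
  exact mul_le_mul_of_nonneg_left (abs_entry_le_matrixAbs _ _ _) (hK0 _)

/-- Jensen for the probability density y ↦ `moll N (x - y)`, then Tonelli, where the kernel
integrates to one. The bound does not depend on N. -/
theorem lintegral_exp_torusConvDeriv_le {N : ℕ}
    {f : UnitAddTorus (Fin d) → Euc d} (hf : Integrable f)
    {G : UnitAddTorus (Fin d) → Matrix (Fin d) (Fin d) ℝ} (h : IsWeakGradient f G) {β : ℝ}
    (hβ : 0 ≤ β)
    (hfin : ∫⁻ y, ENNReal.ofReal (Real.exp (β * (d : ℝ) ^ 2 * matrixAbs (G y))) ≠ ⊤) :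
    ∫⁻ x, ENNReal.ofReal (Real.exp (β * ‖torusConvDeriv (moll N) f x‖)) ≤
      ∫⁻ y, ENNReal.ofReal (Real.exp (β * (d : ℝ) ^ 2 * matrixAbs (G y))) := by
  set e : UnitAddTorus (Fin d) → ℝ := fun y => Real.exp (β * (d : ℝ) ^ 2 * matrixAbs (G y)) with he
  have hGi := h.integrable_matrixAbs
  have hem : AEStronglyMeasurable e volume :=
    Real.continuous_exp.comp_aestronglyMeasurable (hGi.1.const_mul _)
  have hei : Integrable e :=
    ⟨hem, by
      rw [hasFiniteIntegral_iff_ofReal (Eventually.of_forall fun y => (Real.exp_pos _).le)]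
      exact lt_top_iff_ne_top.2 hfin⟩
  have hKc := continuous_moll (d := d) N
  have h1 : ∀ x, Real.exp (β * ‖torusConvDeriv (moll N) f x‖) ≤ ∫ y, moll N (x - y) * e y := by
    intro x
    have h2 := exp_integral_mul_le (μ := volume) (k := fun y => moll N (x - y))
      (g := fun y => β * (d : ℝ) ^ 2 * matrixAbs (G y)) (fun y => moll_nonneg _ _)
      ((integrable_moll N).comp_sub_left x) (integral_moll_sub N x)
      (integrable_torusConv_mul hKc (hGi.const_mul _) x) (integrable_torusConv_mul hKc hei x)
    refine le_trans (Real.exp_le_exp.2 ?_) h2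
    have h3 := mul_le_mul_of_nonneg_left
      (norm_torusConvDeriv_le (torusSmooth_moll N) (moll_nonneg N) hf h x) hβ
    refine h3.trans (le_of_eq ?_)
    rw [← mul_assoc, ← integral_const_mul]
    exact integral_congr_ae (Eventually.of_forall fun y => by ring)
  calc ∫⁻ x, ENNReal.ofReal (Real.exp (β * ‖torusConvDeriv (moll N) f x‖))
      ≤ ∫⁻ x, ∫⁻ y, ENNReal.ofReal (moll N (x - y)) * ENNReal.ofReal (e y) := by
        refine lintegral_mono fun x => ?_
        refine (ENNReal.ofReal_le_ofReal (h1 x)).trans (le_of_eq ?_)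
        rw [ofReal_integral_eq_lintegral_ofReal (integrable_torusConv_mul hKc hei x)
          (Eventually.of_forall fun y => mul_nonneg (moll_nonneg _ _) (Real.exp_pos _).le)]
        exact lintegral_congr fun y => ENNReal.ofReal_mul (moll_nonneg _ _)
    _ = ∫⁻ y, ∫⁻ x, ENNReal.ofReal (moll N (x - y)) * ENNReal.ofReal (e y) := by
        refine lintegral_lintegral_swap ?_
        have hc : Continuous fun p : UnitAddTorus (Fin d) × UnitAddTorus (Fin d) =>
          moll N (p.1 - p.2) := by fun_prop
        exact (hc.measurable.ennreal_ofReal.aemeasurable).mul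
          (hem.aemeasurable.comp_snd).ennreal_ofReal
    _ = ∫⁻ y, ENNReal.ofReal (e y) := by
        refine lintegral_congr fun y => ?_
        rw [lintegral_mul_const]
        · rw [lintegral_sub_right_eq_self (fun x => ENNReal.ofReal (moll N x)),
            ← ofReal_integral_eq_lintegral_ofReal (integrable_moll N)
              (Eventually.of_forall (moll_nonneg N)), integral_moll]
          simp
        · exact (by fun_prop : Continuous fun x => moll N (x - y)).measurable.ennreal_ofReal

/-- The trace of an endomorphism of `ℝᵈ`. -/
noncomputable def eucTrace (A : Euc d →L[ℝ] Euc d) : ℝ :=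
  ∑ i, (A (EuclideanSpace.single i 1)) i

/-- The trace of the mollified gradient is an average of the divergence, so it inherits the sup
bound. -/
theorem abs_eucTrace_torusConvDeriv_le {N : ℕ}
    {f : UnitAddTorus (Fin d) → Euc d} (hf : Integrable f)
    {G : UnitAddTorus (Fin d) → Matrix (Fin d) (Fin d) ℝ} (h : IsWeakGradient f G) {L : ℝ}
    (hL : ∀ᵐ y, |(G y).trace| ≤ L) (x : UnitAddTorus (Fin d)) :
    |eucTrace (torusConvDeriv (moll N) f x)| ≤ L := by
  have hKc := continuous_moll (d := d) N
  have h1 : eucTrace (torusConvDeriv (moll N) f x) = ∫ y, moll N (x - y) * (G y).trace := by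
    unfold eucTrace
    simp only [torusConvDeriv_entry (torusSmooth_moll N) hf h, Matrix.trace, Matrix.diag_apply,
      Finset.mul_sum]
    rw [integral_finsetSum]
    exact fun i _ => integrable_torusConv_mul hKc (h.integrable_entry i i) x
  rw [h1]
  have h2 : ∫ y, moll N (x - y) * L = L := by
    rw [integral_mul_const, integral_moll_sub, one_mul]
  rw [← h2]
  rw [← Real.norm_eq_abs]
  refine norm_integral_le_of_norm_le (((integrable_moll N).comp_sub_left x).mul_const L) ?_
  filter_upwards [hL] with y hy
  rw [Real.norm_eq_abs, abs_mul, abs_of_nonneg (moll_nonneg _ _)]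
  exact mul_le_mul_of_nonneg_left hy (moll_nonneg _ _)

theorem clm_det_eq (A : Euc d →L[ℝ] Euc d) :
    A.det = Matrix.det (Matrix.of fun i j => (A (EuclideanSpace.single j 1)) i) := by
  rw [ContinuousLinearMap.det,
    ← LinearMap.det_toMatrix (EuclideanSpace.basisFun (Fin d) ℝ).toBasis]
  congr 1

/-- The determinant is a polynomial in the entries, and along each line r ↦ 1 + rA its linear
coefficient is the trace. The existential also provides the trace as a continuous linear map, which
commutes with Bochner integrals. -/
theorem hasFDerivAt_det_id_add :
    ∃ δ' : (Euc d →L[ℝ] Euc d) →L[ℝ] ℝ, (∀ A, δ' A = eucTrace A) ∧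
      HasFDerivAt (fun A : Euc d →L[ℝ] Euc d => (ContinuousLinearMap.id ℝ (Euc d) + A).det) δ' 0 := by
  set D : (Euc d →L[ℝ] Euc d) → ℝ := fun A => (ContinuousLinearMap.id ℝ (Euc d) + A).det with hD
  set M : (Euc d →L[ℝ] Euc d) → Matrix (Fin d) (Fin d) ℝ := fun A =>
    Matrix.of fun i j => (A (EuclideanSpace.single j 1)) i with hM
  have hDM : ∀ A, D A = (1 + M A).det := by
    intro A
    simp only [hD, clm_det_eq]
    congr 1
    ext i j
    simp [hM, Matrix.one_apply]
  have hdiff : DifferentiableAt ℝ D 0 := by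
    have : D = fun A => ∑ σ : Equiv.Perm (Fin d), (Equiv.Perm.sign σ : ℝ) *
        ∏ i, ((1 : Matrix (Fin d) (Fin d) ℝ) (σ i) i + (A (EuclideanSpace.single i 1)) (σ i)) := by
      ext A
      rw [hDM, Matrix.det_apply']
      rfl
    rw [this]
    fun_prop
  refine ⟨fderiv ℝ D 0, fun A => ?_, hdiff.hasFDerivAt⟩
  have h1 : HasDerivAt (fun r : ℝ => D (r • A)) (fderiv ℝ D 0 A) 0 := by
    have h2 : HasDerivAt (fun r : ℝ => r • A) ((1 : ℝ) • A) 0 := (hasDerivAt_id 0).smul_const A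
    have h3 : HasFDerivAt D (fderiv ℝ D 0) ((0 : ℝ) • A) := by
      have h0 : (0 : ℝ) • A = 0 := zero_smul ℝ A
      rw [h0]; exact hdiff.hasFDerivAt
    simpa using! h3.comp_hasDerivAt 0 h2
  have h4 : HasDerivAt (fun r : ℝ => D (r • A)) (M A).trace 0 := by
    set p : Polynomial ℝ :=
      (1 + (Polynomial.X : Polynomial ℝ) • (M A).map ⇑Polynomial.C).det.divX.divX with hp
    have h5 : (fun r : ℝ => D (r • A)) =
        fun r => 1 + (M A).trace * r + Polynomial.eval r p * r ^ 2 := by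
      ext r
      rw [hDM, hp, ← Matrix.det_one_add_smul]
      congr 2
    rw [h5]
    have h6 := (((hasDerivAt_id (0 : ℝ)).const_mul (M A).trace).const_add 1).add
      ((p.hasDerivAt 0).mul ((hasDerivAt_id (0 : ℝ)).pow 2))
    simpa using! h6
  rw [h1.unique h4]
  rfl

theorem exists_det_lower_bound {ε : ℝ} (hε : 0 < ε) :
    ∃ δ > 0, ∀ A : Euc d →L[ℝ] Euc d, ‖A‖ ≤ δ →
      1 + eucTrace A - ε * ‖A‖ ≤ (ContinuousLinearMap.id ℝ (Euc d) + A).det := by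
  obtain ⟨δ', hδ', h⟩ := hasFDerivAt_det_id_add (d := d)
  have h1 := h.isLittleO.def hε
  rw [Metric.eventually_nhds_iff_ball] at h1
  obtain ⟨r, hr, h2⟩ := h1
  refine ⟨r / 2, by positivity, fun A hA => ?_⟩
  have h3 := h2 A (by rw [mem_ball_zero_iff]; linarith)
  simp only [sub_zero, hδ', Real.norm_eq_abs, add_zero] at h3
  have h4 : (ContinuousLinearMap.id ℝ (Euc d)).det = 1 := by
    simp [ContinuousLinearMap.det]
  rw [h4] at h3
  linarith [(abs_le.1 h3).1]

end Entries

/-! ### The log-Lipschitz modulus of continuity -/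

section Modulus
open scoped Pointwise
variable {d : ℕ}

theorem measurePreserving_torusProj (a : Fin d → ℝ) :
    MeasurePreserving torusProj (volume.restrict (unitCube a))
      (volume : Measure (UnitAddTorus (Fin d))) := by
  refine ⟨continuous_torusProj.measurable, ?_⟩
  ext s hs
  rw [Measure.map_apply continuous_torusProj.measurable hs, ← lintegral_indicator_one hs,
    lintegral_torus_eq _ a, ← lintegral_indicator_one (continuous_torusProj.measurable hs)]
  rfl

theorem integral_torus_eq {F : Type*} [NormedAddCommGroup F] [NormedSpace ℝ F]
    {f : UnitAddTorus (Fin d) → F} (hf : AEStronglyMeasurable f) (a : Fin d → ℝ) :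
    ∫ x, f x = ∫ v in unitCube a, f (torusProj v) := by
  rw [← (measurePreserving_torusProj a).map_eq] at hf
  rw [← (measurePreserving_torusProj a).map_eq,
    integral_map (measurePreserving_torusProj a).measurable.aemeasurable hf]

/-- A Young inequality with a free level a, from t + 1 ≤ eᵗ; the level will be adapted to the volume
of the set over which g is averaged. -/
theorem le_add_exp_mul {β : ℝ} (hβ : 0 < β) (a g : ℝ) :
    g ≤ a + β⁻¹ * (Real.exp (-(β * a)) * Real.exp (β * g)) := by
  rw [← Real.exp_add]
  have h1 := Real.add_one_le_exp (-(β * a) + β * g)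
  have h2 : β * (g - a) ≤ Real.exp (-(β * a) + β * g) := by linarith
  have h3 : g - a ≤ β⁻¹ * Real.exp (-(β * a) + β * g) := by
    rw [← div_eq_inv_mul, le_div_iff₀ hβ]; linarith
  linarith

/-- Write f(x) − f(x+z) as an integral of the derivative along the segment, average over z ∈ Q and
exchange integrals. For each s the derivative is averaged over x + sQ, which embeds in the torus, so
its exponential moment there is at most C. The price is the logarithm of the volume, the source of
the log-Lipschitz modulus. -/
theorem norm_sub_average_le {f : UnitAddTorus (Fin d) → Euc d}
    {f' : UnitAddTorus (Fin d) → Euc d →L[ℝ] Euc d} (hf : TorusC1 f f') {β C : ℝ} (hβ : 0 < β)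
    (hC : ∫⁻ y, ENNReal.ofReal (Real.exp (β * ‖f' y‖)) ≤ ENNReal.ofReal C) (hC0 : 0 ≤ C)
    {Q : Set (Euc d)} (hQ : MeasurableSet Q) {R : ℝ} (hR : 0 ≤ R) (hQR : ∀ z ∈ Q, ‖z‖ ≤ R)
    (hinj : ∀ s ∈ Ioc (0 : ℝ) 1, InjOn torusProj (s • Q)) {V : ℝ} (hV : 0 < V)
    (hVQ : volume Q = ENNReal.ofReal V) (x : UnitAddTorus (Fin d)) :
    ‖f x - V⁻¹ • ∫ z in Q, f (x + torusProj z)‖ ≤ R * ((-Real.log V + d + C) / β) := by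
  have hfc := hf.continuous
  have hf'c := hf.1
  have hPc := continuous_torusProj (d := d)
  obtain ⟨M, hM0, hM⟩ := exists_norm_bound hf'c
  obtain ⟨Mf, -, hMf⟩ := exists_norm_bound hfc
  have : IsFiniteMeasure (volume.restrict Q) := ⟨by simp [hVQ]⟩
  have hVr : (volume : Measure (Euc d)).real Q = V := by
    simp [Measure.real, hVQ, hV.le]
  -- integrability
  have hint1 : Integrable (fun z : Euc d => f (x + torusProj z)) (volume.restrict Q) :=
    Integrable.of_bound (by fun_prop : Continuous fun z : Euc d =>
      f (x + torusProj z)).aestronglyMeasurable Mf (Eventually.of_forall fun z => hMf _)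
  have hint2 : ∀ s : ℝ, Integrable (fun z : Euc d => ‖f' (x + torusProj (s • z))‖)
      (volume.restrict Q) := fun s =>
    Integrable.of_bound (by fun_prop : Continuous fun z : Euc d =>
      ‖f' (x + torusProj (s • z))‖).aestronglyMeasurable M
      (Eventually.of_forall fun z => by simpa using hM _)
  have hint3 : ∀ s : ℝ, Integrable (fun z : Euc d => Real.exp (β * ‖f' (x + torusProj (s • z))‖))
      (volume.restrict Q) := fun s =>
    Integrable.of_bound (by fun_prop : Continuous fun z : Euc d =>
      Real.exp (β * ‖f' (x + torusProj (s • z))‖)).aestronglyMeasurable (Real.exp (β * M))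
      (Eventually.of_forall fun z => by
        rw [Real.norm_of_nonneg (Real.exp_pos _).le]
        exact Real.exp_le_exp.2 (mul_le_mul_of_nonneg_left (hM _) hβ.le))
  have hint4 : Integrable (fun p : Euc d × ℝ => ‖f' (x + torusProj (p.2 • p.1))‖)
      ((volume.restrict Q).prod (volume.restrict (Ioc (0 : ℝ) 1))) :=
    Integrable.of_bound (by fun_prop : Continuous fun p : Euc d × ℝ =>
      ‖f' (x + torusProj (p.2 • p.1))‖).aestronglyMeasurable M
      (Eventually.of_forall fun z => by simpa using hM _)
  -- fundamental theorem of calculus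
  have hftc : ∀ z ∈ Q, ‖f x - f (x + torusProj z)‖ ≤
      R * ∫ s in Ioc (0 : ℝ) 1, ‖f' (x + torusProj (s • z))‖ := by
    intro z hz
    have hder : ∀ s : ℝ, HasDerivAt (fun s : ℝ => f (x + torusProj (s • z)))
        (f' (x + torusProj (s • z)) z) s := by
      intro s
      have h1 := hf.hasFDerivAt x (s • z)
      have h2 : HasDerivAt (fun s : ℝ => s • z) ((1 : ℝ) • z) s := (hasDerivAt_id s).smul_const z
      simpa using! h1.comp_hasDerivAt s h2
    have h3 := intervalIntegral.integral_eq_sub_of_hasDerivAt (a := 0) (b := 1)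
      (fun s _ => hder s) (Continuous.intervalIntegrable (by fun_prop) _ _)
    simp only [one_smul, zero_smul, torusProj_zero, add_zero] at h3
    rw [norm_sub_rev, ← h3, ← integral_const_mul, intervalIntegral.integral_of_le zero_le_one]
    refine norm_integral_le_of_norm_le ?_ (Eventually.of_forall fun s => ?_)
    · exact ((by fun_prop : Continuous fun s : ℝ =>
        R * ‖f' (x + torusProj (s • z))‖).integrableOn_Icc).mono_set Ioc_subset_Icc_self
    · rw [mul_comm]
      exact (ContinuousLinearMap.le_opNorm _ _).trans
        (mul_le_mul_of_nonneg_left (hQR z hz) (norm_nonneg _))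
  -- the inner bound
  have hinner : ∀ s ∈ Ioc (0 : ℝ) 1, ∫ z in Q, ‖f' (x + torusProj (s • z))‖ ≤
      V * (-(Real.log V + d * Real.log s) / β) + V * C / β := by
    intro s hs
    -- With this level exp(−βa) = V sᵈ, which cancels the Jacobian s⁻ᵈ of the dilation and leaves an
    -- exponential term of at most V C / β.
    set a := -(Real.log V + d * Real.log s) / β with ha
    have hea : Real.exp (-(β * a)) = V * s ^ d := by
      have : -(β * a) = Real.log V + d * Real.log s := by rw [ha]; field_simp
      rw [this, Real.exp_add, Real.exp_log hV, mul_comm (d : ℝ), Real.exp_mul, Real.exp_log hs.1,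
        Real.rpow_natCast]
    have h1 : ∫ z in Q, ‖f' (x + torusProj (s • z))‖ ≤ ∫ z in Q,
        (a + β⁻¹ * (Real.exp (-(β * a)) * Real.exp (β * ‖f' (x + torusProj (s • z))‖))) :=
      integral_mono (hint2 s) ((integrable_const a).add (((hint3 s).const_mul _).const_mul _))
        fun z => le_add_exp_mul hβ a _
    rw [integral_add (integrable_const a) (((hint3 s).const_mul _).const_mul _), integral_const_mul,
      integral_const_mul, setIntegral_const, hVr, hea,
      Measure.setIntegral_comp_smul_of_pos volume
        (fun z => Real.exp (β * ‖f' (x + torusProj z)‖)) Q hs.1] at h1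
    have h2 : ∫ z in s • Q, Real.exp (β * ‖f' (x + torusProj z)‖) ≤ C := by
      rw [integral_eq_lintegral_of_nonneg_ae (Eventually.of_forall fun z => (Real.exp_pos _).le)
        (by fun_prop : Continuous fun z : Euc d =>
          Real.exp (β * ‖f' (x + torusProj z)‖)).aestronglyMeasurable]
      refine ENNReal.toReal_le_of_le_ofReal hC0 ?_
      have h3 := setLIntegral_torusProj_le (hQ.const_smul_of_ne_zero hs.1.ne') (hinj s hs)
        (g := fun y => ENNReal.ofReal (Real.exp (β * ‖f' (x + y)‖)))
      rw [lintegral_add_left_eq_self (fun y => ENNReal.ofReal (Real.exp (β * ‖f' y‖)))] at h3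
      exact h3.trans hC
    simp only [finrank_euclideanSpace, Fintype.card_fin, smul_eq_mul] at h1
    refine h1.trans ?_
    have hsd : 0 < s ^ d := pow_pos hs.1 d
    have h4 : β⁻¹ * (V * s ^ d * ((s ^ d)⁻¹ * ∫ z in s • Q, Real.exp (β * ‖f' (x + torusProj z)‖)))
        = V / β * ∫ z in s • Q, Real.exp (β * ‖f' (x + torusProj z)‖) := by
      field_simp
    rw [h4]
    have h5 : V / β * ∫ z in s • Q, Real.exp (β * ‖f' (x + torusProj z)‖) ≤ V / β * C := by
      gcongr
    have h6 : V / β * C = V * C / β := by ring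
    linarith
  have hlogint : IntegrableOn Real.log (Ioc (0 : ℝ) 1) :=
    (intervalIntegrable_iff_integrableOn_Ioc_of_le zero_le_one).1
      intervalIntegral.intervalIntegrable_log'
  -- The logarithmic singularity at s = 0 is integrable; this mean produces the summand d of the
  -- final bound.
  have hlog : ∫ s in Ioc (0 : ℝ) 1, Real.log s = -1 := by
    rw [← intervalIntegral.integral_of_le zero_le_one, integral_log]; simp
  have hbint : IntegrableOn (fun s => V * (-(Real.log V + d * Real.log s) / β) + V * C / β)
      (Ioc (0 : ℝ) 1) := by
    have h1 : IntegrableOn (fun s => (-(V * d / β)) * Real.log s +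
        (V * C / β - V * Real.log V / β)) (Ioc (0 : ℝ) 1) :=
      (hlogint.const_mul _).add (integrable_const _)
    refine h1.congr (Eventually.of_forall fun s => ?_)
    simp only
    ring
  have hbval : ∫ s in Ioc (0 : ℝ) 1, (V * (-(Real.log V + d * Real.log s) / β) + V * C / β) =
      V * ((-Real.log V + d + C) / β) := by
    have h1 : ∫ s in Ioc (0 : ℝ) 1, ((-(V * d / β)) * Real.log s +
        (V * C / β - V * Real.log V / β)) = V * ((-Real.log V + d + C) / β) := by
      rw [integral_add (hlogint.const_mul _) (integrable_const _), integral_const_mul, hlog,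
        setIntegral_const]
      simp
      ring
    rw [← h1]
    refine integral_congr_ae (Eventually.of_forall fun s => ?_)
    simp only
    ring
  have hmain : ‖∫ z in Q, (f x - f (x + torusProj z))‖ ≤
      R * (V * ((-Real.log V + d + C) / β)) := by
    calc ‖∫ z in Q, (f x - f (x + torusProj z))‖
        ≤ ∫ z in Q, R * ∫ s in Ioc (0 : ℝ) 1, ‖f' (x + torusProj (s • z))‖ := by
          refine norm_integral_le_of_norm_le (hint4.integral_prod_left.const_mul R) ?_
          exact (ae_restrict_iff' hQ).2 (Eventually.of_forall hftc)
      _ = R * ∫ s in Ioc (0 : ℝ) 1, ∫ z in Q, ‖f' (x + torusProj (s • z))‖ := by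
          rw [integral_const_mul, integral_integral_swap hint4]
      _ ≤ R * ∫ s in Ioc (0 : ℝ) 1, (V * (-(Real.log V + d * Real.log s) / β) + V * C / β) := by
          refine mul_le_mul_of_nonneg_left ?_ hR
          exact setIntegral_mono_on hint4.integral_prod_right hbint measurableSet_Ioc hinner
      _ = _ := by rw [hbval]
  have hrew : f x - V⁻¹ • ∫ z in Q, f (x + torusProj z) =
      V⁻¹ • ∫ z in Q, (f x - f (x + torusProj z)) := by
    rw [integral_sub (integrable_const _) hint1, setIntegral_const, hVr, smul_sub, smul_smul,
      inv_mul_cancel₀ hV.ne', one_smul]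
  rw [hrew, norm_smul, Real.norm_of_nonneg (inv_nonneg.2 hV.le), inv_mul_le_iff₀ hV]
  linarith

/-- The case Q = unit cube, whose average is the mean over the torus. It bounds the oscillation of f
and handles displacements with ‖w‖ ≥ 1. -/
theorem norm_sub_integral_le {f : UnitAddTorus (Fin d) → Euc d}
    {f' : UnitAddTorus (Fin d) → Euc d →L[ℝ] Euc d} (hf : TorusC1 f f') {β C : ℝ} (hβ : 0 < β)
    (hC : ∫⁻ y, ENNReal.ofReal (Real.exp (β * ‖f' y‖)) ≤ ENNReal.ofReal C) (hC0 : 0 ≤ C)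
    (x : UnitAddTorus (Fin d)) :
    ‖f x - ∫ y, f y‖ ≤ d * ((d + C) / β) := by
  have hQ0 : ∀ z ∈ unitCube (0 : Fin d → ℝ), ∀ i, 0 < z i ∧ z i ≤ 1 := by
    intro z hz i
    simpa using hz i
  have h := norm_sub_average_le hf hβ hC hC0 (measurableSet_unitCube 0) (R := d) (by positivity)
    (fun z hz => (euc_norm_le_sum z).trans ?_) ?_ one_pos (by simp [volume_unitCube]) x
  · have hint : ∫ z in unitCube (0 : Fin d → ℝ), f (x + torusProj z) = ∫ y, f y := by
      rw [← integral_torus_eq (f := fun y => f (x + y))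
        (by have := hf.continuous; fun_prop : Continuous fun y => f (x + y)).aestronglyMeasurable,
        integral_add_left_eq_self f x]
    simpa [hint] using h
  · calc ∑ i, |z i| ≤ ∑ _i : Fin d, (1 : ℝ) := Finset.sum_le_sum fun i _ => by
          rw [abs_of_pos (hQ0 z hz i).1]; exact (hQ0 z hz i).2
      _ = d := by simp
  · rintro s hs _ ⟨v, hv, rfl⟩ _ ⟨w, hw, rfl⟩ h
    obtain ⟨k, hk⟩ := torusProj_eq_iff.1 h
    ext i
    have h3 := hk i
    simp only [PiLp.smul_apply, smul_eq_mul] at h3 ⊢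
    obtain ⟨a1, a2⟩ := hQ0 v hv i
    obtain ⟨b1, b2⟩ := hQ0 w hw i
    have : k i = 0 := by
      have : |(k i : ℝ)| < 1 := by
        have hki : (k i : ℝ) = s * (v i - w i) := by linarith
        rw [hki, abs_mul, abs_of_pos hs.1]
        have : |v i - w i| < 1 := by rw [abs_lt]; constructor <;> linarith
        calc s * |v i - w i| ≤ 1 * |v i - w i| := by gcongr; exact hs.2
          _ < 1 := by linarith
      exact_mod_cast Int.abs_lt_one_iff.1 (by exact_mod_cast this)
    rw [h3, this]; simp

/-- Both f(x) and f(x+w) are compared with the average over the ball of radius ‖w‖/2 about the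
midpoint x + w/2. Its volume is of order ‖w‖ᵈ, whence the term d log(1/‖w‖). -/
theorem norm_sub_le_of_norm_lt_one {f : UnitAddTorus (Fin d) → Euc d}
    {f' : UnitAddTorus (Fin d) → Euc d →L[ℝ] Euc d} (hf : TorusC1 f f') {β C : ℝ} (hβ : 0 < β)
    (hC : ∫⁻ y, ENNReal.ofReal (Real.exp (β * ‖f' y‖)) ≤ ENNReal.ofReal C) (hC0 : 0 ≤ C)
    (x : UnitAddTorus (Fin d)) {w : Euc d} (hw0 : w ≠ 0) (hw : ‖w‖ < 1) :
    ‖f (x + torusProj w) - f x‖ ≤ 2 * ‖w‖ * ((d * -Real.log ‖w‖ + (d * Real.log 2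
      - Real.log (volume.real (Metric.ball (0 : Euc d) 1)) + d + C)) / β) := by
  set r := ‖w‖ with hr
  have hr0 : 0 < r := norm_pos_iff.2 hw0
  set v := volume.real (Metric.ball (0 : Euc d) 1) with hv
  have hv0 : 0 < v := ENNReal.toReal_pos (Metric.measure_ball_pos volume _ one_pos).ne' measure_ball_lt_top.ne
  have hvol : ∀ c : Euc d, volume (Metric.ball c (r / 2)) = ENNReal.ofReal ((r / 2) ^ d * v) := by
    intro c
    rw [Measure.addHaar_ball_of_pos volume c (by positivity), finrank_euclideanSpace, Fintype.card_fin,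
      ENNReal.ofReal_mul (by positivity), hv, ofReal_measureReal]
  have hV : 0 < (r / 2) ^ d * v := by positivity
  have hinj : ∀ c : Euc d, ∀ s ∈ Ioc (0 : ℝ) 1, InjOn torusProj (s • Metric.ball c (r / 2)) := by
    intro c s hs
    refine injOn_torusProj_of_dist_lt ?_
    rintro _ ⟨a, ha, rfl⟩ _ ⟨b, hb, rfl⟩
    simp only
    rw [← smul_sub, norm_smul, Real.norm_of_nonneg hs.1.le]
    have h1 : ‖a - b‖ < 1 := by
      have h2 := dist_triangle_right a b c
      rw [Metric.mem_ball] at ha hb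
      rw [← dist_eq_norm]
      linarith
    calc s * ‖a - b‖ ≤ 1 * ‖a - b‖ := by gcongr; exact hs.2
      _ < 1 := by linarith
  have hhalf : ‖(2⁻¹ : ℝ) • w‖ = r / 2 := by
    rw [norm_smul, ← hr]; norm_num; ring
  have hball : ∀ c : Euc d, ‖c‖ = r / 2 → ∀ z ∈ Metric.ball c (r / 2), ‖z‖ ≤ r := by
    intro c hc z hz
    rw [mem_ball_iff_norm] at hz
    have := norm_le_norm_add_norm_sub' z c
    linarith
  have h1 := norm_sub_average_le hf hβ hC hC0 measurableSet_ball hr0.le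
    (hball ((2⁻¹ : ℝ) • w) hhalf) (hinj _) hV (hvol _) x
  have h2 := norm_sub_average_le hf hβ hC hC0 measurableSet_ball hr0.le
    (hball (-((2⁻¹ : ℝ) • w)) (by rw [norm_neg, hhalf])) (hinj _) hV (hvol _) (x + torusProj w)
  -- Seen from x + w, the midpoint ball is centred at −w/2.
  have h3 : ∫ z in Metric.ball (-((2⁻¹ : ℝ) • w)) (r / 2), f (x + torusProj w + torusProj z) =
      ∫ z in Metric.ball ((2⁻¹ : ℝ) • w) (r / 2), f (x + torusProj z) := by
    have h4 := (measurePreserving_add_left volume w).setIntegral_preimage_emb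
      (measurableEmbedding_addLeft w) (fun z => f (x + torusProj z))
      (Metric.ball ((2⁻¹ : ℝ) • w) (r / 2))
    have h5 : (fun z => w + z) ⁻¹' Metric.ball ((2⁻¹ : ℝ) • w) (r / 2) =
        Metric.ball (-((2⁻¹ : ℝ) • w)) (r / 2) := by
      rw [preimage_add_ball]
      congr 1
      module
    rw [h5] at h4
    simpa only [torusProj_add, add_assoc] using h4
  rw [h3] at h2
  have hlog : Real.log ((r / 2) ^ d * v) = d * (Real.log r - Real.log 2) + Real.log v := by
    rw [Real.log_mul (by positivity) hv0.ne', Real.log_pow, Real.log_div hr0.ne' two_ne_zero]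
  rw [hlog] at h1 h2
  set q := ((r / 2) ^ d * v)⁻¹ • ∫ z in Metric.ball ((2⁻¹ : ℝ) • w) (r / 2), f (x + torusProj z)
  have h6 := norm_sub_le_norm_sub_add_norm_sub (f (x + torusProj w)) q (f x)
  rw [norm_sub_rev q] at h6
  refine h6.trans ((add_le_add h2 h1).trans (le_of_eq ?_))
  ring

/-- The bound r log(1/r) lies below all lines r a + e^{−a}; trading a for the slope A gives linear
moduli with exponentially small remainder. The rate λ is proportional to the exponent β, hence
arbitrary. -/
theorem exists_modulus (hd : 1 ≤ d) {lam : ℝ} (hlam : 0 < lam) {C : ℝ} (hC0 : 0 ≤ C) :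
    ∃ B A₀ : ℝ, 0 ≤ B ∧ 0 ≤ A₀ ∧ ∀ (f : UnitAddTorus (Fin d) → Euc d)
      (f' : UnitAddTorus (Fin d) → Euc d →L[ℝ] Euc d), TorusC1 f f' →
      ∫⁻ y, ENNReal.ofReal (Real.exp (2 * d * lam * ‖f' y‖)) ≤ ENNReal.ofReal C →
      ∀ A, A₀ ≤ A → ∀ x w, ‖f (x + torusProj w) - f x‖ ≤ A * ‖w‖ + B * Real.exp (-(lam * A)) := by
  have hd0 : (0 : ℝ) < d := by exact_mod_cast hd
  -- With this β the coefficient 2d/β of r log(1/r) equals 1/λ.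
  set β : ℝ := 2 * d * lam with hβ
  have hβ0 : 0 < β := by positivity
  set c : ℝ := d * Real.log 2 - Real.log (volume.real (Metric.ball (0 : Euc d) 1)) + d + C with hc
  set c1 : ℝ := 2 * c / β with hc1
  -- A₀ is the oscillation bound, so A‖w‖ alone suffices when ‖w‖ ≥ 1; B comes from the computation
  -- for ‖w‖ < 1.
  refine ⟨lam⁻¹ * Real.exp (lam * c1), 2 * (d * ((d + C) / β)), by positivity, by positivity,
    fun f f' hf hexp A hA x w => ?_⟩
  have hBpos : 0 ≤ lam⁻¹ * Real.exp (lam * c1) * Real.exp (-(lam * A)) := by positivity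
  have hA0 : 0 ≤ A := le_trans (by positivity) hA
  rcases eq_or_ne w 0 with rfl | hw0
  · simpa using hBpos
  rcases lt_or_ge ‖w‖ 1 with hw | hw
  · have h1 := norm_sub_le_of_norm_lt_one hf hβ0 hexp hC0 x hw0 hw
    rw [← hc] at h1
    set r := ‖w‖ with hr
    have hr0 : 0 < r := norm_pos_iff.2 hw0
    -- Chosen so that a/λ + c1 = A: the slopes add up to exactly A.
    set a := lam * (A - c1) with ha
    -- This is log y ≤ y − 1 at y = e^{−a}/r.
    have h2 : r * -Real.log r ≤ r * a + Real.exp (-a) := by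
      have h3 := Real.log_le_sub_one_of_pos (div_pos (Real.exp_pos (-a)) hr0)
      rw [Real.log_div (Real.exp_pos _).ne' hr0.ne', Real.log_exp] at h3
      have h4 := mul_le_mul_of_nonneg_left h3 hr0.le
      have h5 : r * (Real.exp (-a) / r - 1) = Real.exp (-a) - r := by field_simp
      rw [h5] at h4
      linarith
    have h6 : 2 * r * ((d * -Real.log r + c) / β) = lam⁻¹ * (r * -Real.log r) + r * c1 := by
      rw [hc1, hβ]; field_simp
    rw [h6] at h1
    have h7 : lam⁻¹ * (r * -Real.log r) ≤ lam⁻¹ * (r * a + Real.exp (-a)) := by gcongr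
    have h8 : Real.exp (-a) = Real.exp (lam * c1) * Real.exp (-(lam * A)) := by
      rw [← Real.exp_add]; congr 1; rw [ha]; ring
    have h9 : lam⁻¹ * (r * a + Real.exp (-a)) + r * c1 =
        A * r + lam⁻¹ * Real.exp (lam * c1) * Real.exp (-(lam * A)) := by
      rw [h8, ha]; field_simp; ring
    linarith
  · have h1 := norm_sub_integral_le hf hβ0 hexp hC0 (x + torusProj w)
    have h2 := norm_sub_integral_le hf hβ0 hexp hC0 x
    have h3 := norm_sub_le_norm_sub_add_norm_sub (f (x + torusProj w)) (∫ y, f y) (f x)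
    rw [norm_sub_rev (∫ y, f y)] at h3
    have h4 : A ≤ A * ‖w‖ := le_mul_of_one_le_right hA0 hw
    linarith

end Modulus

/-! ### The continuous representative -/

section ContRep
variable {d : ℕ}

/-- `f` has modulus of continuity `r ↦ A r + ε`. -/
def HasModulus (A ε : ℝ) (f : UnitAddTorus (Fin d) → Euc d) : Prop :=
  ∀ x w, ‖f (x + torusProj w) - f x‖ ≤ A * ‖w‖ + ε

theorem norm_torusConv_moll_sub_le {N : ℕ} {g : UnitAddTorus (Fin d) → Euc d} (hg : Continuous g)
    (x : UnitAddTorus (Fin d)) :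
    ‖torusConv (moll N) g x - g x‖ ≤ ∫ z, moll N z * ‖g (x - z) - g x‖ := by
  have hKc := continuous_moll (d := d) N
  have h1 : torusConv (moll N) g x - g x = ∫ y, moll N (x - y) • (g y - g x) := by
    simp only [smul_sub]
    rw [integral_sub (integrable_torusConv hKc hg.integrable_torus x)
      (integrable_torusConv hKc (integrable_const _) x), integral_smul_const, integral_moll_sub,
      one_smul]
    rfl
  have h2 : ∫ z, moll N z * ‖g (x - z) - g x‖ = ∫ y, moll N (x - y) * ‖g y - g x‖ := by
    rw [← integral_sub_left_eq_self (fun z => moll N z * ‖g (x - z) - g x‖) volume x]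
    simp
  rw [h1, h2]
  refine norm_integral_le_of_norm_le
    (by fun_prop : Continuous fun y => moll N (x - y) * ‖g y - g x‖).integrable_torus
    (Eventually.of_forall fun y => ?_)
  rw [norm_smul, Real.norm_of_nonneg (moll_nonneg _ _)]

theorem tendsto_torusConv_moll {g : UnitAddTorus (Fin d) → Euc d} (hg : Continuous g)
    (x : UnitAddTorus (Fin d)) :
    Tendsto (fun N => torusConv (moll N) g x) atTop (𝓝 (g x)) := by
  rw [tendsto_iff_norm_sub_tendsto_zero]
  have h := tendsto_integral_moll_mul (g := fun z => ‖g (x - z) - g x‖) (by fun_prop)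
  simp only [sub_zero, sub_self, norm_zero] at h
  exact squeeze_zero (fun _ => norm_nonneg _) (fun N => norm_torusConv_moll_sub_le hg x) h

/-- The first moment of the mollifying kernel. -/
noncomputable def mollMoment (d N : ℕ) : ℝ := ∫ y : UnitAddTorus (Fin d), moll N y * (d * ‖y‖)

theorem tendsto_mollMoment : Tendsto (mollMoment d) atTop (𝓝 0) := by
  have h := tendsto_integral_moll_mul (d := d) (g := fun z => d * ‖z‖) (by fun_prop)
  unfold mollMoment
  simpa using h

/-- The kernel averages the modulus over displacements; each −z has a lift of norm at most d‖z‖,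
which is why `mollMoment` carries the factor d. -/
theorem HasModulus.norm_torusConv_sub_le {N : ℕ} {g : UnitAddTorus (Fin d) → Euc d}
    (hg : Continuous g) {A ε : ℝ} (hA : 0 ≤ A) (h : HasModulus A ε g) (x : UnitAddTorus (Fin d)) :
    ‖torusConv (moll N) g x - g x‖ ≤ A * mollMoment d N + ε := by
  have hKc := continuous_moll (d := d) N
  refine (norm_torusConv_moll_sub_le hg x).trans ?_
  have h1 : A * mollMoment d N + ε = ∫ z : UnitAddTorus (Fin d), moll N z * (A * (d * ‖z‖) + ε) := by
    simp only [mul_add]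
    rw [integral_add (by fun_prop : Continuous fun z : UnitAddTorus (Fin d) =>
        moll N z * (A * (d * ‖z‖))).integrable_torus
      ((integrable_moll N).mul_const ε), integral_mul_const, integral_moll, one_mul, mollMoment,
      ← integral_const_mul]
    congr 2
    ext z; ring
  rw [h1]
  refine integral_mono (by fun_prop : Continuous _).integrable_torus
    (by fun_prop : Continuous _).integrable_torus fun z => ?_
  refine mul_le_mul_of_nonneg_left ?_ (moll_nonneg _ _)
  obtain ⟨w, hw, hwn⟩ := exists_torusProj_norm_le (-z)
  rw [norm_neg] at hwn
  have h2 := h x w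
  rw [hw, ← sub_eq_add_neg] at h2
  have h3 : A * ‖w‖ ≤ A * (d * ‖z‖) := by gcongr
  linarith

theorem integrable_prod_torusConv {F : Type*} [NormedAddCommGroup F] [NormedSpace ℝ F]
    {K : UnitAddTorus (Fin d) × UnitAddTorus (Fin d) → ℝ} (hK : Continuous K)
    {f : UnitAddTorus (Fin d) → F} (hf : Integrable f) :
    Integrable (fun p : UnitAddTorus (Fin d) × UnitAddTorus (Fin d) => K p • f p.2)
      (volume.prod volume) := by
  obtain ⟨C, hC⟩ := isCompact_univ.exists_bound_of_continuousOn hK.continuousOn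
  exact (hf.comp_snd (μ := volume)).bdd_smul C hK.aestronglyMeasurable
    (Eventually.of_forall fun p => hC p (mem_univ _))

/-- Needed to compare two mollifications of f through their common double mollification. -/
theorem torusConv_comm {K₁ K₂ : UnitAddTorus (Fin d) → ℝ} (h₁ : Continuous K₁) (h₂ : Continuous K₂)
    {f : UnitAddTorus (Fin d) → Euc d} (hf : Integrable f) :
    torusConv K₁ (torusConv K₂ f) = torusConv K₂ (torusConv K₁ f) := by
  have key : ∀ K₁ K₂ : UnitAddTorus (Fin d) → ℝ, Continuous K₁ → Continuous K₂ → ∀ x,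
      torusConv K₁ (torusConv K₂ f) x = ∫ z, (∫ y, K₁ (x - y) * K₂ (y - z)) • f z := by
    intro K₁ K₂ h₁ h₂ x
    unfold torusConv
    simp only [← integral_smul]
    rw [integral_integral_swap]
    · refine integral_congr_ae (Eventually.of_forall fun z => ?_)
      simp only [smul_smul]
      rw [integral_smul_const]
    · have := integrable_prod_torusConv (f := f)
        (K := fun p => K₁ (x - p.1) * K₂ (p.1 - p.2)) (by fun_prop) hf
      refine this.congr (Eventually.of_forall fun p => ?_)
      simp [Function.uncurry, smul_smul]
  ext1 x
  rw [key _ _ h₁ h₂, key _ _ h₂ h₁]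
  refine integral_congr_ae (Eventually.of_forall fun z => ?_)
  simp only
  congr 1
  -- The reflection y ↦ x + z − y exchanges the two kernels.
  rw [← integral_sub_left_eq_self (fun y => K₁ (x - y) * K₂ (y - z)) volume (x + z)]
  refine integral_congr_ae (Eventually.of_forall fun y => ?_)
  simp only
  rw [mul_comm]
  congr 2 <;> abel

theorem integral_norm_torusConv_le {N : ℕ} {f : UnitAddTorus (Fin d) → Euc d} (hf : Integrable f) :
    ∫ x, ‖torusConv (moll N) f x‖ ≤ ∫ y, ‖f y‖ := by
  have hKc := continuous_moll (d := d) N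
  have hi : Integrable (fun p : UnitAddTorus (Fin d) × UnitAddTorus (Fin d) =>
      moll N (p.1 - p.2) * ‖f p.2‖) (volume.prod volume) :=
    integrable_prod_torusConv (K := fun p => moll N (p.1 - p.2)) (by fun_prop) hf.norm
  calc ∫ x, ‖torusConv (moll N) f x‖ ≤ ∫ x, ∫ y, moll N (x - y) * ‖f y‖ := by
        refine integral_mono_of_nonneg (Eventually.of_forall fun x => norm_nonneg _)
          hi.integral_prod_left (Eventually.of_forall fun x => ?_)
        refine norm_integral_le_of_norm_le (integrable_torusConv_mul hKc hf.norm x)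
          (Eventually.of_forall fun y => ?_)
        rw [norm_smul, Real.norm_of_nonneg (moll_nonneg _ _)]
    _ = ∫ y, ∫ x, moll N (x - y) * ‖f y‖ := integral_integral_swap hi
    _ = ∫ y, ‖f y‖ := by
        refine integral_congr_ae (Eventually.of_forall fun y => ?_)
        simp only
        rw [integral_mul_const, integral_sub_right_eq_self (moll N), integral_moll, one_mul]

theorem continuous_torusConv_moll {N : ℕ} {f : UnitAddTorus (Fin d) → Euc d} (hf : Integrable f) :
    Continuous (torusConv (moll N) f) :=
  (torusC1_torusConv (torusSmooth_moll N).torusC1 hf).continuous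

theorem torusConv_sub {K : UnitAddTorus (Fin d) → ℝ} (hK : Continuous K)
    {f g : UnitAddTorus (Fin d) → Euc d} (hf : Integrable f) (hg : Integrable g)
    (x : UnitAddTorus (Fin d)) :
    torusConv K (fun y => f y - g y) x = torusConv K f x - torusConv K g x := by
  simp only [torusConv, smul_sub]
  exact integral_sub (integrable_torusConv hK hf x) (integrable_torusConv hK hg x)

theorem torusConv_neg (K : UnitAddTorus (Fin d) → ℝ) (f : UnitAddTorus (Fin d) → Euc d)
    (x : UnitAddTorus (Fin d)) :
    torusConv K (fun y => -f y) x = -torusConv K f x := by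
  simp only [torusConv, smul_neg]
  exact integral_neg _

/-- Density of continuous functions in L¹ and the L¹-contractivity of mollification. This identifies
the uniform limit of the mollifications with f almost everywhere. -/
theorem tendsto_integral_norm_torusConv_sub {f : UnitAddTorus (Fin d) → Euc d}
    (hf : Integrable f) :
    Tendsto (fun N => ∫ x, ‖torusConv (moll N) f x - f x‖) atTop (𝓝 0) := by
  rw [Metric.tendsto_atTop]
  intro ε hε
  obtain ⟨g, -, hg2, hg3, hgi⟩ := hf.exists_hasCompactSupport_integral_sub_le
    (show (0 : ℝ) < ε / 4 by positivity)
  have hlim : Tendsto (fun N => ∫ x, ‖torusConv (moll N) g x - g x‖) atTop (𝓝 0) := by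
    obtain ⟨M, hM0, hM⟩ := exists_norm_bound hg3
    have h0 : ∫ x : UnitAddTorus (Fin d), ‖g x - g x‖ = 0 := by simp
    rw [← h0]
    refine tendsto_integral_of_dominated_convergence (fun _ => M + M) (fun N => ?_)
      (integrable_const _) (fun N => Eventually.of_forall fun x => ?_)
      (Eventually.of_forall fun x => ?_)
    · have := continuous_torusConv_moll (N := N) hgi
      exact (by fun_prop : Continuous fun x => ‖torusConv (moll N) g x - g x‖).aestronglyMeasurable
    · rw [norm_norm]
      refine (norm_sub_le _ _).trans (add_le_add ?_ (hM x))
      have h1 : ∫ y, moll N (x - y) * M = M := by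
        rw [integral_mul_const, integral_moll_sub, one_mul]
      rw [← h1]
      refine norm_integral_le_of_norm_le (((integrable_moll N).comp_sub_left x).mul_const M)
        (Eventually.of_forall fun y => ?_)
      rw [norm_smul, Real.norm_of_nonneg (moll_nonneg _ _)]
      exact mul_le_mul_of_nonneg_left (hM y) (moll_nonneg _ _)
    · exact ((tendsto_torusConv_moll hg3 x).sub_const (g x)).norm
  obtain ⟨N₀, hN₀⟩ := Metric.tendsto_atTop.1 hlim (ε / 4) (by positivity)
  refine ⟨N₀, fun N hN => ?_⟩
  have h1 := hN₀ N hN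
  rw [Real.dist_eq, sub_zero, abs_of_nonneg (integral_nonneg fun _ => norm_nonneg _)] at h1 ⊢
  have hfg : Integrable fun x => f x - g x := hf.sub hgi
  have h2 := integral_norm_torusConv_le (N := N) hfg
  have hc1 := (continuous_torusConv_moll (N := N) hf).integrable_torus
  have hc2 := (continuous_torusConv_moll (N := N) hgi).integrable_torus
  have hc3 := (continuous_torusConv_moll (N := N) hfg).integrable_torus
  have hc4 : Integrable fun x => torusConv (moll N) g x - g x := hc2.sub hgi
  have h5 : Integrable fun x => ‖torusConv (moll N) (fun y => f y - g y) x‖ +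
      ‖torusConv (moll N) g x - g x‖ := hc3.norm.add hc4.norm
  have h3 : ∫ x, ‖torusConv (moll N) f x - f x‖ ≤ ∫ x, (‖torusConv (moll N) (fun y => f y - g y) x‖
      + ‖torusConv (moll N) g x - g x‖ + ‖f x - g x‖) := by
    refine integral_mono (hc1.sub hf).norm ((hc3.norm.add hc4.norm).add hfg.norm)
      fun x => ?_
    simp only
    rw [torusConv_sub (continuous_moll N) hf hgi]
    have h4 : torusConv (moll N) f x - f x = (torusConv (moll N) f x - torusConv (moll N) g x) +
      (torusConv (moll N) g x - g x) - (f x - g x) := by abel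
    rw [h4]
    exact (norm_sub_le _ _).trans (add_le_add (norm_add_le _ _) le_rfl)
  rw [integral_add h5 hfg.norm, integral_add hc3.norm hc4.norm] at h3
  linarith

/-- The pointwise limit of the mollifications of `f`. -/
noncomputable def contRep (f : UnitAddTorus (Fin d) → Euc d) (x : UnitAddTorus (Fin d)) : Euc d :=
  limUnder atTop fun N => torusConv (moll N) f x

/-- All mollifications of `f` have the modulus of continuity `r ↦ A r + B exp (-λ A)`, for all
large `A`. -/
def MollModulus (lam B A₀ : ℝ) (f : UnitAddTorus (Fin d) → Euc d) : Prop :=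
  ∀ N A, A₀ ≤ A → HasModulus A (B * Real.exp (-(lam * A))) (torusConv (moll N) f)

section
variable {lam B A₀ : ℝ} {f : UnitAddTorus (Fin d) → Euc d}

/-- Each mollification is close to its own further mollification by the other kernel, and by
commutativity the two double mollifications agree. -/
theorem MollModulus.norm_sub_le (hf : Integrable f) (hA₀ : 0 ≤ A₀) (h : MollModulus lam B A₀ f)
    (N M : ℕ) {A : ℝ} (hA : A₀ ≤ A) (x : UnitAddTorus (Fin d)) :
    ‖torusConv (moll N) f x - torusConv (moll M) f x‖ ≤
      A * (mollMoment d N + mollMoment d M) + 2 * (B * Real.exp (-(lam * A))) := by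
  have h1 := (h N A hA).norm_torusConv_sub_le (N := M) (continuous_torusConv_moll hf)
    (hA₀.trans hA) x
  have h2 := (h M A hA).norm_torusConv_sub_le (N := N) (continuous_torusConv_moll hf)
    (hA₀.trans hA) x
  rw [torusConv_comm (continuous_moll M) (continuous_moll N) hf] at h1
  rw [norm_sub_rev] at h1
  have h3 := norm_sub_le_norm_sub_add_norm_sub (torusConv (moll N) f x)
    (torusConv (moll N) (torusConv (moll M) f) x) (torusConv (moll M) f x)
  linarith

end

theorem tendsto_exp_neg_mul {lam : ℝ} (hlam : 0 < lam) (B : ℝ) :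
    Tendsto (fun A : ℝ => B * Real.exp (-(lam * A))) atTop (𝓝 0) := by
  have h1 : Tendsto (fun A : ℝ => lam * A) atTop atTop := tendsto_id.const_mul_atTop hlam
  simpa using (Real.tendsto_exp_neg_atTop_nhds_zero.comp h1).const_mul B

theorem exists_large_exp_le {lam : ℝ} (hlam : 0 < lam) (B A₀ : ℝ) {ε : ℝ} (hε : 0 < ε) :
    ∃ A, A₀ ≤ A ∧ B * Real.exp (-(lam * A)) ≤ ε := by
  obtain ⟨A, h1, h2⟩ := (((tendsto_exp_neg_mul hlam B).eventually (ge_mem_nhds hε)).and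
    (eventually_ge_atTop A₀)).exists
  exact ⟨A, h2, h1⟩

section
variable {lam B A₀ : ℝ} {f : UnitAddTorus (Fin d) → Euc d}

theorem MollModulus.tendsto (hf : Integrable f) (hlam : 0 < lam) (hA₀ : 0 ≤ A₀)
    (h : MollModulus lam B A₀ f)
    (x : UnitAddTorus (Fin d)) :
    Tendsto (fun N => torusConv (moll N) f x) atTop (𝓝 (contRep f x)) := by
  refine CauchySeq.tendsto_limUnder (Metric.cauchySeq_iff'.2 fun ε hε => ?_)
  obtain ⟨A, hA, hAε⟩ := exists_large_exp_le hlam B A₀ (show 0 < ε / 6 by positivity)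
  have hm := (tendsto_mollMoment (d := d)).const_mul (2 * A)
  rw [mul_zero] at hm
  obtain ⟨N, hN⟩ := eventually_atTop.1 (hm.eventually (gt_mem_nhds (show 0 < ε / 6 by positivity)))
  refine ⟨N, fun n hn => ?_⟩
  rw [dist_eq_norm]
  have h1 := MollModulus.norm_sub_le hf hA₀ h n N hA x
  have h2 := hN n hn
  have h3 := hN N le_rfl
  linarith

theorem MollModulus.norm_sub_contRep_le (hf : Integrable f) (hlam : 0 < lam) (hA₀ : 0 ≤ A₀)
    (h : MollModulus lam B A₀ f)
    (N : ℕ) {A : ℝ} (hA : A₀ ≤ A) (x : UnitAddTorus (Fin d)) :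
    ‖torusConv (moll N) f x - contRep f x‖ ≤
      A * mollMoment d N + 2 * (B * Real.exp (-(lam * A))) := by
  have h1 := ((MollModulus.tendsto hf hlam hA₀ h x).const_sub (torusConv (moll N) f x)).norm
  have h2 : Tendsto (fun M => A * (mollMoment d N + mollMoment d M) +
      2 * (B * Real.exp (-(lam * A)))) atTop
      (𝓝 (A * (mollMoment d N + 0) + 2 * (B * Real.exp (-(lam * A))))) :=
    ((tendsto_mollMoment.const_add _).const_mul A).add_const _
  rw [add_zero] at h2
  exact le_of_tendsto_of_tendsto' h1 h2 fun M => MollModulus.norm_sub_le hf hA₀ h N M hA x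

theorem MollModulus.hasModulus_contRep (hf : Integrable f) (hlam : 0 < lam) (hA₀ : 0 ≤ A₀)
    (h : MollModulus lam B A₀ f)
    {A : ℝ} (hA : A₀ ≤ A) :
    HasModulus A (B * Real.exp (-(lam * A))) (contRep f) := by
  intro x w
  have h1 := ((MollModulus.tendsto hf hlam hA₀ h (x + torusProj w)).sub
    (MollModulus.tendsto hf hlam hA₀ h x)).norm
  exact le_of_tendsto' h1 fun N => h N A hA x w

/-- The order of choices matters: A makes the exponential remainder small, and only then N makes A
times the kernel moment small. -/
theorem MollModulus.exists_norm_sub_contRep_le (hf : Integrable f) (hlam : 0 < lam) (hA₀ : 0 ≤ A₀)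
    (h : MollModulus lam B A₀ f)
    {ε : ℝ} (hε : 0 < ε) :
    ∃ N₀, ∀ N ≥ N₀, ∀ x, ‖torusConv (moll N) f x - contRep f x‖ ≤ ε := by
  obtain ⟨A, hA, hAε⟩ := exists_large_exp_le hlam B A₀ (show 0 < ε / 4 by positivity)
  have hm := (tendsto_mollMoment (d := d)).const_mul A
  rw [mul_zero] at hm
  obtain ⟨N, hN⟩ := eventually_atTop.1 (hm.eventually (ge_mem_nhds (show 0 < ε / 2 by positivity)))
  refine ⟨N, fun n hn x => ?_⟩
  have h1 := MollModulus.norm_sub_contRep_le hf hlam hA₀ h n hA x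
  have h2 := hN n hn
  linarith

theorem MollModulus.continuous_contRep (hf : Integrable f) (hlam : 0 < lam) (hA₀ : 0 ≤ A₀)
    (h : MollModulus lam B A₀ f) : Continuous (contRep f) := by
  have hu : TendstoUniformly (fun N => torusConv (moll N) f) (contRep f) atTop := by
    rw [Metric.tendstoUniformly_iff]
    intro ε hε
    obtain ⟨N₀, hN₀⟩ := MollModulus.exists_norm_sub_contRep_le hf hlam hA₀ h
      (show 0 < ε / 2 by positivity)
    filter_upwards [eventually_ge_atTop N₀] with N hN x
    rw [dist_comm, dist_eq_norm]
    linarith [hN₀ N hN x]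
  exact hu.continuous (Frequently.of_forall fun N => continuous_torusConv_moll hf)

theorem MollModulus.contRep_ae_eq (hf : Integrable f) (hlam : 0 < lam) (hA₀ : 0 ≤ A₀)
    (h : MollModulus lam B A₀ f) : contRep f =ᵐ[volume] f := by
  have hc := (MollModulus.continuous_contRep hf hlam hA₀ h).integrable_torus
  have hcf : Integrable fun x => contRep f x - f x := hc.sub hf
  have key : ∫ x, ‖contRep f x - f x‖ = 0 := by
    refine le_antisymm (le_of_forall_pos_le_add fun ε hε => ?_)
      (integral_nonneg fun _ => norm_nonneg _)
    obtain ⟨N₀, hN₀⟩ := MollModulus.exists_norm_sub_contRep_le hf hlam hA₀ h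
      (show 0 < ε / 2 by positivity)
    obtain ⟨N, hN1, hN2⟩ := (((tendsto_integral_norm_torusConv_sub hf).eventually
      (ge_mem_nhds (show 0 < ε / 2 by positivity))).and (eventually_ge_atTop N₀)).exists
    have hci : Integrable fun x => torusConv (moll N) f x - f x :=
      (continuous_torusConv_moll (N := N) hf).integrable_torus.sub hf
    have h1 : ∫ x, ‖contRep f x - f x‖ ≤ ∫ x, (ε / 2 + ‖torusConv (moll N) f x - f x‖) := by
      refine integral_mono hcf.norm ((integrable_const _).add hci.norm)
        fun x => ?_
      have h2 := norm_sub_le_norm_sub_add_norm_sub (contRep f x) (torusConv (moll N) f x) (f x)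
      rw [norm_sub_rev (contRep f x) (torusConv (moll N) f x)] at h2
      have h3 := hN₀ N hN2 x
      simp only
      linarith
    rw [integral_add (integrable_const _) hci.norm] at h1
    simp at h1
    linarith
  rw [integral_eq_zero_iff_of_nonneg (fun _ => norm_nonneg _) hcf.norm] at key
  filter_upwards [key] with x hx
  exact sub_eq_zero.1 (norm_eq_zero.1 hx)

/-- `limUnder` is meaningful only along convergent sequences, so compatibility with negation relies
on the modulus. It is used for the reversed field. -/
theorem MollModulus.contRep_neg (hf : Integrable f) (hlam : 0 < lam) (hA₀ : 0 ≤ A₀)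
    (h : MollModulus lam B A₀ f)
    (x : UnitAddTorus (Fin d)) :
    contRep (fun y => -f y) x = -contRep f x := by
  refine Tendsto.limUnder_eq ?_
  simp only [torusConv_neg]
  exact (MollModulus.tendsto hf hlam hA₀ h x).neg

end

end ContRep

/-! ### Fields with exponentially integrable gradient, and approximate solutions -/

section Field
variable {d : ℕ}

/-- A time-dependent field on `[0, T]` with weak gradient `D`, exponential moments of the gradient
bounded by `C`, and divergence bounded by `L`. -/
structure ExpField (T L : ℝ) (C : ℝ → ℝ) (b : ℝ → UnitAddTorus (Fin d) → Euc d)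
    (D : ℝ → UnitAddTorus (Fin d) → Matrix (Fin d) (Fin d) ℝ) : Prop where
  dim_pos : 1 ≤ d
  integrable : Integrable (fun z : ℝ × UnitAddTorus (Fin d) => b z.1 z.2)
      ((volume.restrict (Icc 0 T)).prod volume)
  grad : ∀ t ∈ Icc 0 T, IsWeakGradient (b t) (D t)
  C_nonneg : ∀ β, 0 ≤ C β
  exp_le : ∀ β : ℝ, 0 < β → ∀ t ∈ Icc 0 T,
      ∫⁻ x, ENNReal.ofReal (Real.exp (β * matrixAbs (D t x))) ≤ ENNReal.ofReal (C β)
  div_le : ∀ᵐ t ∂(volume.restrict (Icc 0 T)), ∀ᵐ x : UnitAddTorus (Fin d), |(D t x).trace| ≤ L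

section
variable {T L : ℝ} {C : ℝ → ℝ} {b : ℝ → UnitAddTorus (Fin d) → Euc d}
    {D : ℝ → UnitAddTorus (Fin d) → Matrix (Fin d) (Fin d) ℝ}

theorem ExpField.integrable_at (H : ExpField T L C b D) {t : ℝ} (ht : t ∈ Icc 0 T) :
    Integrable (b t) := (H.grad t ht).integrable H.dim_pos

theorem ExpField.lintegral_exp_le (H : ExpField T L C b D) {t : ℝ} (ht : t ∈ Icc 0 T) (N : ℕ)
    {β : ℝ} (hβ : 0 < β) :
    ∫⁻ x, ENNReal.ofReal (Real.exp (β * ‖torusConvDeriv (moll N) (b t) x‖)) ≤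
      ENNReal.ofReal (C (β * (d : ℝ) ^ 2)) := by
  have hd : (0 : ℝ) < d := by exact_mod_cast H.dim_pos
  have h1 := H.exp_le (β * (d : ℝ) ^ 2) (by positivity) t ht
  exact (lintegral_exp_torusConvDeriv_le (H.integrable_at ht) (H.grad t ht) hβ.le
    (h1.trans_lt ENNReal.ofReal_lt_top).ne).trans h1

theorem ExpField.exists_mollModulus (H : ExpField T L C b D) {lam : ℝ} (hlam : 0 < lam) :
    ∃ B A₀ : ℝ, 0 ≤ B ∧ 0 ≤ A₀ ∧ ∀ t ∈ Icc 0 T, MollModulus lam B A₀ (b t) := by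
  have hd : (0 : ℝ) < d := by exact_mod_cast H.dim_pos
  obtain ⟨B, A₀, hB, hA₀, h⟩ := exists_modulus H.dim_pos hlam
    (H.C_nonneg (2 * d * lam * (d : ℝ) ^ 2))
  exact ⟨B, A₀, hB, hA₀, fun t ht N A hA => h _ _
    (torusC1_torusConv (torusSmooth_moll N).torusC1 (H.integrable_at ht))
    (H.lintegral_exp_le ht N (by positivity)) A hA⟩

theorem ExpField.exists_norm_sub_contRep_le (H : ExpField T L C b D) {ε : ℝ} (hε : 0 < ε) :
    ∃ N₀, ∀ N ≥ N₀, ∀ t ∈ Icc 0 T, ∀ x,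
      ‖torusConv (moll N) (b t) x - contRep (b t) x‖ ≤ ε := by
  obtain ⟨B, A₀, -, hA₀, h⟩ := H.exists_mollModulus one_pos
  obtain ⟨A, hA, hAε⟩ := exists_large_exp_le one_pos B A₀ (show 0 < ε / 4 by positivity)
  have hm := (tendsto_mollMoment (d := d)).const_mul A
  rw [mul_zero] at hm
  obtain ⟨N, hN⟩ := eventually_atTop.1 (hm.eventually (ge_mem_nhds (show 0 < ε / 2 by positivity)))
  refine ⟨N, fun n hn t ht x => ?_⟩
  have h1 := (h t ht).norm_sub_contRep_le (H.integrable_at ht) one_pos hA₀ n hA x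
  have h2 := hN n hn
  linarith

theorem ExpField.tendsto_contRep (H : ExpField T L C b D) {t : ℝ} (ht : t ∈ Icc 0 T)
    (x : UnitAddTorus (Fin d)) :
    Tendsto (fun N => torusConv (moll N) (b t) x) atTop (𝓝 (contRep (b t) x)) := by
  obtain ⟨B, A₀, -, hA₀, h⟩ := H.exists_mollModulus one_pos
  exact (h t ht).tendsto (H.integrable_at ht) one_pos hA₀ x

theorem ExpField.continuous_contRep (H : ExpField T L C b D) {t : ℝ} (ht : t ∈ Icc 0 T) :
    Continuous (contRep (b t)) := by
  obtain ⟨B, A₀, -, hA₀, h⟩ := H.exists_mollModulus one_pos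
  exact (h t ht).continuous_contRep (H.integrable_at ht) one_pos hA₀

theorem ExpField.contRep_ae_eq (H : ExpField T L C b D) {t : ℝ} (ht : t ∈ Icc 0 T) :
    contRep (b t) =ᵐ[volume] b t := by
  obtain ⟨B, A₀, -, hA₀, h⟩ := H.exists_mollModulus one_pos
  exact (h t ht).contRep_ae_eq (H.integrable_at ht) one_pos hA₀

theorem ExpField.contRep_neg (H : ExpField T L C b D) {t : ℝ} (ht : t ∈ Icc 0 T)
    (x : UnitAddTorus (Fin d)) : contRep (fun y => -b t y) x = -contRep (b t) x := by
  obtain ⟨B, A₀, -, hA₀, h⟩ := H.exists_mollModulus one_pos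
  exact (h t ht).contRep_neg (H.integrable_at ht) one_pos hA₀ x

/-- Composing b itself with a curve need not be measurable, since b is controlled only up to null
sets. The mollified value is a parametric integral of a jointly integrable function, so Fubini
applies. -/
theorem ExpField.integrableOn_torusConv (H : ExpField T L C b D) (N : ℕ)
    (x : UnitAddTorus (Fin d)) {w : ℝ → Euc d}
    (hw : AEStronglyMeasurable w (volume.restrict (Icc 0 T))) :
    IntegrableOn (fun s => torusConv (moll N) (b s) (x + torusProj (w s))) (Icc 0 T) := by
  have hKc := continuous_moll (d := d) N
  have hPc := continuous_torusProj (d := d)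
  obtain ⟨M, -, hM⟩ := exists_norm_bound hKc
  obtain ⟨G, hG, hGe⟩ : ∃ G : Euc d × UnitAddTorus (Fin d) → ℝ, Continuous G ∧
      ∀ p, G p = moll N (x + torusProj p.1 - p.2) := ⟨_, by fun_prop, fun _ => rfl⟩
  have h0 : AEStronglyMeasurable (fun z : ℝ × UnitAddTorus (Fin d) => G (w z.1, z.2))
      ((volume.restrict (Icc 0 T)).prod volume) :=
    hG.comp_aestronglyMeasurable (hw.comp_fst.prodMk aestronglyMeasurable_id.comp_snd)
  have h1 : AEStronglyMeasurable (fun z : ℝ × UnitAddTorus (Fin d) =>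
      moll N (x + torusProj (w z.1) - z.2)) ((volume.restrict (Icc 0 T)).prod volume) := by
    simpa only [hGe] using h0
  have h2 : Integrable (fun z : ℝ × UnitAddTorus (Fin d) =>
      moll N (x + torusProj (w z.1) - z.2) • b z.1 z.2) ((volume.restrict (Icc 0 T)).prod volume) :=
    H.integrable.bdd_smul M h1 (Eventually.of_forall fun z => hM _)
  exact h2.integral_prod_left

theorem ExpField.integrableOn_integral_norm (H : ExpField T L C b D) :
    IntegrableOn (fun s => ∫ y, ‖b s y‖) (Icc 0 T) := H.integrable.norm.integral_prod_left

/-- Measurability passes to the pointwise limit, and one mollification that is uniformly within 1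
supplies the dominating function. -/
theorem ExpField.integrableOn_contRep (H : ExpField T L C b D)
    (x : UnitAddTorus (Fin d)) {w : ℝ → Euc d}
    (hw : AEStronglyMeasurable w (volume.restrict (Icc 0 T))) :
    IntegrableOn (fun s => contRep (b s) (x + torusProj (w s))) (Icc 0 T) := by
  obtain ⟨N, hN⟩ := H.exists_norm_sub_contRep_le one_pos
  have hm : AEStronglyMeasurable (fun s => contRep (b s) (x + torusProj (w s)))
      (volume.restrict (Icc 0 T)) := by
    refine aestronglyMeasurable_of_tendsto_ae atTop
      (fun N => (H.integrableOn_torusConv N x hw).aestronglyMeasurable) ?_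
    exact (ae_restrict_iff' measurableSet_Icc).2
      (Eventually.of_forall fun s hs => H.tendsto_contRep hs _)
  refine Integrable.mono' (((H.integrableOn_torusConv N x hw).norm).add (integrable_const 1)) hm ?_
  refine (ae_restrict_iff' measurableSet_Icc).2 (Eventually.of_forall fun s hs => ?_)
  have h1 := hN N le_rfl s hs (x + torusProj (w s))
  have h2 := norm_le_norm_add_norm_sub (torusConv (moll N) (b s) (x + torusProj (w s)))
    (contRep (b s) (x + torusProj (w s)))
  simp only [Pi.add_apply]
  linarith

end

/-- `w` solves `w(t) = ∫₀ᵗ c(s, x + w(s)) ds` on `[0, T]` up to an error `e`. -/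
def IsApproxSol (T : ℝ) (c : ℝ → UnitAddTorus (Fin d) → Euc d) (e : ℝ) (x : UnitAddTorus (Fin d))
    (w : ℝ → Euc d) : Prop :=
  ContinuousOn w (Icc 0 T) ∧
    ∀ t ∈ Icc 0 T, ‖w t - ∫ s in (0 : ℝ)..t, c s (x + torusProj (w s))‖ ≤ e

theorem intervalIntegrable_of_Icc {F : Type*} [NormedAddCommGroup F] {g : ℝ → F} {T a t : ℝ}
    (hg : IntegrableOn g (Icc 0 T)) (ha : a ∈ Icc 0 T) (ht : t ∈ Icc 0 T) :
    IntervalIntegrable g volume a t :=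
  (hg.mono_set (uIcc_subset_Icc ha ht)).intervalIntegrable

/-- The right-hand side F satisfies F' = A u ≤ A F, so F(t) e^{−At} is nonincreasing. -/
theorem gronwall_integral {T A c : ℝ} {u : ℝ → ℝ} (hA : 0 ≤ A)
    (hu : ContinuousOn u (Icc 0 T))
    (h : ∀ t ∈ Icc 0 T, u t ≤ c + A * ∫ s in (0 : ℝ)..t, u s) {t : ℝ} (ht : t ∈ Icc 0 T) :
    u t ≤ c * Real.exp (A * t) := by
  set F : ℝ → ℝ := fun t => c + A * ∫ s in (0 : ℝ)..t, u s with hF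
  have h0T : (0 : ℝ) ∈ Icc 0 T := ⟨le_rfl, ht.1.trans ht.2⟩
  have hui : IntegrableOn u (Icc 0 T) := hu.integrableOn_Icc
  have hFc : ContinuousOn F (Icc 0 T) := by
    refine continuousOn_const.add (continuousOn_const.mul ?_)
    have := intervalIntegral.continuousOn_primitive_interval' (a := 0)
      (intervalIntegrable_of_Icc hui h0T ⟨h0T.2, le_rfl⟩) (by simp)
    rwa [uIcc_of_le h0T.2] at this
  have hder : ∀ s ∈ Ioo 0 T, HasDerivAt F (A * u s) s := by
    intro s hs
    have hsI : s ∈ Icc 0 T := Ioo_subset_Icc_self hs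
    have hcs : ContinuousAt u s := hu.continuousAt (Icc_mem_nhds hs.1 hs.2)
    have h1 := intervalIntegral.integral_hasDerivAt_right (intervalIntegrable_of_Icc hui h0T hsI)
      (hu.stronglyMeasurableAtFilter_nhdsWithin measurableSet_Icc s |>.filter_mono
        (by rw [nhdsWithin_eq_nhds.2 (Icc_mem_nhds hs.1 hs.2)])) hcs
    exact (h1.const_mul A).const_add c
  have hG : AntitoneOn (fun s => F s * Real.exp (-(A * s))) (Icc 0 T) := by
    refine antitoneOn_of_hasDerivWithinAt_nonpos
      (f' := fun s => (A * u s) * Real.exp (-(A * s)) + F s * (Real.exp (-(A * s)) * -A))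
      (convex_Icc 0 T) (hFc.mul (by fun_prop)) ?_ ?_
    · intro s hs
      rw [interior_Icc] at hs
      have h2 : HasDerivAt (fun s => Real.exp (-(A * s))) (Real.exp (-(A * s)) * -A) s := by
        have h3 : HasDerivAt (fun s => -(A * s)) (-A) s := by
          simpa using! ((hasDerivAt_id s).const_mul A).neg
        exact h3.exp
      exact ((hder s hs).mul h2).hasDerivWithinAt
    · intro s hs
      rw [interior_Icc] at hs
      have h3 : u s ≤ F s := h s (Ioo_subset_Icc_self hs)
      have h4 : (A * u s) * Real.exp (-(A * s)) + F s * (Real.exp (-(A * s)) * -A) =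
          A * Real.exp (-(A * s)) * (u s - F s) := by ring
      rw [h4]
      exact mul_nonpos_of_nonneg_of_nonpos (by positivity) (by linarith)
  have h5 := hG h0T ht ht.1
  simp only [hF, intervalIntegral.integral_same, mul_zero, add_zero, neg_zero, Real.exp_zero,
    mul_one] at h5
  have h6 := mul_le_mul_of_nonneg_right h5 (Real.exp_pos (A * t)).le
  rw [mul_assoc, ← Real.exp_add, neg_add_cancel, Real.exp_zero, mul_one] at h6
  exact (h t ht).trans h6

/-! ### Stability, uniqueness and limits of approximate solutions. -/

section
variable {T L : ℝ} {C : ℝ → ℝ} {b : ℝ → UnitAddTorus (Fin d) → Euc d}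
    {D : ℝ → UnitAddTorus (Fin d) → Matrix (Fin d) (Fin d) ℝ}

/-- Gronwall with slope A turns the total error 2e + T B e^{−λA} into at most its product with
e^{AT}. With λ = T + 1 the second part becomes T B e^{−A}, which vanishes as A → ∞; then e is chosen
small depending on A. This replaces an Osgood argument. -/
theorem ExpField.stability (H : ExpField T L C b D) (hT : 0 ≤ T) {ε : ℝ} (hε : 0 < ε) :
    ∃ e > 0, ∀ x w₁ w₂, IsApproxSol T (fun s => contRep (b s)) e x w₁ →
      IsApproxSol T (fun s => contRep (b s)) e x w₂ → ∀ t ∈ Icc 0 T, ‖w₁ t - w₂ t‖ ≤ ε := by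
  have hlam : 0 < T + 1 := by positivity
  obtain ⟨B, A₀, hB, hA₀, hmod⟩ := H.exists_mollModulus hlam
  -- Rate one is what remains of λ = T + 1 after the Gronwall factor e^{AT}.
  obtain ⟨A, hA, hAε⟩ := exists_large_exp_le one_pos (T * B) A₀ (half_pos hε)
  have hA0 := hA₀.trans hA
  -- After amplification by e^{AT} the two errors e contribute ε/2 together.
  refine ⟨ε / 4 * Real.exp (-(A * T)), by positivity, fun x w₁ w₂ h₁ h₂ t ht => ?_⟩
  set e := ε / 4 * Real.exp (-(A * T)) with he
  set η := B * Real.exp (-((T + 1) * A)) with hη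
  have hη0 : 0 ≤ η := by positivity
  have hu : ContinuousOn (fun s => ‖w₁ s - w₂ s‖) (Icc 0 T) := (h₁.1.sub h₂.1).norm
  have h0T : (0 : ℝ) ∈ Icc 0 T := ⟨le_rfl, hT⟩
  have hi₁ := H.integrableOn_contRep x (h₁.1.aestronglyMeasurable measurableSet_Icc)
  have hi₂ := H.integrableOn_contRep x (h₂.1.aestronglyMeasurable measurableSet_Icc)
  have key : ∀ t ∈ Icc 0 T, ‖w₁ t - w₂ t‖ ≤ (2 * e + T * η) +
      A * ∫ s in (0 : ℝ)..t, ‖w₁ s - w₂ s‖ := by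
    intro t ht
    have hui := intervalIntegrable_of_Icc hu.integrableOn_Icc h0T ht
    have h3 : ‖(∫ s in (0 : ℝ)..t, contRep (b s) (x + torusProj (w₁ s))) -
        ∫ s in (0 : ℝ)..t, contRep (b s) (x + torusProj (w₂ s))‖ ≤
        ∫ s in (0 : ℝ)..t, (A * ‖w₁ s - w₂ s‖ + η) := by
      rw [← intervalIntegral.integral_sub (intervalIntegrable_of_Icc hi₁ h0T ht)
        (intervalIntegrable_of_Icc hi₂ h0T ht)]
      refine intervalIntegral.norm_integral_le_of_norm_le ht.1 (Eventually.of_forall fun s hs => ?_)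
        ((hui.const_mul A).add intervalIntegrable_const)
      have hsI : s ∈ Icc 0 T := ⟨hs.1.le, hs.2.trans ht.2⟩
      have h4 := (hmod s hsI).hasModulus_contRep (H.integrable_at hsI) hlam hA₀ hA
        (x + torusProj (w₂ s)) (w₁ s - w₂ s)
      rw [add_assoc, ← torusProj_add, add_sub_cancel] at h4
      exact h4
    rw [intervalIntegral.integral_add (hui.const_mul A) intervalIntegrable_const,
      intervalIntegral.integral_const_mul, intervalIntegral.integral_const, sub_zero,
      smul_eq_mul] at h3
    have h5 : t * η ≤ T * η := mul_le_mul_of_nonneg_right ht.2 hη0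
    have h6 := h₁.2 t ht
    have h7 := h₂.2 t ht
    have h8 : w₁ t - w₂ t = (w₁ t - ∫ s in (0 : ℝ)..t, contRep (b s) (x + torusProj (w₁ s))) -
        (w₂ t - ∫ s in (0 : ℝ)..t, contRep (b s) (x + torusProj (w₂ s))) +
        ((∫ s in (0 : ℝ)..t, contRep (b s) (x + torusProj (w₁ s))) -
        ∫ s in (0 : ℝ)..t, contRep (b s) (x + torusProj (w₂ s))) := by abel
    rw [h8]
    refine (norm_add_le _ _).trans ?_
    have h9 := norm_sub_le (w₁ t - ∫ s in (0 : ℝ)..t, contRep (b s) (x + torusProj (w₁ s)))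
      (w₂ t - ∫ s in (0 : ℝ)..t, contRep (b s) (x + torusProj (w₂ s)))
    linarith
  have h10 := gronwall_integral hA0 hu key ht
  have hc : 0 ≤ 2 * e + T * η := by positivity
  have h11 : Real.exp (A * t) ≤ Real.exp (A * T) :=
    Real.exp_le_exp.2 (mul_le_mul_of_nonneg_left ht.2 hA0)
  have h12 : (2 * e + T * η) * Real.exp (A * T) = ε / 2 + T * B * Real.exp (-(1 * A)) := by
    rw [he, hη]
    have e1 : Real.exp (-(A * T)) * Real.exp (A * T) = 1 := by
      rw [← Real.exp_add]; simp
    have e2 : Real.exp (-((T + 1) * A)) * Real.exp (A * T) = Real.exp (-(1 * A)) := by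
      rw [← Real.exp_add]; congr 1; ring
    rw [← e2]
    linear_combination (ε / 2) * e1
  calc ‖w₁ t - w₂ t‖ ≤ (2 * e + T * η) * Real.exp (A * t) := h10
    _ ≤ (2 * e + T * η) * Real.exp (A * T) := mul_le_mul_of_nonneg_left h11 hc
    _ ≤ ε := by rw [h12]; linarith

theorem IsApproxSol.mono {T : ℝ} {c : ℝ → UnitAddTorus (Fin d) → Euc d} {e e' : ℝ}
    {x : UnitAddTorus (Fin d)} {w : ℝ → Euc d} (h : IsApproxSol T c e x w) (he : e ≤ e') :
    IsApproxSol T c e' x w := ⟨h.1, fun t ht => (h.2 t ht).trans he⟩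

theorem ExpField.unique (H : ExpField T L C b D) (hT : 0 ≤ T) {x : UnitAddTorus (Fin d)}
    {w₁ w₂ : ℝ → Euc d} (h₁ : IsApproxSol T (fun s => contRep (b s)) 0 x w₁)
    (h₂ : IsApproxSol T (fun s => contRep (b s)) 0 x w₂) {t : ℝ} (ht : t ∈ Icc 0 T) :
    w₁ t = w₂ t := by
  refine sub_eq_zero.1 (norm_eq_zero.1 (le_antisymm (le_of_forall_pos_le_add fun ε hε => ?_)
    (norm_nonneg _)))
  obtain ⟨e, he, h⟩ := H.stability hT hε
  rw [zero_add]
  exact h x w₁ w₂ (h₁.mono he.le) (h₂.mono he.le) t ht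

/-- Families of approximate solutions with errors tending to zero converge uniformly to an exact
solution. -/
theorem ExpField.exists_limit (H : ExpField T L C b D) (hT : 0 ≤ T)
    (u : ℕ → UnitAddTorus (Fin d) → ℝ → Euc d)
    (hu : ∀ e > 0, ∀ᶠ j in atTop, ∀ x, IsApproxSol T (fun s => contRep (b s)) e x (u j x)) :
    ∃ v : UnitAddTorus (Fin d) → ℝ → Euc d,
      (∀ x, IsApproxSol T (fun s => contRep (b s)) 0 x (v x)) ∧
      ∀ ε > 0, ∀ᶠ j in atTop, ∀ x, ∀ t ∈ Icc 0 T, ‖u j x t - v x t‖ ≤ ε := by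
  have hcau : ∀ ε > 0, ∃ J, ∀ j ≥ J, ∀ k ≥ J, ∀ x, ∀ t ∈ Icc 0 T, ‖u j x t - u k x t‖ ≤ ε := by
    intro ε hε
    obtain ⟨e, he, h⟩ := H.stability hT hε
    obtain ⟨J, hJ⟩ := eventually_atTop.1 (hu e he)
    exact ⟨J, fun j hj k hk x t ht => h x _ _ (hJ j hj x) (hJ k hk x) t ht⟩
  have hlim : ∀ x, ∀ t ∈ Icc 0 T,
      Tendsto (fun j => u j x t) atTop (𝓝 (limUnder atTop fun j => u j x t)) := by
    intro x t ht
    refine CauchySeq.tendsto_limUnder (Metric.cauchySeq_iff'.2 fun ε hε => ?_)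
    obtain ⟨J, hJ⟩ := hcau (ε / 2) (half_pos hε)
    refine ⟨J, fun n hn => ?_⟩
    rw [dist_eq_norm]
    linarith [hJ n hn J le_rfl x t ht]
  set v : UnitAddTorus (Fin d) → ℝ → Euc d := fun x t => limUnder atTop fun j => u j x t with hv
  have hunif : ∀ ε > 0, ∀ᶠ j in atTop, ∀ x, ∀ t ∈ Icc 0 T, ‖u j x t - v x t‖ ≤ ε := by
    intro ε hε
    obtain ⟨J, hJ⟩ := hcau ε hε
    filter_upwards [eventually_ge_atTop J] with j hj x t ht
    refine le_of_tendsto ((hlim x t ht).const_sub (u j x t)).norm ?_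
    filter_upwards [eventually_ge_atTop J] with k hk using hJ j hj k hk x t ht
  refine ⟨v, fun x => ?_, hunif⟩
  have hvc : ContinuousOn (v x) (Icc 0 T) := by
    have htu : TendstoUniformlyOn (fun j => u j x) (v x) atTop (Icc 0 T) := by
      rw [Metric.tendstoUniformlyOn_iff]
      intro ε hε
      filter_upwards [hunif (ε / 2) (half_pos hε)] with j hj t ht
      rw [dist_comm, dist_eq_norm]
      linarith [hj x t ht]
    refine htu.continuousOn ?_
    exact ((hu 1 one_pos).mono fun j hj => (hj x).1).frequently
  refine ⟨hvc, fun t ht => le_of_forall_pos_le_add fun ε hε => ?_⟩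
  have h0T : (0 : ℝ) ∈ Icc 0 T := ⟨le_rfl, hT⟩
  obtain ⟨B, A₀, hB, hA₀, hmod⟩ := H.exists_mollModulus one_pos
  obtain ⟨A, hA, hAε⟩ := exists_large_exp_le one_pos (T * B) A₀ (show 0 < ε / 4 by positivity)
  have hA0 := hA₀.trans hA
  -- Makes δ + T A δ = ε/4: the distance of the curves plus its effect on the integral through the
  -- slope A.
  set δ := ε / (4 * (1 + T * A)) with hδ
  have hpos : 0 < 1 + T * A := by positivity
  have hδ0 : 0 < δ := by positivity
  obtain ⟨j, hj1, hj2⟩ := ((hu (ε / 4) (by positivity)).and (hunif δ hδ0)).exists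
  have hi₁ := H.integrableOn_contRep x ((hj1 x).1.aestronglyMeasurable measurableSet_Icc)
  have hi₂ := H.integrableOn_contRep x (hvc.aestronglyMeasurable measurableSet_Icc)
  have h3 : ‖(∫ s in (0 : ℝ)..t, contRep (b s) (x + torusProj (u j x s))) -
      ∫ s in (0 : ℝ)..t, contRep (b s) (x + torusProj (v x s))‖ ≤
      (A * δ + B * Real.exp (-(1 * A))) * |t - 0| := by
    rw [← intervalIntegral.integral_sub (intervalIntegrable_of_Icc hi₁ h0T ht)
      (intervalIntegrable_of_Icc hi₂ h0T ht)]
    refine intervalIntegral.norm_integral_le_of_norm_le_const fun s hs => ?_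
    rw [uIoc_of_le ht.1] at hs
    have hsI : s ∈ Icc 0 T := ⟨hs.1.le, hs.2.trans ht.2⟩
    have h4 := (hmod s hsI).hasModulus_contRep (H.integrable_at hsI) one_pos hA₀ hA
      (x + torusProj (v x s)) (u j x s - v x s)
    rw [add_assoc, ← torusProj_add, add_sub_cancel] at h4
    refine h4.trans ?_
    gcongr
    exact hj2 x s hsI
  have h5 : (A * δ + B * Real.exp (-(1 * A))) * |t - 0| ≤ T * A * δ + ε / 4 := by
    rw [sub_zero, abs_of_nonneg ht.1]
    calc (A * δ + B * Real.exp (-(1 * A))) * t ≤ (A * δ + B * Real.exp (-(1 * A))) * T := by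
          gcongr; exact ht.2
      _ = T * A * δ + T * B * Real.exp (-(1 * A)) := by ring
      _ ≤ _ := by linarith
  have h6 : δ + T * A * δ = ε / 4 := by
    rw [hδ]; field_simp
  have h7 := (hj1 x).2 t ht
  have h8 := hj2 x t ht
  have h9 : v x t - ∫ s in (0 : ℝ)..t, contRep (b s) (x + torusProj (v x s)) =
      -(u j x t - v x t) + (u j x t - ∫ s in (0 : ℝ)..t, contRep (b s) (x + torusProj (u j x s)))
      + ((∫ s in (0 : ℝ)..t, contRep (b s) (x + torusProj (u j x s))) -
      ∫ s in (0 : ℝ)..t, contRep (b s) (x + torusProj (v x s))) := by abel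
  rw [h9]
  refine (norm_add₃_le).trans ?_
  rw [norm_neg]
  linarith

end

end Field

/-! ### Compositions of perturbations of the identity -/

section Comp
variable {d : ℕ}

/-- The displacement of the composition of the maps `x ↦ x + W k x`. -/
noncomputable def compDisp (W : ℕ → UnitAddTorus (Fin d) → Euc d) :
    ℕ → UnitAddTorus (Fin d) → Euc d
  | 0 => fun _ => 0
  | k + 1 => fun x => compDisp W k x + W k (x + torusProj (compDisp W k x))

/-- The derivative of `compDisp`. -/
noncomputable def compDispDeriv (W : ℕ → UnitAddTorus (Fin d) → Euc d)
    (W' : ℕ → UnitAddTorus (Fin d) → Euc d →L[ℝ] Euc d) :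
    ℕ → UnitAddTorus (Fin d) → Euc d →L[ℝ] Euc d
  | 0 => fun _ => 0
  | k + 1 => fun x => compDispDeriv W W' k x + (W' k (x + torusProj (compDisp W k x))).comp
      (ContinuousLinearMap.id ℝ (Euc d) + compDispDeriv W W' k x)

variable {W : ℕ → UnitAddTorus (Fin d) → Euc d}
    {W' : ℕ → UnitAddTorus (Fin d) → Euc d →L[ℝ] Euc d} {n : ℕ}

theorem torusC1_compDisp (hW : ∀ k < n, TorusC1 (W k) (W' k)) :
    ∀ k ≤ n, TorusC1 (compDisp W k) (compDispDeriv W W' k) := by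
  intro k
  induction k with
  | zero =>
    intro _
    exact ⟨continuous_const, fun y => hasFDerivAt_const (0 : Euc d) _⟩
  | succ k ih =>
    intro hk
    have h1 := ih (by omega)
    have h2 := hW k (by omega)
    have hPc := continuous_torusProj (d := d)
    have hc := h1.continuous
    have hc' := h1.1
    have h2' := h2.1
    refine ⟨?_, fun y => ?_⟩
    · simp only [compDispDeriv]
      fun_prop
    · have h3 : HasFDerivAt (fun v : Euc d => v + compDisp W k (y + torusProj v))
          (ContinuousLinearMap.id ℝ (Euc d) + compDispDeriv W W' k y) 0 :=
        (hasFDerivAt_id _).add (h1.2 y)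
      have h4 := h2.hasFDerivAt y (0 + compDisp W k (y + torusProj 0))
      have h5 := HasFDerivAt.comp (0 : Euc d) h4 h3
      rw [torusProj_zero, add_zero, zero_add] at h5
      have h6 := (h1.2 y).add h5
      simpa only [compDisp, compDispDeriv, Function.comp_def, torusProj_add, ← add_assoc] using! h6

/-- By the chain rule the derivatives I + V multiply, so 1 + ‖V‖ grows at each step by a factor of
at most 1 + ‖A‖ ≤ e^{‖A‖}. -/
theorem one_add_norm_compDispDeriv_le (k : ℕ) (x : UnitAddTorus (Fin d)) :
    1 + ‖compDispDeriv W W' k x‖ ≤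
      Real.exp (∑ j ∈ Finset.range k, ‖W' j (x + torusProj (compDisp W j x))‖) := by
  induction k with
  | zero => simp [compDispDeriv]
  | succ k ih =>
    rw [Finset.sum_range_succ, Real.exp_add]
    simp only [compDispDeriv]
    set A := W' k (x + torusProj (compDisp W k x))
    set V := compDispDeriv W W' k x
    have h1 : ‖A.comp (ContinuousLinearMap.id ℝ (Euc d) + V)‖ ≤ ‖A‖ * (1 + ‖V‖) :=
      (ContinuousLinearMap.opNorm_comp_le _ _).trans (mul_le_mul_of_nonneg_left
        ((norm_add_le _ _).trans (add_le_add ContinuousLinearMap.norm_id_le le_rfl))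
        (norm_nonneg _))
    have h2 := norm_add_le V (A.comp (ContinuousLinearMap.id ℝ (Euc d) + V))
    calc 1 + ‖V + A.comp (ContinuousLinearMap.id ℝ (Euc d) + V)‖
        ≤ (1 + ‖V‖) * (‖A‖ + 1) := by linarith
      _ ≤ _ := mul_le_mul ih (Real.add_one_le_exp _) (by positivity) (Real.exp_pos _).le

theorem lintegral_comp_compDisp_le (hW : ∀ k < n, Continuous (W k)) {q : ℝ≥0∞}
    (hq : ∀ k < n, ∀ g : UnitAddTorus (Fin d) → ℝ≥0∞, Measurable g →
      ∫⁻ x, g (x + torusProj (W k x)) ≤ q * ∫⁻ x, g x) :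
    ∀ k ≤ n, ∀ g : UnitAddTorus (Fin d) → ℝ≥0∞, Measurable g →
      ∫⁻ x, g (x + torusProj (compDisp W k x)) ≤ q ^ k * ∫⁻ x, g x := by
  have hPc := continuous_torusProj (d := d)
  intro k
  induction k with
  | zero => intro _ g _; simp [compDisp]
  | succ k ih =>
    intro hk g hg
    have hWk := hW k (by omega)
    have h1 := ih (by omega) (fun y => g (y + torusProj (W k y)))
      (hg.comp (by fun_prop : Continuous fun y => y + torusProj (W k y)).measurable)
    have h2 := hq k (by omega) g hg
    calc ∫⁻ x, g (x + torusProj (compDisp W (k + 1) x))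
        = ∫⁻ x, g (x + torusProj (compDisp W k x) +
            torusProj (W k (x + torusProj (compDisp W k x)))) := by
          simp only [compDisp, torusProj_add, add_assoc]
      _ ≤ q ^ k * (q * ∫⁻ x, g x) := h1.trans (by gcongr)
      _ = q ^ (k + 1) * ∫⁻ x, g x := by rw [pow_succ, mul_assoc]

/-- The exponential of the sum along the orbit is averaged by Jensen into terms exp(n p ‖W' k‖) at
the k-th orbit point, and bounded compression removes the orbit. Steps of length T/n have W' of
order 1/n, so the exponents n p ‖W' k‖ do not degenerate as n grows. -/
theorem lintegral_compDispDeriv_pow_le (hn : 0 < n) (hW : ∀ k < n, TorusC1 (W k) (W' k))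
    {q M : ℝ≥0∞} (hq1 : 1 ≤ q)
    (hq : ∀ k < n, ∀ g : UnitAddTorus (Fin d) → ℝ≥0∞, Measurable g →
      ∫⁻ x, g (x + torusProj (W k x)) ≤ q * ∫⁻ x, g x) {p : ℕ}
    (hM : ∀ k < n, ∫⁻ x, ENNReal.ofReal (Real.exp ((n * p) * ‖W' k x‖)) ≤ M) :
    ∫⁻ x, ENNReal.ofReal (‖compDispDeriv W W' n x‖ ^ p) ≤ q ^ n * M := by
  have hPc := continuous_torusProj (d := d)
  have hcc := fun k hk => (torusC1_compDisp hW k hk).continuous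
  have hbound : ∀ x, ENNReal.ofReal (‖compDispDeriv W W' n x‖ ^ p) ≤
      ∑ k ∈ Finset.range n, (n : ℝ≥0∞)⁻¹ * ENNReal.ofReal (Real.exp ((n * p) *
        ‖W' k (x + torusProj (compDisp W k x))‖)) := by
    intro x
    have h1 : ‖compDispDeriv W W' n x‖ ^ p ≤ Real.exp (∑ k ∈ Finset.range n,
        p * ‖W' k (x + torusProj (compDisp W k x))‖) := by
      rw [← Finset.mul_sum, mul_comm, Real.exp_mul, Real.rpow_natCast]
      refine pow_le_pow_left₀ (norm_nonneg _) ?_ p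
      have := one_add_norm_compDispDeriv_le (W := W) (W' := W') n x
      linarith
    have h2 := h1.trans (exp_sum_le_average hn _)
    refine (ENNReal.ofReal_le_ofReal h2).trans (le_of_eq ?_)
    rw [ENNReal.ofReal_sum_of_nonneg (fun _ _ => by positivity)]
    refine Finset.sum_congr rfl fun k _ => ?_
    rw [ENNReal.ofReal_mul (by positivity), ENNReal.ofReal_inv_of_pos (by positivity),
      ENNReal.ofReal_natCast, mul_assoc]
  have hmeas : ∀ k < n, Measurable fun y =>
      ENNReal.ofReal (Real.exp ((n * p) * ‖W' k y‖)) := fun k hk => by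
    have := (hW k hk).1
    exact (by fun_prop : Continuous fun y =>
      Real.exp ((n * p) * ‖W' k y‖)).measurable.ennreal_ofReal
  have hmeas2 : ∀ k < n, Measurable fun x => ENNReal.ofReal (Real.exp ((n * p) *
        ‖W' k (x + torusProj (compDisp W k x))‖)) := fun k hk => by
    have := hcc k hk.le
    exact (hmeas k hk).comp
      (by fun_prop : Continuous fun x => x + torusProj (compDisp W k x)).measurable
  calc ∫⁻ x, ENNReal.ofReal (‖compDispDeriv W W' n x‖ ^ p)
      ≤ ∫⁻ x, ∑ k ∈ Finset.range n, (n : ℝ≥0∞)⁻¹ * ENNReal.ofReal (Real.exp ((n * p) *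
        ‖W' k (x + torusProj (compDisp W k x))‖)) := lintegral_mono hbound
    _ = ∑ k ∈ Finset.range n, (n : ℝ≥0∞)⁻¹ * ∫⁻ x, ENNReal.ofReal (Real.exp ((n * p) *
        ‖W' k (x + torusProj (compDisp W k x))‖)) := by
        rw [lintegral_finsetSum' _ fun k hk =>
          ((hmeas2 k (Finset.mem_range.1 hk)).const_mul _).aemeasurable]
        refine Finset.sum_congr rfl fun k hk => ?_
        rw [lintegral_const_mul _ (hmeas2 k (Finset.mem_range.1 hk))]
    _ ≤ ∑ k ∈ Finset.range n, (n : ℝ≥0∞)⁻¹ * (q ^ n * M) := by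
        refine Finset.sum_le_sum fun k hk => ?_
        have hk' := Finset.mem_range.1 hk
        gcongr
        refine (lintegral_comp_compDisp_le (fun k hk => (hW k hk).continuous) hq k hk'.le _
          (hmeas k hk')).trans ?_
        exact mul_le_mul' (pow_le_pow_right₀ hq1 hk'.le) (hM k hk')
    _ = q ^ n * M := by
        rw [Finset.sum_const, Finset.card_range, nsmul_eq_mul, ← mul_assoc,
          ENNReal.mul_inv_cancel (by simp [hn.ne']) (by simp), one_mul]

end Comp

/-! ### Time averages of mollified fields -/

section Average
variable {d : ℕ} {T L : ℝ} {C : ℝ → ℝ} {b : ℝ → UnitAddTorus (Fin d) → Euc d}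
    {D : ℝ → UnitAddTorus (Fin d) → Matrix (Fin d) (Fin d) ℝ}

/-- The time integral of a field. -/
noncomputable def timeInt (b : ℝ → UnitAddTorus (Fin d) → Euc d) (a c : ℝ)
    (y : UnitAddTorus (Fin d)) : Euc d := ∫ s in Ioc a c, b s y

theorem Ioc_subset_Icc_of_mem {a c T : ℝ} (ha : 0 ≤ a) (hc : c ≤ T) : Ioc a c ⊆ Icc 0 T :=
  fun _ hs => ⟨ha.trans hs.1.le, hs.2.trans hc⟩

theorem ExpField.integrable_Ioc (H : ExpField T L C b D) {a c : ℝ} (ha : 0 ≤ a) (hc : c ≤ T) :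
    Integrable (fun z : ℝ × UnitAddTorus (Fin d) => b z.1 z.2)
      ((volume.restrict (Ioc a c)).prod volume) :=
  H.integrable.mono_measure
    (Measure.prod_mono (Measure.restrict_mono (Ioc_subset_Icc_of_mem ha hc) le_rfl) le_rfl)

theorem ExpField.integrable_timeInt (H : ExpField T L C b D) {a c : ℝ} (ha : 0 ≤ a) (hc : c ≤ T) :
    Integrable (timeInt b a c) := (H.integrable_Ioc ha hc).integral_prod_right

theorem ExpField.torusConv_timeInt (H : ExpField T L C b D) {a c : ℝ} (ha : 0 ≤ a) (hc : c ≤ T)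
    (N : ℕ) (x : UnitAddTorus (Fin d)) :
    torusConv (moll N) (timeInt b a c) x = ∫ s in Ioc a c, torusConv (moll N) (b s) x := by
  have hKc := continuous_moll (d := d) N
  obtain ⟨M, -, hM⟩ := exists_norm_bound hKc
  have hi : Integrable (fun z : ℝ × UnitAddTorus (Fin d) => moll N (x - z.2) • b z.1 z.2)
      ((volume.restrict (Ioc a c)).prod volume) :=
    (H.integrable_Ioc ha hc).bdd_smul M
      (by fun_prop : Continuous fun z : ℝ × UnitAddTorus (Fin d) =>
        moll N (x - z.2)).aestronglyMeasurable (Eventually.of_forall fun z => hM _)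
  unfold torusConv timeInt
  rw [integral_integral_swap hi]
  exact integral_congr_ae (Eventually.of_forall fun y => (integral_smul _ _).symm)

theorem ExpField.torusConvDeriv_timeInt (H : ExpField T L C b D) {a c : ℝ} (ha : 0 ≤ a)
    (hc : c ≤ T) (N : ℕ) (x : UnitAddTorus (Fin d)) :
    torusConvDeriv (moll N) (timeInt b a c) x =
      ∫ s in Ioc a c, torusConvDeriv (moll N) (b s) x := by
  have hK'c := (torusSmooth_moll (d := d) N).torusC1.1
  obtain ⟨M, -, hM⟩ := exists_norm_bound hK'c
  have hi0 := H.integrable_Ioc ha hc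
  have hi : Integrable (fun z : ℝ × UnitAddTorus (Fin d) =>
      (torusFDeriv (moll N) (x - z.2)).smulRight (b z.1 z.2))
      ((volume.restrict (Ioc a c)).prod volume) := by
    refine (hi0.norm.const_mul M).mono' ?_ (Eventually.of_forall fun z => ?_)
    · exact (ContinuousLinearMap.smulRightL ℝ (Euc d) (Euc d)).aestronglyMeasurable_comp₂
        (by fun_prop : Continuous fun z : ℝ × UnitAddTorus (Fin d) =>
          torusFDeriv (moll N) (x - z.2)).aestronglyMeasurable hi0.1
    · rw [ContinuousLinearMap.norm_smulRight_apply]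
      exact mul_le_mul_of_nonneg_right (hM _) (norm_nonneg _)
  unfold torusConvDeriv timeInt
  rw [integral_integral_swap hi]
  refine integral_congr_ae ?_
  filter_upwards [hi0.prod_left_ae] with y hy
  exact (((ContinuousLinearMap.smulRightL ℝ (Euc d) (Euc d))
    (torusFDeriv (moll N) (x - y))).integral_comp_comm hy).symm

theorem ExpField.aestronglyMeasurable_torusConvDeriv (H : ExpField T L C b D) {a c : ℝ}
    (ha : 0 ≤ a) (hc : c ≤ T) (N : ℕ) :
    AEStronglyMeasurable (fun z : ℝ × UnitAddTorus (Fin d) => torusConvDeriv (moll N) (b z.1) z.2)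
      ((volume.restrict (Ioc a c)).prod volume) := by
  have hK'c := (torusSmooth_moll (d := d) N).torusC1.1
  have hi0 := (H.integrable_Ioc ha hc).1
  have hq : Measure.QuasiMeasurePreserving
      (Prod.map (Prod.fst : ℝ × UnitAddTorus (Fin d) → ℝ) (id : UnitAddTorus (Fin d) → _))
      (((volume.restrict (Ioc a c)).prod volume).prod volume)
      ((volume.restrict (Ioc a c)).prod volume) :=
    QuasiMeasurePreserving.prodMap Measure.quasiMeasurePreserving_fst
      (Measure.QuasiMeasurePreserving.id _)
  have h1 := hi0.comp_quasiMeasurePreserving hq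
  have h2 : AEStronglyMeasurable (fun z : (ℝ × UnitAddTorus (Fin d)) × UnitAddTorus (Fin d) =>
      (torusFDeriv (moll N) (z.1.2 - z.2)).smulRight (b z.1.1 z.2))
      (((volume.restrict (Ioc a c)).prod volume).prod volume) :=
    (ContinuousLinearMap.smulRightL ℝ (Euc d) (Euc d)).aestronglyMeasurable_comp₂
      (by fun_prop : Continuous fun z : (ℝ × UnitAddTorus (Fin d)) × UnitAddTorus (Fin d) =>
        torusFDeriv (moll N) (z.1.2 - z.2)).aestronglyMeasurable h1
  exact h2.integral_prod_right'

/-- Sup bound on the kernel times an L¹ bound on the gradient, from s ≤ eˢ. The constant depends on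
N but not on time, so for fixed N short Euler steps are close to the identity. -/
theorem ExpField.exists_torusConvDeriv_bound (H : ExpField T L C b D) (N : ℕ) :
    ∃ R, 0 ≤ R ∧ ∀ t ∈ Icc 0 T, ∀ x, ‖torusConvDeriv (moll N) (b t) x‖ ≤ R := by
  have hKc := continuous_moll (d := d) N
  obtain ⟨M, hM0, hM⟩ := exists_norm_bound hKc
  refine ⟨(d : ℝ) ^ 2 * (M * C 1), by have := H.C_nonneg 1; positivity, fun t ht x => ?_⟩
  refine (norm_torusConvDeriv_le (torusSmooth_moll N) (moll_nonneg N) (H.integrable_at ht)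
    (H.grad t ht) x).trans ?_
  have hG := (H.grad t ht).integrable_matrixAbs
  have hGm := hG.1
  have h1 : ∫ y, matrixAbs (D t y) ≤ C 1 := by
    rw [integral_eq_lintegral_of_nonneg_ae (Eventually.of_forall fun y => matrixAbs_nonneg _) hGm]
    refine ENNReal.toReal_le_of_le_ofReal (H.C_nonneg 1) (le_trans (lintegral_mono fun y => ?_)
      (H.exp_le 1 one_pos t ht))
    refine ENNReal.ofReal_le_ofReal ?_
    rw [one_mul]
    linarith [Real.add_one_le_exp (matrixAbs (D t y))]
  gcongr
  calc ∫ y, moll N (x - y) * matrixAbs (D t y) ≤ ∫ y, M * matrixAbs (D t y) := by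
        refine integral_mono (integrable_torusConv_mul hKc hG x) (hG.const_mul M) fun y => ?_
        exact mul_le_mul_of_nonneg_right ((le_abs_self _).trans (hM _)) (matrixAbs_nonneg _)
    _ ≤ M * C 1 := by
        rw [integral_const_mul]
        gcongr

theorem ExpField.integrableOn_torusConvDeriv (H : ExpField T L C b D) {a c : ℝ}
    (ha : 0 ≤ a) (hc : c ≤ T) (N : ℕ) :
    ∀ᵐ x, IntegrableOn (fun s => torusConvDeriv (moll N) (b s) x) (Ioc a c) := by
  obtain ⟨R, -, hR⟩ := H.exists_torusConvDeriv_bound N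
  have h := (H.aestronglyMeasurable_torusConvDeriv ha hc N).prod_swap
  filter_upwards [h.prodMk_left] with x hx
  refine Integrable.of_bound hx R ((ae_restrict_iff' measurableSet_Ioc).2
    (Eventually.of_forall fun s hs => hR s (Ioc_subset_Icc_of_mem ha hc hs) x))

theorem ExpField.norm_torusConvDeriv_timeInt_le (H : ExpField T L C b D) {a c : ℝ} (ha : 0 ≤ a)
    (hac : a ≤ c) (hc : c ≤ T) {N : ℕ} {R : ℝ}
    (hR : ∀ t ∈ Icc 0 T, ∀ x, ‖torusConvDeriv (moll N) (b t) x‖ ≤ R) (x : UnitAddTorus (Fin d)) :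
    ‖torusConvDeriv (moll N) (timeInt b a c) x‖ ≤ (c - a) * R := by
  rw [H.torusConvDeriv_timeInt ha hc]
  have h1 := norm_setIntegral_le_of_norm_le_const (μ := volume) (s := Ioc a c) (by simp)
    fun s hs => hR s (Ioc_subset_Icc_of_mem ha hc hs) x
  simpa [hac, mul_comm] using h1

/-- The trace commutes with the time integral for almost every x, where the derivative is integrable
in time; continuity in x extends the bound to every point. -/
theorem ExpField.abs_eucTrace_timeInt_le (H : ExpField T L C b D) {a c : ℝ} (ha : 0 ≤ a)
    (hac : a ≤ c) (hc : c ≤ T) (N : ℕ) (x : UnitAddTorus (Fin d)) :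
    |eucTrace (torusConvDeriv (moll N) (timeInt b a c) x)| ≤ (c - a) * L := by
  have hae : ∀ᵐ x : UnitAddTorus (Fin d),
      |eucTrace (torusConvDeriv (moll N) (timeInt b a c) x)| ≤ (c - a) * L := by
    obtain ⟨δ', hδ', -⟩ := hasFDerivAt_det_id_add (d := d)
    filter_upwards [H.integrableOn_torusConvDeriv ha hc N] with x hx
    rw [H.torusConvDeriv_timeInt ha hc, ← hδ', ← δ'.integral_comp_comm hx, ← Real.norm_eq_abs]
    have h1 : ∀ᵐ s ∂(volume.restrict (Ioc a c)),
        ‖δ' (torusConvDeriv (moll N) (b s) x)‖ ≤ L := by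
      have h2 := ae_restrict_of_ae_restrict_of_subset (Ioc_subset_Icc_of_mem ha hc) H.div_le
      filter_upwards [h2, ae_restrict_mem measurableSet_Ioc] with s hs hsI
      have hs' := Ioc_subset_Icc_of_mem ha hc hsI
      rw [hδ', Real.norm_eq_abs]
      exact abs_eucTrace_torusConvDeriv_le (H.integrable_at hs') (H.grad s hs') hs x
    have h3 := norm_integral_le_of_norm_le_const h1
    simpa [hac, mul_comm] using h3
  have hcont : Continuous fun x =>
      |eucTrace (torusConvDeriv (moll N) (timeInt b a c) x)| := by
    have h4 := (torusC1_torusConv (torusSmooth_moll N).torusC1 (H.integrable_timeInt ha hc)).1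
    unfold eucTrace
    fun_prop
  have hcl : IsClosed {x : UnitAddTorus (Fin d) |
      |eucTrace (torusConvDeriv (moll N) (timeInt b a c) x)| ≤ (c - a) * L} :=
    isClosed_le hcont continuous_const
  have hdense : Dense {x : UnitAddTorus (Fin d) |
      |eucTrace (torusConvDeriv (moll N) (timeInt b a c) x)| ≤ (c - a) * L} :=
    Measure.dense_of_ae hae
  have := hcl.closure_eq ▸ hdense.closure_eq
  exact (this ▸ mem_univ x : x ∈ {x : UnitAddTorus (Fin d) | _})

/-- Jensen for the normalized measure ds/(c − a) on the time interval, then Tonelli. Division by the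
step length is what allows the large exponents n p of the composition estimate. -/
theorem ExpField.lintegral_exp_timeInt_le (H : ExpField T L C b D) {a c : ℝ} (ha : 0 ≤ a)
    (hac : a < c) (hc : c ≤ T) (N : ℕ) {β : ℝ} (hβ : 0 < β) :
    ∫⁻ x, ENNReal.ofReal (Real.exp (β / (c - a) *
      ‖torusConvDeriv (moll N) (timeInt b a c) x‖)) ≤ ENNReal.ofReal (C (β * (d : ℝ) ^ 2)) := by
  obtain ⟨R, hR0, hR⟩ := H.exists_torusConvDeriv_bound N
  set h := c - a with hh
  have hpos : 0 < h := sub_pos.2 hac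
  set Φ : ℝ → UnitAddTorus (Fin d) → ℝ := fun s x => ‖torusConvDeriv (moll N) (b s) x‖ with hΦ
  have hm := H.aestronglyMeasurable_torusConvDeriv ha hc N
  have hbd : ∀ x, ∀ᵐ s ∂(volume.restrict (Ioc a c)), Φ s x ≤ R := fun x =>
    (ae_restrict_iff' measurableSet_Ioc).2
      (Eventually.of_forall fun s hs => hR s (Ioc_subset_Icc_of_mem ha hc hs) x)
  have h1 : ∀ᵐ x : UnitAddTorus (Fin d), ENNReal.ofReal (Real.exp (β / h *
      ‖torusConvDeriv (moll N) (timeInt b a c) x‖)) ≤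
      ∫⁻ s in Ioc a c, ENNReal.ofReal h⁻¹ * ENNReal.ofReal (Real.exp (β * Φ s x)) := by
    filter_upwards [H.integrableOn_torusConvDeriv ha hc N] with x hx
    have hΦi : Integrable (fun s => Φ s x) (volume.restrict (Ioc a c)) := hx.norm
    have hei : Integrable (fun s => h⁻¹ * Real.exp (β * Φ s x)) (volume.restrict (Ioc a c)) := by
      refine Integrable.const_mul (Integrable.of_bound
        (Real.continuous_exp.comp_aestronglyMeasurable (hΦi.1.const_mul β)) (Real.exp (β * R)) ?_) _
      filter_upwards [hbd x] with s hs
      rw [Real.norm_of_nonneg (Real.exp_pos _).le]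
      exact Real.exp_le_exp.2 (mul_le_mul_of_nonneg_left hs hβ.le)
    have h2 := exp_integral_mul_le (μ := volume.restrict (Ioc a c)) (k := fun _ => h⁻¹)
      (g := fun s => β * Φ s x) (fun _ => by positivity) (integrable_const _)
      (by simp [← hh, hpos.le, hpos.ne']) ((hΦi.const_mul β).const_mul _) hei
    have h3 : β / h * ‖torusConvDeriv (moll N) (timeInt b a c) x‖ ≤
        ∫ s in Ioc a c, h⁻¹ * (β * Φ s x) := by
      rw [integral_const_mul, integral_const_mul, ← mul_assoc, div_eq_inv_mul,
        H.torusConvDeriv_timeInt ha hc]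
      gcongr
      exact norm_integral_le_integral_norm _
    refine (ENNReal.ofReal_le_ofReal ((Real.exp_le_exp.2 h3).trans h2)).trans (le_of_eq ?_)
    rw [ofReal_integral_eq_lintegral_ofReal hei (Eventually.of_forall fun s => by positivity)]
    exact lintegral_congr fun s => ENNReal.ofReal_mul (by positivity)
  have hmeas : AEMeasurable (Function.uncurry fun (x : UnitAddTorus (Fin d)) s =>
      ENNReal.ofReal h⁻¹ * ENNReal.ofReal (Real.exp (β * Φ s x)))
      (volume.prod (volume.restrict (Ioc a c))) := by
    have h4 : AEStronglyMeasurable (fun z : UnitAddTorus (Fin d) × ℝ => Φ z.2 z.1)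
      (volume.prod (volume.restrict (Ioc a c))) := hm.norm.prod_swap
    exact ((Real.continuous_exp.comp_aestronglyMeasurable
      (h4.const_mul β)).aemeasurable.ennreal_ofReal).const_mul _
  calc ∫⁻ x, ENNReal.ofReal (Real.exp (β / h * ‖torusConvDeriv (moll N) (timeInt b a c) x‖))
      ≤ ∫⁻ x, ∫⁻ s in Ioc a c, ENNReal.ofReal h⁻¹ * ENNReal.ofReal (Real.exp (β * Φ s x)) :=
        lintegral_mono_ae h1
    _ = ∫⁻ s in Ioc a c, ∫⁻ x, ENNReal.ofReal h⁻¹ * ENNReal.ofReal (Real.exp (β * Φ s x)) :=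
        lintegral_lintegral_swap hmeas
    _ ≤ ∫⁻ s in Ioc a c, ENNReal.ofReal h⁻¹ * ENNReal.ofReal (C (β * (d : ℝ) ^ 2)) := by
        refine setLIntegral_mono' measurableSet_Ioc fun s hs => ?_
        rw [lintegral_const_mul' _ _ ENNReal.ofReal_ne_top]
        gcongr
        exact H.lintegral_exp_le (Ioc_subset_Icc_of_mem ha hc hs) N hβ
    _ = ENNReal.ofReal (C (β * (d : ℝ) ^ 2)) := by
        rw [setLIntegral_const, Real.volume_Ioc, mul_right_comm, ← hh,
          ← ENNReal.ofReal_mul (by positivity), inv_mul_cancel₀ hpos.ne', ENNReal.ofReal_one,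
          one_mul]

end Average

/-! ### The Euler scheme -/

section Euler
variable {d : ℕ} {T L : ℝ} {C : ℝ → ℝ} {b : ℝ → UnitAddTorus (Fin d) → Euc d}
    {D : ℝ → UnitAddTorus (Fin d) → Matrix (Fin d) (Fin d) ℝ}

/-- The displacement of the `k`-th step of the Euler scheme with time step `h`. -/
noncomputable def eulerStep (b : ℝ → UnitAddTorus (Fin d) → Euc d) (N : ℕ) (h : ℝ) (k : ℕ) :
    UnitAddTorus (Fin d) → Euc d :=
  torusConv (moll N) (timeInt b ((k : ℝ) * h) (((k + 1 : ℕ) : ℝ) * h))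

/-- The derivative of `eulerStep`. -/
noncomputable def eulerStepDeriv (b : ℝ → UnitAddTorus (Fin d) → Euc d) (N : ℕ) (h : ℝ) (k : ℕ) :
    UnitAddTorus (Fin d) → Euc d →L[ℝ] Euc d :=
  torusConvDeriv (moll N) (timeInt b ((k : ℝ) * h) (((k + 1 : ℕ) : ℝ) * h))

/-- The piecewise constant curve through the nodes of the Euler scheme. -/
noncomputable def eulerNode (b : ℝ → UnitAddTorus (Fin d) → Euc d) (N : ℕ) (h : ℝ)
    (x : UnitAddTorus (Fin d)) (s : ℝ) : Euc d :=
  compDisp (eulerStep b N h) (⌈s / h⌉₊ - 1) x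

/-- The Euler polygon. -/
noncomputable def eulerCurve (b : ℝ → UnitAddTorus (Fin d) → Euc d) (N : ℕ) (h : ℝ)
    (x : UnitAddTorus (Fin d)) (t : ℝ) : Euc d :=
  ∫ s in (0 : ℝ)..t, torusConv (moll N) (b s) (x + torusProj (eulerNode b N h x s))

theorem measurable_eulerNode (b : ℝ → UnitAddTorus (Fin d) → Euc d) (N : ℕ) (h : ℝ)
    (x : UnitAddTorus (Fin d)) : Measurable (eulerNode b N h x) := by
  have h1 : Measurable fun k : ℕ => compDisp (eulerStep b N h) (k - 1) x := measurable_from_top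
  exact h1.comp (Nat.measurable_ceil.comp (measurable_id.div_const h))

theorem ExpField.integrableOn_euler (H : ExpField T L C b D) (N : ℕ) (h : ℝ)
    (x : UnitAddTorus (Fin d)) :
    IntegrableOn (fun s => torusConv (moll N) (b s) (x + torusProj (eulerNode b N h x s)))
      (Icc 0 T) :=
  H.integrableOn_torusConv N x (measurable_eulerNode b N h x).aestronglyMeasurable

/-- On each step the spatial argument is frozen at the node, and mollification commutes with time
integration, so the increment is exactly `eulerStep`. -/
theorem ExpField.eulerCurve_node (H : ExpField T L C b D) {h : ℝ} (hh : 0 < h) (N : ℕ)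
    (x : UnitAddTorus (Fin d)) (k : ℕ) (hk : k * h ≤ T) :
    eulerCurve b N h x (k * h) = compDisp (eulerStep b N h) k x := by
  induction k with
  | zero => simp [eulerCurve, compDisp]
  | succ k ih =>
    have hkk : (k : ℝ) * h ≤ ((k + 1 : ℕ) : ℝ) * h := by
      gcongr; simp
    have hk0 : (0 : ℝ) ≤ k * h := by positivity
    have h0 : (0 : ℝ) ∈ Icc 0 T := ⟨le_rfl, hk0.trans (hkk.trans hk)⟩
    have h1 : (k : ℝ) * h ∈ Icc 0 T := ⟨hk0, hkk.trans hk⟩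
    have h2 : ((k + 1 : ℕ) : ℝ) * h ∈ Icc 0 T := ⟨hk0.trans hkk, hk⟩
    have hi := H.integrableOn_euler N h x
    have h3 := intervalIntegral.integral_add_adjacent_intervals
      (intervalIntegrable_of_Icc hi h0 h1) (intervalIntegrable_of_Icc hi h1 h2)
    have h4 := ih h1.2
    unfold eulerCurve at h4 ⊢
    rw [← h3, h4, intervalIntegral.integral_of_le hkk]
    simp only [compDisp]
    congr 1
    rw [eulerStep, H.torusConv_timeInt hk0 hk]
    refine setIntegral_congr_fun measurableSet_Ioc fun s hs => ?_
    -- On the half-open step (kh, (k+1)h] the ceiling is k + 1, so the frozen node is the left one.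
    have h5 : ⌈s / h⌉₊ = k + 1 := by
      rw [Nat.ceil_eq_iff (by omega), lt_div_iff₀ hh, div_le_iff₀ hh]
      exact ⟨by simpa using hs.1, hs.2⟩
    simp only [eulerNode, h5, Nat.add_sub_cancel]

theorem ExpField.continuousOn_eulerCurve (H : ExpField T L C b D) (hT : 0 ≤ T) (N : ℕ) (h : ℝ)
    (x : UnitAddTorus (Fin d)) : ContinuousOn (eulerCurve b N h x) (Icc 0 T) := by
  have := intervalIntegral.continuousOn_primitive_interval' (a := 0)
    (intervalIntegrable_of_Icc (H.integrableOn_euler N h x) ⟨le_rfl, hT⟩ ⟨hT, le_rfl⟩) (by simp)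
  rwa [uIcc_of_le hT] at this

/-- On short time steps the Euler polygon is close to its nodes. -/
theorem ExpField.eulerCurve_sub_node_le (H : ExpField T L C b D) (hT : 0 ≤ T) (N : ℕ) {η : ℝ}
    (hη : 0 < η) : ∃ δ > 0, ∀ h, 0 < h → h ≤ δ → ∀ x, ∀ s ∈ Icc 0 T,
      ‖eulerNode b N h x s - eulerCurve b N h x s‖ ≤ η := by
  obtain ⟨M, hM0, hM⟩ := exists_norm_bound (continuous_moll (d := d) N)
  -- For fixed N the mollified field is bounded in space by this function, integrable in time;
  -- uniform continuity of its primitive gives a δ independent of x.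
  set m : ℝ → ℝ := fun s => M * ∫ y, ‖b s y‖ with hm
  have hmi : IntegrableOn m (Icc 0 T) := H.integrableOn_integral_norm.const_mul M
  have h0T : (0 : ℝ) ∈ Icc 0 T := ⟨le_rfl, hT⟩
  have hP : ContinuousOn (fun t => ∫ s in (0 : ℝ)..t, m s) (Icc 0 T) := by
    have := intervalIntegral.continuousOn_primitive_interval' (a := 0)
      (intervalIntegrable_of_Icc hmi h0T ⟨hT, le_rfl⟩) (by simp)
    rwa [uIcc_of_le hT] at this
  have hU := isCompact_Icc.uniformContinuousOn_of_continuous hP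
  rw [Metric.uniformContinuousOn_iff] at hU
  obtain ⟨δ, hδ, hU⟩ := hU η hη
  refine ⟨δ / 2, half_pos hδ, fun h hh hhδ x s hs => ?_⟩
  set k := ⌈s / h⌉₊ - 1 with hk
  have hks : (k : ℝ) * h ≤ s ∧ s ≤ (k : ℝ) * h + h := by
    -- At s = 0 the ceiling is 0, and truncated subtraction still selects the node of index 0.
    rcases Nat.eq_zero_or_pos ⌈s / h⌉₊ with hz | hz
    · have hs0 : s = 0 := by
        have := Nat.ceil_eq_zero.1 hz
        rw [div_le_iff₀ hh] at this
        linarith [hs.1]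
      simp [hk, hs0, hh.le]
    · have h1 : (⌈s / h⌉₊ : ℝ) = k + 1 := by
        rw [hk, Nat.cast_sub (by omega)]; simp
      have h2 := Nat.le_ceil (s / h)
      have h3 := Nat.ceil_lt_add_one (div_nonneg hs.1 hh.le)
      rw [h1] at h2 h3
      rw [div_le_iff₀ hh] at h2
      have h4 : (k : ℝ) < s / h := by linarith
      rw [lt_div_iff₀ hh] at h4
      exact ⟨h4.le, by linarith⟩
  have hkI : (k : ℝ) * h ∈ Icc 0 T := ⟨by positivity, hks.1.trans hs.2⟩
  have hi := H.integrableOn_euler N h x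
  have h1 : eulerNode b N h x s = eulerCurve b N h x (k * h) :=
    (H.eulerCurve_node hh N x k hkI.2).symm
  have h2 : eulerCurve b N h x s - eulerCurve b N h x (k * h) =
      ∫ r in (k * h)..s, torusConv (moll N) (b r) (x + torusProj (eulerNode b N h x r)) :=
    intervalIntegral.integral_interval_sub_left (intervalIntegrable_of_Icc hi h0T hs)
      (intervalIntegrable_of_Icc hi h0T hkI)
  have h3 : (∫ r in (0 : ℝ)..s, m r) - ∫ r in (0 : ℝ)..(k * h), m r = ∫ r in (k * h)..s, m r :=
    intervalIntegral.integral_interval_sub_left (intervalIntegrable_of_Icc hmi h0T hs)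
      (intervalIntegrable_of_Icc hmi h0T hkI)
  rw [h1, norm_sub_rev, h2]
  have h4 := hU s hs (k * h) hkI (by
    rw [Real.dist_eq, abs_of_nonneg (by linarith [hks.1])]; linarith [hks.2])
  rw [Real.dist_eq, h3] at h4
  refine le_trans ?_ ((le_abs_self _).trans h4.le)
  refine intervalIntegral.norm_integral_le_of_norm_le hks.1 (Eventually.of_forall fun r hr => ?_)
    (intervalIntegrable_of_Icc hmi hkI hs)
  have hrI : r ∈ Icc 0 T := ⟨hkI.1.trans hr.1.le, hr.2.trans hs.2⟩
  exact norm_torusConv_le hM (H.integrable_at hrI) _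

theorem ExpField.isApproxSol_eulerCurve (H : ExpField T L C b D) (hT : 0 ≤ T) {e : ℝ}
    (he : 0 < e) : ∃ N, ∃ δ > 0, ∀ h, 0 < h → h ≤ δ → ∀ x,
      IsApproxSol T (fun s => contRep (b s)) e x (eulerCurve b N h x) := by
  obtain ⟨B, A₀, hB, hA₀, hmod⟩ := H.exists_mollModulus one_pos
  -- The error e is split in three: the remainder of the modulus, the mollification error, and the
  -- distance between polygon and nodes times the slope A. N is fixed before δ.
  obtain ⟨A, hA, hAε⟩ := exists_large_exp_le one_pos (T * B) A₀ (show 0 < e / 3 by positivity)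
  have hA0 := hA₀.trans hA
  obtain ⟨N, hN⟩ := H.exists_norm_sub_contRep_le (show 0 < e / (3 * (T + 1)) by positivity)
  obtain ⟨δ, hδ, hclose⟩ := H.eulerCurve_sub_node_le hT N
    (show 0 < e / (3 * (T * A + 1)) by positivity)
  refine ⟨N, δ, hδ, fun h hh hhδ x => ⟨H.continuousOn_eulerCurve hT N h x, fun t ht => ?_⟩⟩
  have h0T : (0 : ℝ) ∈ Icc 0 T := ⟨le_rfl, hT⟩
  set w := eulerCurve b N h x with hw
  have hi₁ := H.integrableOn_euler N h x
  have hi₂ := H.integrableOn_contRep x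
    ((H.continuousOn_eulerCurve hT N h x).aestronglyMeasurable measurableSet_Icc)
  have h1 : w t - ∫ s in (0 : ℝ)..t, contRep (b s) (x + torusProj (w s)) =
      ∫ s in (0 : ℝ)..t, (torusConv (moll N) (b s) (x + torusProj (eulerNode b N h x s)) -
        contRep (b s) (x + torusProj (w s))) := by
    rw [intervalIntegral.integral_sub (intervalIntegrable_of_Icc hi₁ h0T ht)
      (intervalIntegrable_of_Icc hi₂ h0T ht)]
    rfl
  simp only
  rw [h1]
  have h2 : ‖∫ s in (0 : ℝ)..t, (torusConv (moll N) (b s) (x + torusProj (eulerNode b N h x s)) -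
        contRep (b s) (x + torusProj (w s)))‖ ≤ (e / (3 * (T + 1)) +
        (A * (e / (3 * (T * A + 1))) + B * Real.exp (-(1 * A)))) * |t - 0| := by
    refine intervalIntegral.norm_integral_le_of_norm_le_const fun s hs => ?_
    rw [uIoc_of_le ht.1] at hs
    have hsI : s ∈ Icc 0 T := ⟨hs.1.le, hs.2.trans ht.2⟩
    have h4 := (hmod s hsI).hasModulus_contRep (H.integrable_at hsI) one_pos hA₀ hA
      (x + torusProj (w s)) (eulerNode b N h x s - w s)
    rw [add_assoc, ← torusProj_add, add_sub_cancel] at h4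
    have h5 := hN N le_rfl s hsI (x + torusProj (eulerNode b N h x s))
    have h6 := norm_sub_le_norm_sub_add_norm_sub
      (torusConv (moll N) (b s) (x + torusProj (eulerNode b N h x s)))
      (contRep (b s) (x + torusProj (eulerNode b N h x s))) (contRep (b s) (x + torusProj (w s)))
    have h7 : A * ‖eulerNode b N h x s - w s‖ ≤ A * (e / (3 * (T * A + 1))) := by
      gcongr
      exact hclose h hh hhδ x s hsI
    linarith
  refine h2.trans ?_
  rw [sub_zero, abs_of_nonneg ht.1]
  have hTA : 0 ≤ T * A := by positivity
  calc _ ≤ (e / (3 * (T + 1)) + (A * (e / (3 * (T * A + 1))) + B * Real.exp (-(1 * A)))) * T := by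
        gcongr; exact ht.2
    _ = e / 3 * (T / (T + 1)) + e / 3 * (T * A / (T * A + 1)) + T * B * Real.exp (-(1 * A)) := by
        field_simp
        ring
    _ ≤ e / 3 * 1 + e / 3 * 1 + e / 3 := by
        gcongr
        · rw [div_le_one (by positivity)]; linarith
        · rw [div_le_one (by positivity)]; linarith
    _ = e := by ring

/-- The compression factor of one step is at most e^{2h(|L|+1)}, so n steps give e^{2T(|L|+1)},
independent of both n and N. Only the threshold n₀ depends on N. -/
theorem ExpField.eulerStep_bounds (H : ExpField T L C b D) (hT : 0 < T) (N : ℕ) :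
    ∃ n₀ : ℕ, ∀ n ≥ n₀, 0 < n →
      (∀ k < n, TorusC1 (eulerStep b N (T / n) k) (eulerStepDeriv b N (T / n) k)) ∧
      ∀ p : ℕ, 1 ≤ p → ∫⁻ x, ENNReal.ofReal (‖compDispDeriv (eulerStep b N (T / n))
        (eulerStepDeriv b N (T / n)) n x‖ ^ p) ≤ ENNReal.ofReal (Real.exp (2 * T * (|L| + 1))) *
          ENNReal.ofReal (C (p * T * (d : ℝ) ^ 2)) := by
  obtain ⟨R, hR0, hR⟩ := H.exists_torusConvDeriv_bound N
  -- With ‖A‖ ≤ hR, this ε makes the error of the determinant expansion at most h, the extra 1 in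
  -- |L| + 1.
  obtain ⟨δ, hδ, hdet⟩ := exists_det_lower_bound (d := d) (show 0 < 1 / (R + 1) by positivity)
  have hlim : ∀ c : ℝ, Tendsto (fun n : ℕ => T / n * c) atTop (𝓝 0) := fun c => by
    simpa using (tendsto_const_div_atTop_nhds_zero_nat T).mul_const c
  obtain ⟨n₀, hn₀⟩ := eventually_atTop.1 ((((hlim R).eventually (ge_mem_nhds hδ)).and
    ((hlim R).eventually (ge_mem_nhds (show (0 : ℝ) < 1 / 2 by norm_num)))).and
    ((hlim (|L| + 1)).eventually (ge_mem_nhds (show (0 : ℝ) < 1 / 2 by norm_num))))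
  refine ⟨n₀, fun n hn hn0 => ?_⟩
  obtain ⟨⟨hhδ, hh2⟩, hhL⟩ := hn₀ n hn
  have hn0' : (0 : ℝ) < n := by exact_mod_cast hn0
  set h := T / n with hh
  have hpos : 0 < h := by positivity
  have hnh : n * h = T := by rw [hh]; field_simp
  have hk0 : ∀ k : ℕ, (0 : ℝ) ≤ k * h := fun k => by positivity
  have hkT : ∀ k < n, ((k + 1 : ℕ) : ℝ) * h ≤ T := fun k hk => by
    rw [← hnh]
    gcongr
    exact_mod_cast hk
  have hkk : ∀ k : ℕ, (k : ℝ) * h < ((k + 1 : ℕ) : ℝ) * h := fun k => by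
    push_cast; linarith
  have hdiff : ∀ k : ℕ, ((k + 1 : ℕ) : ℝ) * h - k * h = h := fun k => by push_cast; ring
  have hC1 : ∀ k < n, TorusC1 (eulerStep b N h k) (eulerStepDeriv b N h k) := fun k hk =>
    torusC1_torusConv (torusSmooth_moll N).torusC1 (H.integrable_timeInt (hk0 k) (hkT k hk))
  have hnorm : ∀ k < n, ∀ x, ‖eulerStepDeriv b N h k x‖ ≤ h * R := fun k hk x => by
    have := H.norm_torusConvDeriv_timeInt_le (hk0 k) (hkk k).le (hkT k hk) hR x
    rwa [hdiff] at this
  have htr : ∀ k < n, ∀ x, |eucTrace (eulerStepDeriv b N h k x)| ≤ h * L := fun k hk x => by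
    have := H.abs_eucTrace_timeInt_le (hk0 k) (hkk k).le (hkT k hk) N x
    rwa [hdiff] at this
  set c := 1 - h * (|L| + 1) with hc
  have hc0 : 0 < c := by linarith
  have hcdet : ∀ k < n, ∀ x,
      c ≤ (ContinuousLinearMap.id ℝ (Euc d) + eulerStepDeriv b N h k x).det := by
    intro k hk x
    have h1 := hdet _ ((hnorm k hk x).trans hhδ)
    have h2 := (abs_le.1 (htr k hk x)).1
    have h3 : 1 / (R + 1) * ‖eulerStepDeriv b N h k x‖ ≤ h := by
      calc 1 / (R + 1) * ‖eulerStepDeriv b N h k x‖ ≤ 1 / (R + 1) * (h * (R + 1)) := by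
            gcongr
            exact (hnorm k hk x).trans (by gcongr; linarith)
        _ = h := by field_simp
    have h4 : h * L ≤ h * |L| := mul_le_mul_of_nonneg_left (le_abs_self L) hpos.le
    rw [hc]
    linarith
  have hcomp : ∀ k < n, ∀ g : UnitAddTorus (Fin d) → ℝ≥0∞, Measurable g →
      ∫⁻ x, g (x + torusProj (eulerStep b N h k x)) ≤
        ENNReal.ofReal (Real.exp (2 * h * (|L| + 1))) * ∫⁻ x, g x := by
    intro k hk g hg
    refine (lintegral_comp_add_torusProj_le (hC1 k hk) (by linarith : h * R < 1) (hnorm k hk) hc0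
      (hcdet k hk) hg).trans ?_
    gcongr
    have h5 := Real.add_one_le_exp (2 * h * (|L| + 1))
    refine le_trans ?_ h5
    -- For s = h(|L|+1) ≤ 1/2 one has (1 − s)⁻¹ ≤ 1 + 2s ≤ e^{2s}.
    rw [inv_le_iff_one_le_mul₀ hc0, hc]
    have h6 : 0 ≤ h * (|L| + 1) := by positivity
    nlinarith
  refine ⟨hC1, fun p hp => ?_⟩
  have hp0 : (0 : ℝ) < p := by exact_mod_cast hp
  have key := lintegral_compDispDeriv_pow_le hn0 hC1
    (q := ENNReal.ofReal (Real.exp (2 * h * (|L| + 1))))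
    (ENNReal.one_le_ofReal.2 (Real.one_le_exp (by positivity))) hcomp (p := p)
    (M := ENNReal.ofReal (C (p * T * (d : ℝ) ^ 2))) (fun k hk => ?_)
  · refine key.trans (le_of_eq ?_)
    rw [← ENNReal.ofReal_pow (Real.exp_pos _).le, ← Real.exp_nat_mul]
    congr 3
    rw [← hnh]; ring
  · have h7 := H.lintegral_exp_timeInt_le (hk0 k) (hkk k) (hkT k hk) N
      (show 0 < (p : ℝ) * T by positivity)
    rw [hdiff] at h7
    -- The exponent n p required by the composition estimate is that of the time average with β =
    -- pT.
    have h8 : (p : ℝ) * T / h = n * p := by rw [← hnh]; field_simp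
    rw [h8] at h7
    exact h7

/-- Existence of the flow, together with smooth approximations of its time-`T` map whose
derivatives are bounded in every `Lᵖ`. -/
theorem ExpField.exists_flow (H : ExpField T L C b D) (hT : 0 < T) :
    ∃ v : UnitAddTorus (Fin d) → ℝ → Euc d,
      (∀ x, IsApproxSol T (fun s => contRep (b s)) 0 x (v x)) ∧
      ∃ (u : ℕ → UnitAddTorus (Fin d) → Euc d)
        (u' : ℕ → UnitAddTorus (Fin d) → Euc d →L[ℝ] Euc d),
        (∀ j, TorusC1 (u j) (u' j)) ∧
        (∀ p : ℕ, 1 ≤ p → ∃ M : ℝ≥0∞, M ≠ ⊤ ∧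
          ∀ j, ∫⁻ x, ENNReal.ofReal (‖u' j x‖ ^ p) ≤ M) ∧
        ∀ ε > 0, ∀ᶠ j in atTop, ∀ x, ‖u j x - v x T‖ ≤ ε := by
  have hex : ∀ j : ℕ, ∃ N n : ℕ, 0 < n ∧
      (∀ x, IsApproxSol T (fun s => contRep (b s)) (1 / ((j : ℝ) + 1)) x
        (eulerCurve b N (T / n) x)) ∧
      (∀ k < n, TorusC1 (eulerStep b N (T / n) k) (eulerStepDeriv b N (T / n) k)) ∧
      ∀ p : ℕ, 1 ≤ p → ∫⁻ x, ENNReal.ofReal (‖compDispDeriv (eulerStep b N (T / n))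
        (eulerStepDeriv b N (T / n)) n x‖ ^ p) ≤ ENNReal.ofReal (Real.exp (2 * T * (|L| + 1))) *
          ENNReal.ofReal (C (p * T * (d : ℝ) ^ 2)) := by
    intro j
    obtain ⟨N, δ, hδ, h1⟩ := H.isApproxSol_eulerCurve hT.le
      (show (0 : ℝ) < 1 / ((j : ℝ) + 1) by positivity)
    -- The number of steps is chosen after N, since the gradient bound of the mollified field
    -- depends on N.
    obtain ⟨n₀, h2⟩ := H.eulerStep_bounds hT N
    obtain ⟨n, ⟨hn1, hn2⟩, hn3⟩ := ((((tendsto_const_div_atTop_nhds_zero_nat T).eventually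
      (ge_mem_nhds hδ)).and (eventually_ge_atTop n₀)).and (eventually_gt_atTop 0)).exists
    have hn3' : (0 : ℝ) < n := by exact_mod_cast hn3
    exact ⟨N, n, hn3, h1 _ (by positivity) hn1, h2 n hn2 hn3⟩
  choose N n hn0 happ hC1 hbd using hex
  obtain ⟨v, hv, hlim⟩ := H.exists_limit hT.le (fun j x => eulerCurve b (N j) (T / n j) x) (by
    intro e he
    have h1 := tendsto_one_div_add_atTop_nhds_zero_nat (𝕜 := ℝ)
    filter_upwards [h1.eventually (ge_mem_nhds he)] with j hj x
    exact (happ j x).mono hj)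
  refine ⟨v, hv, fun j => compDisp (eulerStep b (N j) (T / n j)) (n j),
    fun j => compDispDeriv (eulerStep b (N j) (T / n j)) (eulerStepDeriv b (N j) (T / n j)) (n j),
    fun j => torusC1_compDisp (hC1 j) _ le_rfl, fun p hp => ⟨_, ?_, fun j => hbd j p hp⟩, ?_⟩
  · exact ENNReal.mul_ne_top ENNReal.ofReal_ne_top ENNReal.ofReal_ne_top
  · intro ε hε
    filter_upwards [hlim ε hε] with j hj x
    have hn' : (0 : ℝ) < n j := by exact_mod_cast hn0 j
    have h1 : (n j : ℝ) * (T / n j) = T := by field_simp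
    have h2 := H.eulerCurve_node (show 0 < T / n j by positivity) (N j) x (n j) h1.le
    rw [h1] at h2
    rw [← h2]
    exact hj x T ⟨hT.le, le_rfl⟩

end Euler

/-! ### Weak limits of bounded sequences in Sobolev spaces -/

section WeakLimit

/-- Bounded sequences in `L²` converge weakly along the hyperfilter. -/
theorem exists_weak_limit {α : Type*} [MeasurableSpace α] {μ : Measure α} {g : ℕ → α → ℝ}
    (hg : ∀ j, MemLp (g j) 2 μ) {M : ℝ} (hM : ∀ j, ∫ x, g j x ^ 2 ∂μ ≤ M) :
    ∃ G : α → ℝ, MemLp G 2 μ ∧ ∀ φ : α → ℝ, MemLp φ 2 μ →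
      Tendsto (fun j => ∫ x, g j x * φ x ∂μ) (hyperfilter ℕ : Filter ℕ) (𝓝 (∫ x, G x * φ x ∂μ)) := by
  set J : Lp ℝ 2 μ → StrongDual ℝ (Lp ℝ 2 μ) :=
    fun f => InnerProductSpace.toDual ℝ (Lp ℝ 2 μ) f with hJ
  have hin : ∀ (f φ : α → ℝ) (hf : MemLp f 2 μ) (hφ : MemLp φ 2 μ),
      J (hf.toLp f) (hφ.toLp φ) = ∫ x, f x * φ x ∂μ := by
    intro f φ hf hφ
    simp only [hJ]
    rw [InnerProductSpace.toDual_apply_apply, L2.inner_def]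
    refine integral_congr_ae ?_
    filter_upwards [hf.coeFn_toLp, hφ.coeFn_toLp] with x hx hy
    rw [hx, hy]
    simp [mul_comm]
  have hnorm : ∀ j, ‖J ((hg j).toLp (g j))‖ ≤ Real.sqrt M := by
    intro j
    simp only [hJ]
    rw [LinearIsometryEquiv.norm_map]
    refine Real.le_sqrt_of_sq_le ?_
    rw [← real_inner_self_eq_norm_sq, ← InnerProductSpace.toDual_apply_apply (𝕜 := ℝ)]
    change J ((hg j).toLp (g j)) ((hg j).toLp (g j)) ≤ M
    rw [hin]
    simpa [pow_two] using hM j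
  -- Banach–Alaoglu. Limits along a fixed ultrafilter replace subsequences, so all matrix entries
  -- later converge along the same filter.
  have hcpt := WeakDual.isCompact_closedBall (𝕜 := ℝ) (E := Lp ℝ 2 μ) 0 (Real.sqrt M)
  obtain ⟨ℓ, -, hℓ⟩ := hcpt.ultrafilter_le_nhds
    ((hyperfilter ℕ).map fun j => StrongDual.toWeakDual (J ((hg j).toLp (g j)))) (by
      rw [le_principal_iff]
      refine Ultrafilter.mem_map.2 (univ_mem' fun j => ?_)
      change _ ∈ Metric.closedBall _ _
      rw [mem_closedBall_zero_iff]
      exact hnorm j)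
  set G : Lp ℝ 2 μ := (InnerProductSpace.toDual ℝ (Lp ℝ 2 μ)).symm (WeakDual.toStrongDual ℓ) with hG
  refine ⟨G, Lp.memLp G, fun φ hφ => ?_⟩
  have h1 : Tendsto (fun j => (StrongDual.toWeakDual (J ((hg j).toLp (g j)))) (hφ.toLp φ))
      (hyperfilter ℕ : Filter ℕ) (𝓝 (ℓ (hφ.toLp φ))) :=
    ((WeakDual.eval_continuous (hφ.toLp φ)).tendsto ℓ).comp hℓ
  have h2 : ℓ (hφ.toLp φ) = ∫ x, G x * φ x ∂μ := by
    have h3 : J G = WeakDual.toStrongDual ℓ := by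
      simp only [hJ, hG]
      rw [LinearIsometryEquiv.apply_symm_apply]
    have h4 := hin G φ (Lp.memLp G) hφ
    rw [Lp.toLp_coeFn, h3] at h4
    exact h4
  rw [← h2]
  refine h1.congr fun j => ?_
  exact hin (g j) φ (hg j) hφ

/-- Young's inequality with the factor 1/2 on the power of c, so that this term can be absorbed on
the left. -/
theorem mul_pow_le_half_add (n : ℕ) {a c : ℝ} (ha : 0 ≤ a) (hc : 0 ≤ c) :
    a * c ^ n ≤ c ^ (n + 1) / 2 + 2 ^ n * a ^ (n + 1) := by
  rcases le_total a (c / 2) with h | h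
  · have h1 : a * c ^ n ≤ c / 2 * c ^ n := by gcongr
    have h2 : c / 2 * c ^ n = c ^ (n + 1) / 2 := by ring
    have h3 : 0 ≤ 2 ^ n * a ^ (n + 1) := by positivity
    linarith
  · have h1 : a * c ^ n ≤ a * (2 * a) ^ n := by gcongr; linarith
    have h2 : a * (2 * a) ^ n = 2 ^ n * a ^ (n + 1) := by rw [mul_pow]; ring
    have h3 : 0 ≤ c ^ (n + 1) / 2 := by positivity
    linarith

/-- Test with sign(G)|G|ⁿ truncated to |G| ≤ k. Young bounds the truncated integral of |G|^{n+1} by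
half of itself plus 2ⁿM; it is finite by truncation, so it can be absorbed. Then k → ∞ by monotone
convergence. -/
theorem memLp_of_weak_limit {α : Type*} [MeasurableSpace α] {μ : Measure α} [IsFiniteMeasure μ]
    {g : ℕ → α → ℝ} {G : α → ℝ} (hG : MemLp G 2 μ) {𝒰 : Filter ℕ} [𝒰.NeBot]
    (hlim : ∀ φ : α → ℝ, MemLp φ 2 μ →
      Tendsto (fun j => ∫ x, g j x * φ x ∂μ) 𝒰 (𝓝 (∫ x, G x * φ x ∂μ)))
    {n : ℕ} {M : ℝ} (hg : ∀ j, Integrable (fun x => |g j x| ^ (n + 1)) μ)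
    (hg2 : ∀ j, MemLp (g j) 2 μ)
    (hM : ∀ j, ∫ x, |g j x| ^ (n + 1) ∂μ ≤ M) : MemLp G (n + 1 : ℕ) μ := by
  obtain ⟨G', hG'm, hGG'⟩ := hG.1
  have hG'meas : Measurable G' := hG'm.measurable
  set S : ℕ → Set α := fun k => {x | |G' x| ≤ k} with hS
  have hSm : ∀ k, MeasurableSet (S k) := fun k =>
    measurableSet_le hG'meas.abs measurable_const
  set φ : ℕ → α → ℝ := fun k => (S k).indicator fun x => SignType.sign (G' x) * |G' x| ^ n with hφ
  have hsignm : Measurable fun x => ((SignType.sign (G' x) : SignType) : ℝ) := by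
    have : Measurable fun r : ℝ => ((SignType.sign r : SignType) : ℝ) := by
      have h1 : (fun r : ℝ => ((SignType.sign r : SignType) : ℝ)) =
          fun r => if 0 < r then 1 else if r < 0 then -1 else 0 := by
        ext r
        rw [sign_apply]
        split_ifs <;> simp
      rw [h1]
      exact Measurable.ite measurableSet_Ioi measurable_const
        (Measurable.ite measurableSet_Iio measurable_const measurable_const)
    exact this.comp hG'meas
  have hφm : ∀ k, Measurable (φ k) := fun k =>
    (hsignm.mul (hG'meas.abs.pow_const n)).indicator (hSm k)
  have hsign : ∀ r : ℝ, |((SignType.sign r : SignType) : ℝ)| ≤ 1 := by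
    intro r
    rw [sign_apply]
    split_ifs <;> simp
  have hφabs : ∀ k x, |φ k x| ≤ (S k).indicator (fun x => |G' x| ^ n) x := by
    intro k x
    by_cases hx : x ∈ S k
    · simp only [hφ, indicator_of_mem hx, abs_mul, abs_pow, abs_abs]
      exact mul_le_of_le_one_left (by positivity) (hsign _)
    · simp [hφ, hx]
  have hφ2 : ∀ k, MemLp (φ k) 2 μ := fun k =>
    MemLp.of_bound (hφm k).aestronglyMeasurable ((k : ℝ) ^ n) (Eventually.of_forall fun x => by
      refine (hφabs k x).trans ?_
      by_cases hx : x ∈ S k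
      · rw [indicator_of_mem hx]
        exact pow_le_pow_left₀ (abs_nonneg _) hx n
      · rw [indicator_of_notMem hx]; positivity)
  have hIint : ∀ k, Integrable ((S k).indicator fun x => |G' x| ^ (n + 1)) μ := fun k => by
    refine Integrable.of_bound ((hG'meas.abs.pow_const _).indicator
      (hSm k)).aestronglyMeasurable ((k : ℝ) ^ (n + 1)) (Eventually.of_forall fun x => ?_)
    by_cases hx : x ∈ S k
    · rw [indicator_of_mem hx, Real.norm_of_nonneg (by positivity)]
      exact pow_le_pow_left₀ (abs_nonneg _) hx _
    · rw [indicator_of_notMem hx, norm_zero]; positivity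
  have hI : ∀ k, ∫ x, (S k).indicator (fun x => |G' x| ^ (n + 1)) x ∂μ ≤ 2 ^ (n + 1) * M := by
    intro k
    set I := ∫ x, (S k).indicator (fun x => |G' x| ^ (n + 1)) x ∂μ with hIdef
    have h1 : ∫ x, G x * φ k x ∂μ = I := by
      refine integral_congr_ae ?_
      filter_upwards [hGG'] with x hx
      by_cases hxS : x ∈ S k
      · simp only [hφ, indicator_of_mem hxS, hx]
        rw [← mul_assoc, mul_comm (G' x), sign_mul_self, pow_succ, mul_comm]
      · simp [hφ, hxS]
    have h2 := hlim (φ k) (hφ2 k)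
    rw [h1] at h2
    have h3 : ∀ j, ∫ x, g j x * φ k x ∂μ ≤ I / 2 + 2 ^ n * M := by
      intro j
      have h4 : ∫ x, g j x * φ k x ∂μ ≤ ∫ x, ((S k).indicator (fun x => |G' x| ^ (n + 1)) x / 2 +
          2 ^ n * |g j x| ^ (n + 1)) ∂μ := by
        refine integral_mono ((hg2 j).integrable_mul (hφ2 k))
          (((hIint k).div_const 2).add ((hg j).const_mul _)) fun x => ?_
        simp only
        have h5 : g j x * φ k x ≤ |g j x| * |φ k x| := by
          rw [← abs_mul]; exact le_abs_self _
        refine h5.trans ?_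
        by_cases hx : x ∈ S k
        · have h6 := hφabs k x
          rw [indicator_of_mem hx] at h6 ⊢
          exact (mul_le_mul_of_nonneg_left h6 (abs_nonneg _)).trans
            (mul_pow_le_half_add n (abs_nonneg _) (abs_nonneg _))
        · have h6 : φ k x = 0 := by simp [hφ, hx]
          rw [indicator_of_notMem hx, h6, abs_zero, mul_zero]
          positivity
      rw [integral_add ((hIint k).div_const 2) ((hg j).const_mul _), integral_div,
        integral_const_mul] at h4
      have h7 : 2 ^ n * ∫ x, |g j x| ^ (n + 1) ∂μ ≤ 2 ^ n * M := by
        gcongr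
        exact hM j
      linarith
    have h8 := le_of_tendsto' h2 h3
    rw [pow_succ]
    linarith
  have hmain : ∫⁻ x, ENNReal.ofReal (|G' x| ^ (n + 1)) ∂μ ≤ ENNReal.ofReal (2 ^ (n + 1) * M) := by
    have hU : (⋃ k, S k) = univ := by
      refine eq_univ_of_forall fun x => mem_iUnion.2 ?_
      obtain ⟨k, hk⟩ := exists_nat_ge |G' x|
      exact ⟨k, hk⟩
    have hmono : Monotone S := fun k l hkl x hx => show |G' x| ≤ l from
      le_trans (show |G' x| ≤ k from hx) (by exact_mod_cast hkl)
    rw [← setLIntegral_univ, ← hU, setLIntegral_iUnion_of_directed _ hmono.directed_le]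
    refine iSup_le fun k => ?_
    rw [← lintegral_indicator (hSm k)]
    refine le_trans (le_of_eq ?_) (ENNReal.ofReal_le_ofReal (hI k))
    rw [ofReal_integral_eq_lintegral_ofReal (hIint k)
      (Eventually.of_forall fun x => indicator_nonneg (fun _ _ => by positivity) x)]
    refine lintegral_congr fun x => ?_
    by_cases hx : x ∈ S k <;> simp [hx]
  rw [memLp_congr_ae hGG']
  rw [← integrable_norm_rpow_iff hG'm.aestronglyMeasurable (by simp) (by simp)]
  simp only [ENNReal.toReal_natCast, Real.rpow_natCast, Real.norm_eq_abs]
  refine ⟨(hG'meas.abs.pow_const _).aestronglyMeasurable, ?_⟩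
  rw [hasFiniteIntegral_iff_ofReal (Eventually.of_forall fun x => by positivity)]
  exact hmain.trans_lt ENNReal.ofReal_lt_top

end WeakLimit

/-! ### Integration by parts and Sobolev regularity of uniform limits. -/

section Sobolev
variable {d : ℕ}

theorem TorusC1.mul {f g : UnitAddTorus (Fin d) → ℝ} {f' g' : UnitAddTorus (Fin d) → Euc d →L[ℝ] ℝ}
    (hf : TorusC1 f f') (hg : TorusC1 g g') :
    TorusC1 (fun y => f y * g y) (fun y => f y • g' y + g y • f' y) := by
  have h1 := hf.continuous
  have h2 := hg.continuous
  have h3 := hf.1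
  have h4 := hg.1
  refine ⟨by fun_prop, fun y => ?_⟩
  have := (hf.2 y).mul (hg.2 y)
  simpa using! this

/-- By translation invariance the integral of f(· + s eⱼ) is constant in s; differentiate under the
integral at s = 0. -/
theorem TorusC1.integral_deriv_eq_zero {f : UnitAddTorus (Fin d) → ℝ}
    {f' : UnitAddTorus (Fin d) → Euc d →L[ℝ] ℝ} (hf : TorusC1 f f') (j : Fin d) :
    ∫ y, f' y (EuclideanSpace.single j 1) = 0 := by
  have hc := hf.continuous
  have hc' := hf.1
  obtain ⟨g, hg, hge⟩ : ∃ g : UnitAddTorus (Fin d) → ℝ, Continuous g ∧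
      ∀ y, g y = f' y (EuclideanSpace.single j 1) := ⟨_, by fun_prop, fun _ => rfl⟩
  obtain ⟨q, hq0, hq⟩ : ∃ q : ℝ → UnitAddTorus (Fin d), q 0 = 0 ∧
      ∀ y s, HasDerivAt (fun s => f (y + q s)) (g (y + q s)) s := by
    refine ⟨fun s => Pi.single j (s : UnitAddCircle), by simp, fun y s => ?_⟩
    rw [hge]
    exact hf.hasDerivAt_single j y s
  obtain ⟨M, -, hM⟩ := exists_norm_bound hg
  have hfq : ∀ s, Continuous fun y => f (y + q s) := fun s => hc.comp (continuous_add_const _)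
  have hgq : ∀ s, Continuous fun y => g (y + q s) := fun s => hg.comp (continuous_add_const _)
  have h := (hasDerivAt_integral_of_dominated_loc_of_deriv_le (μ := volume) (𝕜 := ℝ)
    (F := fun s y => f (y + q s)) (F' := fun s y => g (y + q s))
    (x₀ := 0) (bound := fun _ => M) (s := univ) univ_mem
    (Eventually.of_forall fun s => (hfq s).aestronglyMeasurable)
    (hfq 0).integrable_torus (hgq 0).aestronglyMeasurable
    (Eventually.of_forall fun y s _ => hM _) (integrable_const _)
    (Eventually.of_forall fun y s _ => hq y s)).2
  simp only [integral_add_right_eq_self f, hq0, add_zero] at h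
  simp only [← hge]
  exact h.unique (hasDerivAt_const _ _)

theorem TorusC1.integral_mul_deriv {f g : UnitAddTorus (Fin d) → ℝ}
    {f' g' : UnitAddTorus (Fin d) → Euc d →L[ℝ] ℝ}
    (hf : TorusC1 f f') (hg : TorusC1 g g') (j : Fin d) :
    ∫ y, f y * g' y (EuclideanSpace.single j 1) =
      -∫ y, f' y (EuclideanSpace.single j 1) * g y := by
  have h1 := hf.continuous
  have h2 := hg.continuous
  have h3 := hf.1
  have h4 := hg.1
  have h := (hf.mul hg).integral_deriv_eq_zero j
  simp only [add_apply, smul_apply, smul_eq_mul] at h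
  rw [integral_add (by fun_prop : Continuous fun y =>
      f y * g' y (EuclideanSpace.single j 1)).integrable_torus (by fun_prop : Continuous fun y =>
      g y * f' y (EuclideanSpace.single j 1)).integrable_torus] at h
  simp only [mul_comm (g _)] at h
  linarith

theorem TorusC1.apply {f : UnitAddTorus (Fin d) → Euc d}
    {f' : UnitAddTorus (Fin d) → Euc d →L[ℝ] Euc d} (hf : TorusC1 f f') (i : Fin d) :
    TorusC1 (fun y => f y i) fun y => (EuclideanSpace.proj i : Euc d →L[ℝ] ℝ).comp (f' y) := by
  have h := hf.1
  refine ⟨by fun_prop, fun y => ?_⟩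
  exact (EuclideanSpace.proj i : Euc d →L[ℝ] ℝ).hasFDerivAt.comp 0 (hf.2 y)

/-- The derivatives have a weak L² limit G, which lies in every Lᵖ by the uniform bounds.
Integration by parts passes to the limit, uniformly on the side of u and weakly on the side of u',
so the same G is the weak gradient for all p. -/
theorem memW1p_of_tendsto {u : ℕ → UnitAddTorus (Fin d) → Euc d}
    {u' : ℕ → UnitAddTorus (Fin d) → Euc d →L[ℝ] Euc d} (hu : ∀ j, TorusC1 (u j) (u' j))
    (hM : ∀ p : ℕ, 1 ≤ p → ∃ M : ℝ≥0∞, M ≠ ⊤ ∧ ∀ j, ∫⁻ x, ENNReal.ofReal (‖u' j x‖ ^ p) ≤ M)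
    {v : UnitAddTorus (Fin d) → Euc d} (hlim : ∀ ε > 0, ∀ᶠ j in atTop, ∀ x, ‖u j x - v x‖ ≤ ε) :
    Continuous v ∧ ∀ p : ℝ≥0∞, p ≠ ⊤ → MemW1p p v := by
  have hvc : Continuous v := by
    have h1 : TendstoUniformly u v atTop := by
      rw [Metric.tendstoUniformly_iff]
      intro ε hε
      filter_upwards [hlim (ε / 2) (half_pos hε)] with j hj x
      rw [dist_comm, dist_eq_norm]
      linarith [hj x]
    exact h1.continuous (Frequently.of_forall fun j => (hu j).continuous)
  refine ⟨hvc, ?_⟩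
  set g : Fin d → Fin d → ℕ → UnitAddTorus (Fin d) → ℝ := fun a c j y =>
    (u' j y (EuclideanSpace.single c 1)) a with hg
  have hgc : ∀ a c j, Continuous (g a c j) := fun a c j => by
    have := (hu j).1
    simp only [hg]
    fun_prop
  have hgle : ∀ a c j y, |g a c j y| ≤ ‖u' j y‖ := fun a c j y => by
    refine (euc_abs_apply_le _ a).trans ((ContinuousLinearMap.le_opNorm _ _).trans ?_)
    simp
  have hgi : ∀ a c j (n : ℕ), Integrable fun x => |g a c j x| ^ n := fun a c j n => by
    have := hgc a c j
    exact (by fun_prop : Continuous fun x => |g a c j x| ^ n).integrable_torus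
  have hgM : ∀ n : ℕ, 1 ≤ n → ∃ M : ℝ, ∀ a c j, ∫ x, |g a c j x| ^ n ≤ M := by
    intro n hn
    obtain ⟨M, hMt, hM⟩ := hM n hn
    refine ⟨M.toReal, fun a c j => ?_⟩
    rw [integral_eq_lintegral_of_nonneg_ae (Eventually.of_forall fun x => by positivity)
      (hgi a c j n).1]
    refine ENNReal.toReal_mono hMt (le_trans (lintegral_mono fun x => ?_) (hM j))
    exact ENNReal.ofReal_le_ofReal (pow_le_pow_left₀ (abs_nonneg _) (hgle a c j x) n)
  have hg2 : ∀ a c j, MemLp (g a c j) 2 volume := fun a c j =>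
    (hgc a c j).memLp_of_hasCompactSupport (HasCompactSupport.of_compactSpace _)
  obtain ⟨M₂, hM₂⟩ := hgM 2 (by norm_num)
  have hex : ∀ a c, ∃ G : UnitAddTorus (Fin d) → ℝ, MemLp G 2 volume ∧
      ∀ φ : UnitAddTorus (Fin d) → ℝ, MemLp φ 2 volume →
      Tendsto (fun j => ∫ x, g a c j x * φ x) (hyperfilter ℕ : Filter ℕ)
        (𝓝 (∫ x, G x * φ x)) := fun a c =>
    exists_weak_limit (hg2 a c) (M := M₂) fun j => by simpa using hM₂ a c j
  choose G hG2 hG using hex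
  have hGp : ∀ a c, ∀ n : ℕ, MemLp (G a c) (n + 1 : ℕ) volume := fun a c n => by
    obtain ⟨M, hMn⟩ := hgM (n + 1) (by omega)
    exact memLp_of_weak_limit (hG2 a c) (hG a c) (fun j => hgi a c j (n + 1)) (hg2 a c)
      fun j => hMn a c j
  intro p hp
  obtain ⟨n, hn⟩ := ENNReal.exists_nat_gt hp
  have hpn : p ≤ ((n + 1 : ℕ) : ℝ≥0∞) := hn.le.trans (by exact_mod_cast Nat.le_succ n)
  refine ⟨hvc.memLp_of_hasCompactSupport (HasCompactSupport.of_compactSpace _),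
    fun y => Matrix.of fun a c => G a c y, fun a c => ⟨?_, ?_, fun φ hφ => ?_⟩, fun a c => ?_⟩
  · exact (by fun_prop : Continuous fun y => v y a).integrable_torus
  · simpa using (hG2 a c).integrable (by norm_num)
  · have hφ1 := hφ.torusC1
    have hφc := hφ1.continuous
    have hφc' := hφ1.1
    have hpart : ∀ y, torusPartial c φ y = torusFDeriv φ y (EuclideanSpace.single c 1) := fun y =>
      hφ1.torusPartial_eq c y
    simp only [hpart, Matrix.of_apply]
    have hpc : Continuous fun y => torusFDeriv φ y (EuclideanSpace.single c 1) := by fun_prop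
    obtain ⟨K, hK0, hK⟩ := exists_norm_bound hpc
    have hl1 : Tendsto (fun j => ∫ y, u j y a * torusFDeriv φ y (EuclideanSpace.single c 1))
        (hyperfilter ℕ : Filter ℕ)
        (𝓝 (∫ y, v y a * torusFDeriv φ y (EuclideanSpace.single c 1))) := by
      refine Tendsto.mono_left ?_ Nat.hyperfilter_le_atTop
      rw [Metric.tendsto_atTop']
      intro ε hε
      obtain ⟨J, hJ⟩ := eventually_atTop.1 (hlim (ε / (2 * (K + 1))) (by positivity))
      refine ⟨J, fun j hj => ?_⟩
      have huc := (hu j).continuous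
      rw [dist_eq_norm, ← integral_sub (by fun_prop : Continuous fun y => u j y a *
          torusFDeriv φ y (EuclideanSpace.single c 1)).integrable_torus
        (by fun_prop : Continuous fun y => v y a *
          torusFDeriv φ y (EuclideanSpace.single c 1)).integrable_torus]
      have h3 : ‖∫ y, (u j y a * torusFDeriv φ y (EuclideanSpace.single c 1) -
          v y a * torusFDeriv φ y (EuclideanSpace.single c 1))‖ ≤
          (ε / (2 * (K + 1)) * K) * (volume : Measure (UnitAddTorus (Fin d))).real univ := by
        refine norm_integral_le_of_norm_le_const (Eventually.of_forall fun y => ?_)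
        rw [← sub_mul, norm_mul]
        gcongr
        · have := euc_abs_apply_le (u j y - v y) a
          exact (le_trans (by simp) this).trans (hJ j hj.le y)
        · exact hK y
      refine h3.trans_lt ?_
      simp only [probReal_univ, mul_one]
      have h4 : ε / (2 * (K + 1)) * K = ε / 2 * (K / (K + 1)) := by field_simp
      have h5 : K / (K + 1) ≤ 1 := by rw [div_le_one (by positivity)]; linarith
      rw [h4]
      nlinarith
    have hl2 : Tendsto (fun j => -∫ y, g a c j y * φ y) (hyperfilter ℕ : Filter ℕ)
        (𝓝 (-∫ y, G a c y * φ y)) :=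
      (hG a c φ (hφc.memLp_of_hasCompactSupport (HasCompactSupport.of_compactSpace _))).neg
    refine tendsto_nhds_unique hl1 (hl2.congr fun j => ?_)
    exact (((hu j).apply a).integral_mul_deriv hφ1 c).symm
  · simpa using (hGp a c n).mono_exponent hpn

end Sobolev

/-! ### Time reversal and the flow -/

section Flow
variable {d : ℕ}

theorem measurePreserving_sub_left_restrict_Icc (t₀ : ℝ) :
    MeasurePreserving (fun s => t₀ - s) (volume.restrict (Icc 0 t₀))
      (volume.restrict (Icc 0 t₀)) := by
  have h := (Measure.measurePreserving_sub_left volume t₀).restrict_preimage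
    (measurableSet_Icc (a := 0) (b := t₀))
  simpa using h

theorem MemW1p.zero (p : ℝ≥0∞) : MemW1p p (fun _ : UnitAddTorus (Fin d) => (0 : Euc d)) :=
  ⟨MemLp.zero, fun _ => 0, fun _ _ => ⟨by simp, by simp, by simp⟩, fun _ _ => by simp⟩

theorem IsWeakGradient.neg {f : UnitAddTorus (Fin d) → Euc d}
    {G : UnitAddTorus (Fin d) → Matrix (Fin d) (Fin d) ℝ} (h : IsWeakGradient f G) :
    IsWeakGradient (fun y => -f y) fun y => -G y := by
  intro i j
  obtain ⟨h1, h2, h3⟩ := h i j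
  refine ⟨by simpa using! h1.neg, by simpa using! h2.neg, fun φ hφ => ?_⟩
  have h4 := h3 φ hφ
  simp only [PiLp.neg_apply, Matrix.neg_apply, neg_mul, integral_neg]
  rw [h4]

section
variable {T L : ℝ} {C : ℝ → ℝ} {b : ℝ → UnitAddTorus (Fin d) → Euc d}
    {D : ℝ → UnitAddTorus (Fin d) → Matrix (Fin d) (Fin d) ℝ}

theorem ExpField.restrict (H : ExpField T L C b D) {t₀ : ℝ} (ht₀ : t₀ ≤ T) :
    ExpField t₀ L C b D := by
  have hsub : Icc 0 t₀ ⊆ Icc 0 T := Icc_subset_Icc_right ht₀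
  have hle : (volume : Measure ℝ).restrict (Icc 0 t₀) ≤ volume.restrict (Icc 0 T) :=
    Measure.restrict_mono_set _ hsub
  exact ⟨H.dim_pos, H.integrable.mono_measure (Measure.prod_mono hle le_rfl),
    fun t ht => H.grad t (hsub ht), H.C_nonneg, fun β hβ t ht => H.exp_le β hβ t (hsub ht),
    ae_mono hle H.div_le⟩

theorem ExpField.reverse (H : ExpField T L C b D) :
    ExpField T L C (fun s y => -b (T - s) y) fun s y => -D (T - s) y := by
  have hmp := measurePreserving_sub_left_restrict_Icc T
  have hmem : ∀ t ∈ Icc 0 T, T - t ∈ Icc 0 T := fun t ht =>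
    ⟨sub_nonneg.2 ht.2, sub_le_self T ht.1⟩
  refine ⟨H.dim_pos, ?_, fun t ht => (H.grad _ (hmem t ht)).neg, H.C_nonneg,
    fun β hβ t ht => ?_, ?_⟩
  · exact ((hmp.prod (MeasurePreserving.id volume)).integrable_comp_of_integrable
      H.integrable).neg
  · simpa only [matrixAbs_neg] using H.exp_le β hβ _ (hmem t ht)
  · filter_upwards [hmp.quasiMeasurePreserving.ae H.div_le] with t ht
    filter_upwards [ht] with x hx
    simpa using hx

end

theorem IsApproxSol.eq_integral {T : ℝ} {c : ℝ → UnitAddTorus (Fin d) → Euc d}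
    {x : UnitAddTorus (Fin d)} {w : ℝ → Euc d} (h : IsApproxSol T c 0 x w) {t : ℝ}
    (ht : t ∈ Icc 0 T) : w t = ∫ s in (0 : ℝ)..t, c s (x + torusProj (w s)) :=
  sub_eq_zero.1 (norm_le_zero_iff.1 (h.2 t ht))

/-- Running the curve backwards from its endpoint solves the reversed equation; subtracting w(T)
recentres the displacement at the new starting point. -/
theorem IsApproxSol.reverse {T : ℝ} (hT : 0 ≤ T) {c c' : ℝ → UnitAddTorus (Fin d) → Euc d}
    {x : UnitAddTorus (Fin d)} {w : ℝ → Euc d} (h : IsApproxSol T c 0 x w)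
    (hi : IntegrableOn (fun s => c s (x + torusProj (w s))) (Icc 0 T))
    (hc : ∀ s ∈ Icc 0 T, ∀ y, c' s y = -c (T - s) y) :
    IsApproxSol T c' 0 (x + torusProj (w T)) fun s => w (T - s) - w T := by
  have hmem : ∀ t ∈ Icc 0 T, T - t ∈ Icc 0 T := fun t ht =>
    ⟨sub_nonneg.2 ht.2, sub_le_self T ht.1⟩
  have h0T : (0 : ℝ) ∈ Icc 0 T := ⟨le_rfl, hT⟩
  have hTT : T ∈ Icc 0 T := ⟨hT, le_rfl⟩
  refine ⟨(h.1.comp (by fun_prop) hmem).sub continuousOn_const, fun t ht => ?_⟩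
  have h1 : ∫ s in (0 : ℝ)..t, c' s (x + torusProj (w T) + torusProj (w (T - s) - w T)) =
      ∫ s in (0 : ℝ)..t, -c (T - s) (x + torusProj (w (T - s))) := by
    refine intervalIntegral.integral_congr fun s hs => ?_
    rw [uIcc_of_le ht.1] at hs
    have h2 : x + torusProj (w T) + torusProj (w (T - s) - w T) = x + torusProj (w (T - s)) := by
      rw [torusProj_sub]; abel
    simp only [h2]
    exact hc s ⟨hs.1, hs.2.trans ht.2⟩ _
  have h3 : ∫ s in (0 : ℝ)..t, -c (T - s) (x + torusProj (w (T - s))) =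
      -∫ s in (T - t)..T, c s (x + torusProj (w s)) := by
    rw [intervalIntegral.integral_neg,
      intervalIntegral.integral_comp_sub_left (fun s => c s (x + torusProj (w s))) T, sub_zero]
  have h4 := intervalIntegral.integral_add_adjacent_intervals
    (intervalIntegrable_of_Icc hi h0T (hmem t ht)) (intervalIntegrable_of_Icc hi (hmem t ht) hTT)
  rw [← h.eq_integral hTT, ← h.eq_integral (hmem t ht)] at h4
  rw [h1, h3, ← h4]
  simp

section
variable {T L : ℝ} {C : ℝ → ℝ} {b : ℝ → UnitAddTorus (Fin d) → Euc d}
    {D : ℝ → UnitAddTorus (Fin d) → Matrix (Fin d) (Fin d) ℝ}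

/-- By uniqueness for the reversed field, its solution from the endpoint is the backward curve,
which returns to x. Thus the two time-T maps are inverse to each other. -/
theorem ExpField.reverse_eq_neg (H : ExpField T L C b D) (hT : 0 ≤ T)
    {b' : ℝ → UnitAddTorus (Fin d) → Euc d}
    {D' : ℝ → UnitAddTorus (Fin d) → Matrix (Fin d) (Fin d) ℝ} (H' : ExpField T L C b' D')
    (hb : ∀ s ∈ Icc 0 T, ∀ y, contRep (b' s) y = -contRep (b (T - s)) y)
    {x : UnitAddTorus (Fin d)} {w w' : ℝ → Euc d}
    (hw : IsApproxSol T (fun s => contRep (b s)) 0 x w)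
    (hw' : IsApproxSol T (fun s => contRep (b' s)) 0 (x + torusProj (w T)) w') :
    w' T = -w T := by
  have hTT : T ∈ Icc 0 T := ⟨hT, le_rfl⟩
  have h0 : w 0 = 0 := by simpa using hw.eq_integral ⟨le_rfl, hT⟩
  have h := H'.unique hT hw' (hw.reverse hT
    (H.integrableOn_contRep x (hw.1.aestronglyMeasurable measurableSet_Icc)) hb) hTT
  simpa [h0] using h

theorem ExpField.isFlow (H : ExpField T L C b D) {v : UnitAddTorus (Fin d) → ℝ → Euc d}
    (hv : ∀ x, IsApproxSol T (fun s => contRep (b s)) 0 x (v x)) :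
    IsFlow T (fun s => contRep (b s)) fun t x => x + torusProj (v x t) := fun x =>
  ⟨H.integrableOn_contRep x ((hv x).1.aestronglyMeasurable measurableSet_Icc),
    fun _ ht => by rw [← (hv x).eq_integral ht]⟩

/-- A competing flow is not assumed continuous in time, but the primitive of its velocity is, and
this primitive is an exact solution. -/
theorem ExpField.flow_unique (H : ExpField T L C b D) (hT : 0 ≤ T)
    {v : UnitAddTorus (Fin d) → ℝ → Euc d}
    (hv : ∀ x, IsApproxSol T (fun s => contRep (b s)) 0 x (v x))
    {Z : ℝ → UnitAddTorus (Fin d) → UnitAddTorus (Fin d)}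
    (hZ : IsFlow T (fun s => contRep (b s)) Z) {t : ℝ} (ht : t ∈ Icc 0 T)
    (x : UnitAddTorus (Fin d)) : Z t x = x + torusProj (v x t) := by
  obtain ⟨hi, he⟩ := hZ x
  have h0T : (0 : ℝ) ∈ Icc 0 T := ⟨le_rfl, hT⟩
  set w : ℝ → Euc d := fun t => ∫ s in (0 : ℝ)..t, contRep (b s) (Z s x) with hw
  have hws : IsApproxSol T (fun s => contRep (b s)) 0 x w := by
    refine ⟨?_, fun t ht => ?_⟩
    · have := intervalIntegral.continuousOn_primitive_interval' (a := 0)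
        (intervalIntegrable_of_Icc hi h0T ⟨hT, le_rfl⟩) (by simp)
      rwa [uIcc_of_le hT] at this
    · have h1 : ∫ s in (0 : ℝ)..t, contRep (b s) (x + torusProj (w s)) = w t := by
        refine intervalIntegral.integral_congr fun s hs => ?_
        rw [uIcc_of_le ht.1] at hs
        rw [he s ⟨hs.1, hs.2.trans ht.2⟩]
      rw [h1, sub_self, norm_zero]
  rw [he t ht, H.unique hT (hv x) hws ht]

/-- The regularity produced by `ExpField.exists_flow` concerns the final time only, so it is applied
on [0, t], to the field and to its reversal about t. -/
theorem ExpField.exists_inverse (H : ExpField T L C b D)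
    {v : UnitAddTorus (Fin d) → ℝ → Euc d}
    (hv : ∀ x, IsApproxSol T (fun s => contRep (b s)) 0 x (v x)) {t : ℝ} (ht : t ∈ Icc 0 T) :
    ∃ Y : UnitAddTorus (Fin d) → UnitAddTorus (Fin d),
      Function.LeftInverse Y (fun x => x + torusProj (v x t)) ∧
      Function.RightInverse Y (fun x => x + torusProj (v x t)) ∧
      ∀ p : ℝ≥0∞, 1 ≤ p → p ≠ ⊤ →
        TorusMapMemW1p p (fun x => x + torusProj (v x t)) ∧ TorusMapMemW1p p Y := by
  have hvt : ∀ x, IsApproxSol t (fun s => contRep (b s)) 0 x (v x) := fun x =>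
    ⟨(hv x).1.mono (Icc_subset_Icc_right ht.2), fun s hs => (hv x).2 s ⟨hs.1, hs.2.trans ht.2⟩⟩
  -- The existence theorem needs a time interval of positive length; at t = 0 the map is the
  -- identity.
  rcases ht.1.eq_or_lt with rfl | ht0
  · have h0 : ∀ x, v x 0 = 0 := fun x => by simpa using (hvt x).eq_integral ⟨le_rfl, le_rfl⟩
    have hid : ∀ p : ℝ≥0∞, TorusMapMemW1p p (id : UnitAddTorus (Fin d) → _) := fun p =>
      ⟨fun _ => 0, continuous_const, fun y => by simp [torusProj_zero], MemW1p.zero p⟩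
    simp only [h0, torusProj_zero, add_zero]
    exact ⟨id, fun _ => rfl, fun _ => rfl, fun p _ _ => ⟨hid p, hid p⟩⟩
  have H₁ := H.restrict ht.2
  have H₂ := H₁.reverse
  have hmem : ∀ s ∈ Icc 0 t, t - s ∈ Icc 0 t := fun s hs =>
    ⟨sub_nonneg.2 hs.2, sub_le_self t hs.1⟩
  have hneg : ∀ s ∈ Icc 0 t, ∀ y,
      contRep (fun y => -b (t - s) y) y = -contRep (b (t - s)) y := fun s hs y =>
    H₁.contRep_neg (hmem s hs) y
  obtain ⟨v₁, hv₁, u₁, u₁', hu₁, hM₁, hl₁⟩ := H₁.exists_flow ht0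
  obtain ⟨v₂, hv₂, u₂, u₂', hu₂, hM₂, hl₂⟩ := H₂.exists_flow ht0
  -- The flow constructed on [0, t] agrees with the given one by uniqueness, and transfers its
  -- Sobolev regularity.
  have heq : ∀ x, v x t = v₁ x t := fun x => H₁.unique ht0.le (hvt x) (hv₁ x) ⟨ht0.le, le_rfl⟩
  obtain ⟨hc₁, hS₁⟩ := memW1p_of_tendsto hu₁ hM₁ hl₁
  obtain ⟨hc₂, hS₂⟩ := memW1p_of_tendsto hu₂ hM₂ hl₂
  simp only [heq]
  refine ⟨fun y => y + torusProj (v₂ y t), fun x => ?_, fun y => ?_, fun p _ hp =>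
    ⟨⟨_, hc₁, fun _ => rfl, hS₁ p hp⟩, ⟨_, hc₂, fun _ => rfl, hS₂ p hp⟩⟩⟩
  · have h := H₁.reverse_eq_neg ht0.le H₂ hneg (hv₁ x) (hv₂ _)
    simp only [h, torusProj_neg, add_neg_cancel_right]
  · have h := H₂.reverse_eq_neg ht0.le H₁ (fun s hs y => by
      rw [hneg _ (hmem s hs), neg_neg, sub_sub_cancel]) (hv₂ y) (hv₁ _)
    simp only [h, torusProj_neg, add_neg_cancel_right]

end

theorem exists_expField {T : ℝ} (hd : 1 ≤ d)
    {b : ℝ → UnitAddTorus (Fin d) → Euc d}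
    {D : ℝ → UnitAddTorus (Fin d) → Matrix (Fin d) (Fin d) ℝ}
    (hb : Integrable (fun z : ℝ × UnitAddTorus (Fin d) => b z.1 z.2)
      ((volume.restrict (Icc 0 T)).prod volume))
    (hD : ∀ t ∈ Icc 0 T, IsWeakGradient (b t) (D t))
    (hexp : ∀ β : ℝ, 0 < β →
      (⨆ t ∈ Icc 0 T, ∫⁻ x, ENNReal.ofReal (Real.exp (β * matrixAbs (D t x)))) < (⊤ : ℝ≥0∞))
    (hdiv : ∃ L : ℝ, ∀ᵐ t ∂(volume.restrict (Icc 0 T)),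
      ∀ᵐ x : UnitAddTorus (Fin d), |(D t x).trace| ≤ L) :
    ∃ L C, ExpField T L C b D := by
  obtain ⟨L, hL⟩ := hdiv
  refine ⟨L, fun β => (⨆ t ∈ Icc 0 T,
    ∫⁻ x, ENNReal.ofReal (Real.exp (β * matrixAbs (D t x)))).toReal, hd, hb, hD,
    fun _ => ENNReal.toReal_nonneg, fun β hβ t ht => ?_, hL⟩
  rw [ENNReal.ofReal_toReal (hexp β hβ).ne]
  exact le_iSup₂ (f := fun t (_ : t ∈ Icc 0 T) =>
    ∫⁻ x, ENNReal.ofReal (Real.exp (β * matrixAbs (D t x)))) t ht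

end Flow

/-! ### The main theorem. -/

theorem corollary1p5 (d : ℕ) (hd : 1 ≤ d) (T : ℝ) (hT : 0 < T)
    (b : ℝ → UnitAddTorus (Fin d) → Euc d)
    (D : ℝ → UnitAddTorus (Fin d) → Matrix (Fin d) (Fin d) ℝ)
    (hb : Integrable (fun z : ℝ × UnitAddTorus (Fin d) => b z.1 z.2)
      ((volume.restrict (Icc 0 T)).prod volume))
    (hD : ∀ t ∈ Icc 0 T, IsWeakGradient (b t) (D t))
    (hexp : ∀ β : ℝ, 0 < β →
      (⨆ t ∈ Icc 0 T, ∫⁻ x, ENNReal.ofReal (Real.exp (β * matrixAbs (D t x)))) < (⊤ : ℝ≥0∞))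
    (hdiv : ∃ L : ℝ, ∀ᵐ t ∂(volume.restrict (Icc 0 T)),
      ∀ᵐ x : UnitAddTorus (Fin d), |(D t x).trace| ≤ L) :
    -- the continuous representative of `b`
    ∃ b' : ℝ → UnitAddTorus (Fin d) → Euc d,
      (∀ t ∈ Icc 0 T, Continuous (b' t) ∧ b' t =ᵐ[volume] b t) ∧
      -- its flow, which exists and is unique
      ∃ X : ℝ → UnitAddTorus (Fin d) → UnitAddTorus (Fin d),
        IsFlow T b' X ∧
        (∀ Z, IsFlow T b' Z → ∀ t ∈ Icc 0 T, Z t = X t) ∧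
        ∀ t ∈ Icc 0 T, ∃ Y : UnitAddTorus (Fin d) → UnitAddTorus (Fin d),
          Function.LeftInverse Y (X t) ∧ Function.RightInverse Y (X t) ∧
          ∀ p : ℝ≥0∞, 1 ≤ p → p ≠ ⊤ →
            TorusMapMemW1p p (X t) ∧ TorusMapMemW1p p Y := by
  obtain ⟨L, C, H⟩ := exists_expField hd hb hD hexp hdiv
  obtain ⟨v, hv, -⟩ := H.exists_flow hT
  exact ⟨fun s => contRep (b s), fun t ht => ⟨H.continuous_contRep ht, H.contRep_ae_eq ht⟩,
    fun t x => x + torusProj (v x t), H.isFlow hv,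
    fun Z hZ t ht => funext fun x => H.flow_unique hT.le hv hZ ht x,
    fun t ht => H.exists_inverse hv ht⟩
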